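/- Let $N\ge 1$, $K\ge 0$, $A>1$, $F\in C(\mathbf R^N\times(0,\infty)\times\mathbf R\times\mathbf R^N)$, and let $\varphi\in L^1_K$, i.e. $\varphi\in L^1(\mathbf R^N)$ and $\int_{\mathbf R^N}(1+|x|)^K|\varphi|\,dx<\infty$. Write $G(x,t)=(4\pi t)^{-N/2}e^{-|x|^2/4t}$, $(e^{t\Delta}f)(x)=\int_{\mathbf R^N} G(x-\xi,t)f(\xi)\,d\xi$, $\|\cdot\|_q$ for the $L^q(\mathbf R^N)$ norm, $|||f|||_l=\int_{\mathbf R^N}(1+|x|)^l|f(x)|\,dx$, and $[K]$ for the integer part of $K$. **Solutions.** Let $u\in L^\infty_{loc}(0,\infty;W^{1,1}(\mathbf R^N))$ be a solution of $\partial_tu=\Delta u+F(x,t,u,\nabla u)$, $u(\cdot,0)=\varphi$, that is, $$u(x,t)=\int_{\mathbf R^N}G(x-\xi,t)\varphi(\xi)\,d\xi+\int_0^t\!\int_{\mathbf R^N}G(x-\xi,t-s)F(\xi,s,u(\xi,s),\nabla u(\xi,s))\,d\xi\,ds\qquad(*)$$ (absolutely convergent double integral) for almost all $(x,t)\in\mathbf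 R^N\times(0,\infty)$. Call $t>0$ *regular* if $(*)$ holds at time $t$ for almost every $x$ and $\nabla u(t)$ is the weak gradient of $u(t)$. Almost every $t>0$ is regular (and every $t>0$ is, for the representative of $u$ that satisfies $(*)$ at all times). **Assumptions on $u$ and $F$.** Assume that for all $q\in[1,\infty]$ and $l\in[0,K]$ $$\sup_{t>0}t^{\frac N2(1-\frac1q)}\big[\|u(t)\|_q+t^{\frac12}\|\nabla u(t)\|_q\big]<\infty,\qquad \sup_{t>0}(1+t)^{-\frac l2}\big[|||u(t)|||_l+t^{\frac12}|||\nabla u(t)|||_l\big]<\infty$$ (essential suprema), and that for some constant $C_*$ $$(C_A)\quad |F(x,t,u,\nabla u)|\le C_*(1+t)^{-A}\big(|u(x,t)|+(1+t)^{1/2}|\nabla u(x,t)|\big)\quad\text{for almost all }(x,t).$$ Let $\mathcal S$ be the set of measurable $v$ on $\mathbf R^N\times(0,\infty)$ with a measurable weak spatial gradient such that $v\in L^\infty_{loc}(0,\infty;W^{1,\infty}(\mathbf R^N))$ and $\sup_{t>0}t^{N/2}[\|v(t)\|_\infty+t^{1/2}\|\nabla v(t)\|_\infty]<\infty$. Condition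 $(F_A)$ says that $F(x,t,0,0)=0$ for all $(x,t)\in\mathbf R^N\times(0,\infty)$, and that for all $v_1,v_2\in\mathcal S$ there is a constant $C$ with $$|F(x,t,v_1,\nabla v_1)-F(x,t,v_2,\nabla v_2)|\le C(1+t)^{-A}\big(|v_1-v_2|+(1+t)^{1/2}|\nabla v_1-\nabla v_2|\big)\quad\text{for almost all }(x,t).$$ **The functions $U_n$.** For multi-indices $\alpha$ put $g_\alpha(x,t)=\frac{(-1)^{|\alpha|}}{\alpha!}(\partial_x^\alpha G)(x,1+t)$, and define inductively $M_\alpha(f,t)=\int_{\mathbf R^N} x^\alpha f\,dx$ if $|\alpha|\le1$ and $$M_\alpha(f,t)=\int_{\mathbf R^N} x^\alpha f\,dx-\sum_{\rho\le\alpha,\ \rho\ne\alpha}M_\rho(f,t)\int_{\mathbf R^N} x^\alpha g_\rho(x,t)\,dx\quad\text{if }|\alpha|\ge2.$$ Put $P_k(t)f=f-\sum_{|\alpha|\le k}M_\alpha(f,t)g_\alpha(\cdot,t)$ and $$U_0(x,t)=\sum_{|\alpha|\le[K]}M_\alpha(u(t),t)g_\alpha(x,t),\qquad U_n(x,t)=U_0(x,t)+\int_0^te^{(t-s)\Delta}P_{[K]}(s)F_{n-1}(s)\,ds\quad(n\ge1),$$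 where $F_{n-1}(x,t)=F(x,t,U_{n-1}(x,t),\nabla_xU_{n-1}(x,t))$. **Theorem.** Let $n\in\{0,1,2,\dots\}$ and, if $n\ge1$, assume $(F_A)$. Then $U_n$ is well defined (the integrals in its definition converge absolutely, those of $x^\alpha u(t)$ for every regular $t$ and those of $x^\alpha F_m(s)$, $m<n$, for almost every $s>0$), $U_n(\cdot,t)\in C^1(\mathbf R^N)$ for all $t>0$, and the following holds, where $t$ runs over the regular times and the constants do not depend on $t$. (i) For any $q\in[1,\infty]$ and $l\in[0,K]$, $$\sup_{t>0}t^{\frac N2(1-\frac1q)}\big[\|U_n(t)\|_q+t^{\frac12}\|\nabla U_n(t)\|_q\big]<\infty,\qquad \sup_{t>0}(1+t)^{-\frac l2}\big[|||U_n(t)|||_l+t^{\frac12}|||\nabla U_n(t)|||_l\big]<\infty.$$ (ii) For any $q\in[1,\infty]$ and $j=0,1$ there is a constant $C$ such that, for all $t>0$, $$t^{\frac N2(1-\frac1q)+\frac j2}\|\nabla^j[u(t)-U_n(t)]\|_q\le\begin{cases}C\big[(1+t)^{-\frac K2}+(1+t)^{-(n+1)(A-1)}\big]&\text{if }2(n+1)(A-1)\ne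 K,\\ C(1+t)^{-\frac K2}\log(2+t)&\text{if }2(n+1)(A-1)=K.\end{cases}$$ (iii) If $2(n+1)(A-1)>K$, then for any $q\in[1,\infty]$ and $j=0,1$, as $t\to\infty$, $$t^{\frac N2(1-\frac1q)+\frac j2}\|\nabla^j[u(t)-U_n(t)]\|_q=\begin{cases}o(t^{-K/2})&\text{if }K=[K],\\ O(t^{-K/2})&\text{if }K>[K].\end{cases}$$ (iv) For any $l\in[0,K]$, $\sigma>0$ and $j=0,1$ there is a constant $C$ such that, for all $t>0$, $$t^{\frac j2}(1+t)^{-\frac l2}\,|||\nabla^j[u(t)-U_n(t)]|||_l\le C\big[(1+t)^{-\frac K2+\sigma}+(1+t)^{-(n+1)(A-1)}\big].$$ -/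

import Mathlib

open MeasureTheory Filter Topology Set
open scoped ENNReal ContDiff

noncomputable section

namespace ParabolicExpansion

/-- The Euclidean space `ℝ^N`. -/
abbrev E (N : ℕ) : Type := EuclideanSpace ℝ (Fin N)

variable {N : ℕ}

/-! ### Gauss kernel, multi-indices and the projection operators -/

/-- The Gauss kernel `G(x, t)`. -/
def gaussKernel (x : E N) (t : ℝ) : ℝ :=
  (4 * Real.pi * t) ^ (-(N : ℝ) / 2) * Real.exp (-‖x‖ ^ 2 / (4 * t))

/-- The heat semigroup `(e^{tΔ} f)(x)`. -/
def heat (t : ℝ) (f : E N → ℝ) (x : E N) : ℝ :=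
  ∫ ξ, gaussKernel (x - ξ) t * f ξ

/-- The length `|α|` of a multi-index. -/
def deg (α : Fin N → ℕ) : ℕ := ∑ i, α i

/-- The monomial `x^α`. -/
def monomial (α : Fin N → ℕ) (x : E N) : ℝ := ∏ i, x i ^ α i

/-- The partial derivative `∂f/∂x_i`. -/
def partialDeriv (i : Fin N) (f : E N → ℝ) (x : E N) : ℝ :=
  fderiv ℝ f x (EuclideanSpace.single i 1)

/-- The iterated partial derivative `∂_x^α f = ∂_1^{α_1} (∂_2^{α_2} (⋯ f))`. -/
def multiDeriv (α : Fin N → ℕ) (f : E N → ℝ) : E N → ℝ :=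
  (List.finRange N).foldr (fun i h => (partialDeriv i)^[α i] h) f

/-- `g_α(x, t) = (-1)^{|α|} / α! · (∂_x^α G)(x, 1 + t)`. The time variable comes first. -/
def gKernel (α : Fin N → ℕ) (t : ℝ) (x : E N) : ℝ :=
  (-1) ^ deg α / (∏ i, ((α i).factorial : ℝ)) *
    multiDeriv α (fun y => gaussKernel y (1 + t)) x

/-- The finite set of multi-indices with `|α| ≤ k`. -/
def multiIndices (N k : ℕ) : Finset (Fin N → ℕ) :=
  (Fintype.piFinset fun _ => Finset.range (k + 1)).filter fun α => deg α ≤ k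

lemma mem_multiIndices {k : ℕ} {α : Fin N → ℕ} : α ∈ multiIndices N k ↔ deg α ≤ k := by
  simp only [multiIndices, Finset.mem_filter, Fintype.mem_piFinset, Finset.mem_range,
    and_iff_right_iff_imp]
  intro h i
  have : α i ≤ deg α := Finset.single_le_sum (fun j _ => Nat.zero_le (α j)) (Finset.mem_univ i)
  omega

/-- `J(α)`: the multi-indices `ρ ≠ α` with `ρ_i ≤ α_i` for all `i`. -/
def lowerIndices (α : Fin N → ℕ) : Finset (Fin N → ℕ) :=
  (Fintype.piFinset fun i => Finset.range (α i + 1)).erase α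

lemma mem_lowerIndices {α ρ : Fin N → ℕ} :
    ρ ∈ lowerIndices α ↔ ρ ≠ α ∧ ∀ i, ρ i ≤ α i := by
  simp [lowerIndices]

lemma deg_lt_of_mem_lowerIndices {α ρ : Fin N → ℕ} (h : ρ ∈ lowerIndices α) :
    deg ρ < deg α := by
  obtain ⟨hne, hle⟩ := mem_lowerIndices.1 h
  obtain ⟨i, hi⟩ := Function.ne_iff.1 hne
  exact Finset.sum_lt_sum (fun j _ => hle j) ⟨i, Finset.mem_univ i, lt_of_le_of_ne (hle i) hi⟩

/-- The coefficients `M_α(f, t)`, defined inductively in `α`. -/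
def moment (f : E N → ℝ) (t : ℝ) (α : Fin N → ℕ) : ℝ :=
  if deg α ≤ 1 then ∫ x, monomial α x * f x
  else (∫ x, monomial α x * f x) -
    ∑ ρ ∈ (lowerIndices α).attach, moment f t ρ.1 * ∫ x, monomial α x * gKernel ρ.1 t x
termination_by deg α
decreasing_by exact deg_lt_of_mem_lowerIndices ρ.2

/-- `∑_{|α| ≤ k} M_α(f, t) g_α(x, t)`. -/
def momentExpansion (k : ℕ) (t : ℝ) (f : E N → ℝ) (x : E N) : ℝ :=
  ∑ α ∈ multiIndices N k, moment f t α * gKernel α t x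

/-- The operator `P_k(t)`. -/
def proj (k : ℕ) (t : ℝ) (f : E N → ℝ) (x : E N) : ℝ :=
  f x - momentExpansion k t f x

/-! ### Function spaces and norms -/

/-- `φ ∈ L¹_K`. -/
def MemL1K (K : ℝ) (φ : E N → ℝ) : Prop :=
  Integrable φ ∧ Integrable fun x => (1 + ‖x‖) ^ K * φ x

/-- The (possibly infinite) norm `|||f|||_l` of `L¹(ℝ^N, (1+|x|)^l dx)`. -/
def weightedNorm {V : Type*} [NormedAddCommGroup V] (l : ℝ) (f : E N → V) : ℝ≥0∞ :=
  ∫⁻ x, ENNReal.ofReal ((1 + ‖x‖) ^ l) * ‖f x‖ₑ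

/-- `‖∇^j f‖_q` for `j = 0, 1`, where `df` is the gradient of `f`. -/
def nablaLq (j : Fin 2) (q : ℝ≥0∞) (f : E N → ℝ) (df : E N → E N) : ℝ≥0∞ :=
  if j = 0 then eLpNorm f q volume else eLpNorm df q volume

/-- `|||∇^j f|||_l` for `j = 0, 1`, where `df` is the gradient of `f`. -/
def nablaWeighted (j : Fin 2) (l : ℝ) (f : E N → ℝ) (df : E N → E N) : ℝ≥0∞ :=
  if j = 0 then weightedNorm l f else weightedNorm l df

/-- The exponent `(N/2)(1 - 1/q)`, where `1/∞ = 0`. -/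
def decayExp (N : ℕ) (q : ℝ≥0∞) : ℝ := (N : ℝ) / 2 * (1 - (q⁻¹).toReal)

/-- `df` is the weak gradient of `f` on `ℝ^N`. -/
def HasWeakGradient (f : E N → ℝ) (df : E N → E N) : Prop :=
  LocallyIntegrable f ∧ LocallyIntegrable df ∧
  ∀ ψ : E N → ℝ, ContDiff ℝ ∞ ψ → HasCompactSupport ψ → ∀ i : Fin N,
    ∫ x, f x * partialDeriv i ψ x = -∫ x, df x i * ψ x

/-- Lebesgue measure on `(0, ∞) × ℝ^N`; the time variable comes first. -/
def spaceTime (N : ℕ) : Measure (ℝ × E N) := (volume.restrict (Ioi 0)).prod volume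

/-- A measurable function on `(0, ∞) × ℝ^N` together with its weak spatial gradient. -/
def IsWeaklyDiff (v : ℝ → E N → ℝ) (dv : ℝ → E N → E N) : Prop :=
  AEStronglyMeasurable (fun p : ℝ × E N => v p.1 p.2) (spaceTime N) ∧
  AEStronglyMeasurable (fun p : ℝ × E N => dv p.1 p.2) (spaceTime N) ∧
  ∀ᵐ t ∂(volume.restrict (Ioi (0 : ℝ))), HasWeakGradient (v t) (dv t)

/-- The class `𝒮`. The bound contains `v ∈ L^∞_loc(0, ∞ : W^{1,∞})`. -/
def MemS (v : ℝ → E N → ℝ) (dv : ℝ → E N → E N) : Prop :=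
  IsWeaklyDiff v dv ∧
  ∃ C : ℝ, ∀ᵐ t ∂(volume.restrict (Ioi (0 : ℝ))),
    ENNReal.ofReal (t ^ ((N : ℝ) / 2)) *
      (eLpNorm (v t) ∞ volume + ENNReal.ofReal (t ^ (1 / 2 : ℝ)) * eLpNorm (dv t) ∞ volume)
      ≤ ENNReal.ofReal C

/-! ### The nonlinear parabolic problem -/

/-- `F ∈ C(ℝ^N × (0, ∞) × ℝ × ℝ^N)`. -/
def ContinuousReaction (F : E N → ℝ → ℝ → E N → ℝ) : Prop :=
  ContinuousOn (fun z : E N × ℝ × ℝ × E N => F z.1 z.2.1 z.2.2.1 z.2.2.2) {z | 0 < z.2.1}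

/-- The integral equation at the point `(x, t)` (with an absolutely convergent double integral). -/
def DuhamelAt (F : E N → ℝ → ℝ → E N → ℝ) (φ : E N → ℝ)
    (u : ℝ → E N → ℝ) (du : ℝ → E N → E N) (t : ℝ) (x : E N) : Prop :=
  IntegrableOn (fun p : ℝ × E N =>
    gaussKernel (x - p.2) (t - p.1) * F p.2 p.1 (u p.1 p.2) (du p.1 p.2)) (Ioo 0 t ×ˢ univ) ∧
  u t x = (∫ ξ, gaussKernel (x - ξ) t * φ ξ) +
    ∫ s in (0 : ℝ)..t, ∫ ξ, gaussKernel (x - ξ) (t - s) * F ξ s (u s ξ) (du s ξ)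

/-- `u ∈ L^∞_loc(0, ∞ : W^{1,1}(ℝ^N))`, with weak spatial gradient `du`, is a solution of the
Cauchy problem with reaction term `F` and initial function `φ`. -/
def IsSolution (F : E N → ℝ → ℝ → E N → ℝ) (φ : E N → ℝ)
    (u : ℝ → E N → ℝ) (du : ℝ → E N → E N) : Prop :=
  IsWeaklyDiff u du ∧
  (∀ a b : ℝ, 0 < a → a < b → ∃ C : ℝ, ∀ᵐ t ∂(volume.restrict (Icc a b)),
    eLpNorm (u t) 1 volume + eLpNorm (du t) 1 volume ≤ ENNReal.ofReal C) ∧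
  ∀ᵐ p ∂(spaceTime N), DuhamelAt F φ u du p.1 p.2

/-- The times `t > 0` at which `du(t)` is the weak gradient of `u(t)` and the integral equation
holds for almost every `x`. For a solution, almost every `t > 0` is of this kind, and every `t > 0`
is if `u` is the representative that satisfies the integral equation at every time. -/
def IsRegularTime (F : E N → ℝ → ℝ → E N → ℝ) (φ : E N → ℝ)
    (u : ℝ → E N → ℝ) (du : ℝ → E N → E N) (t : ℝ) : Prop :=
  0 < t ∧ HasWeakGradient (u t) (du t) ∧ ∀ᵐ x, DuhamelAt F φ u du t x

/-- The `L^q` bounds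
`sup_{t>0} t^{(N/2)(1-1/q)} [‖u(t)‖_q + t^{1/2} ‖∇u(t)‖_q] < ∞` for all `q ∈ [1, ∞]`. -/
def LqBounds (u : ℝ → E N → ℝ) (du : ℝ → E N → E N) : Prop :=
  ∀ q : ℝ≥0∞, 1 ≤ q → ∃ C : ℝ, ∀ᵐ t ∂(volume.restrict (Ioi (0 : ℝ))),
    ENNReal.ofReal (t ^ decayExp N q) *
      (eLpNorm (u t) q volume + ENNReal.ofReal (t ^ (1 / 2 : ℝ)) * eLpNorm (du t) q volume)
      ≤ ENNReal.ofReal C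

/-- The weighted bounds
`sup_{t>0} (1+t)^{-l/2} [|||u(t)|||_l + t^{1/2} |||∇u(t)|||_l] < ∞` for all `l ∈ [0, K]`. -/
def WeightedBounds (K : ℝ) (u : ℝ → E N → ℝ) (du : ℝ → E N → E N) : Prop :=
  ∀ l : ℝ, 0 ≤ l → l ≤ K → ∃ C : ℝ, ∀ᵐ t ∂(volume.restrict (Ioi (0 : ℝ))),
    ENNReal.ofReal ((1 + t) ^ (-l / 2)) *
      (weightedNorm l (u t) + ENNReal.ofReal (t ^ (1 / 2 : ℝ)) * weightedNorm l (du t))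
      ≤ ENNReal.ofReal C

/-- Condition `(C_A)`. -/
def ConditionC (A : ℝ) (F : E N → ℝ → ℝ → E N → ℝ)
    (u : ℝ → E N → ℝ) (du : ℝ → E N → E N) : Prop :=
  ∃ C : ℝ, ∀ᵐ p ∂(spaceTime N),
    |F p.2 p.1 (u p.1 p.2) (du p.1 p.2)| ≤
      C * (1 + p.1) ^ (-A) * (|u p.1 p.2| + (1 + p.1) ^ (1 / 2 : ℝ) * ‖du p.1 p.2‖)

/-- Condition `(F_A)`. -/
def ConditionF (A : ℝ) (F : E N → ℝ → ℝ → E N → ℝ) : Prop :=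
  (∀ (x : E N) (t : ℝ), 0 < t → F x t 0 0 = 0) ∧
  ∀ (v₁ v₂ : ℝ → E N → ℝ) (dv₁ dv₂ : ℝ → E N → E N), MemS v₁ dv₁ → MemS v₂ dv₂ →
    ∃ C : ℝ, ∀ᵐ p ∂(spaceTime N),
      |F p.2 p.1 (v₁ p.1 p.2) (dv₁ p.1 p.2) - F p.2 p.1 (v₂ p.1 p.2) (dv₂ p.1 p.2)| ≤
        C * (1 + p.1) ^ (-A) * (|v₁ p.1 p.2 - v₂ p.1 p.2| +
          (1 + p.1) ^ (1 / 2 : ℝ) * ‖dv₁ p.1 p.2 - dv₂ p.1 p.2‖)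

/-- `F(x, t, v(x, t), ∇v(x, t))` with the classical spatial gradient. -/
def reaction (F : E N → ℝ → ℝ → E N → ℝ) (v : ℝ → E N → ℝ) (t : ℝ) (x : E N) : ℝ :=
  F x t (v t x) (gradient (v t) x)

/-- The functions `U_n`, for the projection `P_k`. -/
def approx (F : E N → ℝ → ℝ → E N → ℝ) (k : ℕ) (u : ℝ → E N → ℝ) : ℕ → ℝ → E N → ℝ
  | 0 => fun t x => momentExpansion k t (u t) x
  | n + 1 => fun t x => momentExpansion k t (u t) x +
      ∫ s in (0 : ℝ)..t, heat (t - s) (proj k s (reaction F (approx F k u n) s)) x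

/-- The integrals in the definition of `U_n` converge absolutely, and `U_n(t)` is of class `C¹`
in `x`, so that its classical gradient is meaningful. -/
def ApproxWellDefined (F : E N → ℝ → ℝ → E N → ℝ) (φ : E N → ℝ) (K : ℝ)
    (u : ℝ → E N → ℝ) (du : ℝ → E N → E N) (n : ℕ) : Prop :=
  (∀ t, IsRegularTime F φ u du t → MemL1K K (u t)) ∧
  (∀ m < n,
    (∀ᵐ s ∂(volume.restrict (Ioi (0 : ℝ))),
      MemL1K K (reaction F (approx F ⌊K⌋₊ u m) s)) ∧
    ∀ (t : ℝ) (x : E N), 0 < t → IntegrableOn (fun p : ℝ × E N =>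
      gaussKernel (x - p.2) (t - p.1) *
        proj ⌊K⌋₊ p.1 (reaction F (approx F ⌊K⌋₊ u m) p.1) p.2) (Ioo 0 t ×ˢ univ)) ∧
  ∀ t : ℝ, 0 < t → ContDiff ℝ 1 (approx F ⌊K⌋₊ u n t)

/-- `‖∇^j [u(t) - U_n(t)]‖_q`. -/
def errorLq (F : E N → ℝ → ℝ → E N → ℝ) (k : ℕ) (u : ℝ → E N → ℝ) (du : ℝ → E N → E N)
    (n : ℕ) (j : Fin 2) (q : ℝ≥0∞) (t : ℝ) : ℝ≥0∞ :=
  nablaLq j q (fun x => u t x - approx F k u n t x)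
    (fun x => du t x - gradient (approx F k u n t) x)

/-- `|||∇^j [u(t) - U_n(t)]|||_l`. -/
def errorWeighted (F : E N → ℝ → ℝ → E N → ℝ) (k : ℕ) (u : ℝ → E N → ℝ)
    (du : ℝ → E N → E N) (n : ℕ) (j : Fin 2) (l : ℝ) (t : ℝ) : ℝ≥0∞ :=
  nablaWeighted j l (fun x => u t x - approx F k u n t x)
    (fun x => du t x - gradient (approx F k u n t) x)

end ParabolicExpansion

end

open ParabolicExpansion

open MeasureTheory Filter Topology Set
open scoped ENNReal ContDiff

noncomputable section

namespace ParabolicExpansion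

variable {N : ℕ}

/-! ### Polynomials times Gaussians -/

/-! The coefficients `M_α(·, t)` are dual to the kernels `g_α(t)`. Integration by parts shows that
the matrix `∫ x^β g_α(x, t) dx` is triangular with unit diagonal (`integral_monomial_mul_gKernel`).
Hence `P_k(t) f` is the part of `f` whose moments up to order `k` vanish, and a splitting of `f`
into such a part and a combination of the `g_α(t)` is unique (`moment_eq_of_decomposition`). The
heat semigroup respects this splitting: `e^{τΔ} g_α(s) = g_α(s + τ)` (`heat_gKernel`), and vanishing
moments remain zero (`ZeroMoments.heat`). Splitting `φ` and the source `F(u, ∇u)` in Duhamel's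
formula therefore writes `u(t)` as a combination of the `g_α(t)` plus a mild solution whose initial
function and source have vanishing moments (`sol_eq_add`). By uniqueness the combination is `U_0`.
Consequently `u - U_n` is the mild solution with initial function `P_k(0) φ` and source `P_k(s)`
applied to the difference of `F(u)` and `F_{n-1}`, where `F_{-1} = 0` (`IsRegularTime.approx_eq`).

Sizes are measured in one norm adapted to parabolic scaling, `star K s`: the `L¹` norm with weight
`(1 + |x|/√(1+s))^K` plus `s^{N/2}` times the `L^∞` norm. It controls every norm of the theorem by
interpolation. Convolution with a rescaled kernel is bounded from the norm at time `s` to the norm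
at time `s + τ` (`conv_ostar_le`). If the moments vanish, a Taylor polynomial of the kernel may be
subtracted, which gains the factor `((1+s)/(1+s+τ))^{K/2}` (`conv_ostar_le_of_zeroMoments`). A
source of size `s^{-1/2}(1+s)^{-1/2-p}` then produces an error of order `(1+t)^{-K/2} ∫₀ᵗ
(1+s)^{-1-(p-K/2)} ds`. The sign of `p - K/2` separates the three regimes, with the logarithm at `p
= K/2`.

Condition `(C_A)` gives the rate `A - 1` for `F(u)`. Condition `(F_A)` converts an error bound for
`u - U_n` into a rate for `F(u) - F_n` that is better by `A - 1`, until `K/2` is passed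
(`Setting.defectBound_succ`). Once the rate exceeds `K/2`, the remainder is even `o(t^{-K/2})`: the
Taylor order `⌊K⌋ + 1` is larger than `K`, so dominated convergence disposes of the initial function
and of the sources before time `t/2`, while the later ones are smaller by a power of `t`
(`tendsto_dnorm_sol`). -/

/-- The functions of the form polynomial times `exp (-c ‖x‖²)`. -/
inductive PolyGauss (c : ℝ) : (E N → ℝ) → Prop
  | gauss : PolyGauss c fun x => Real.exp (-(c * ‖x‖ ^ 2))
  | coord (i : Fin N) {f : E N → ℝ} : PolyGauss c f → PolyGauss c fun x => x i * f x
  | add {f g : E N → ℝ} : PolyGauss c f → PolyGauss c g → PolyGauss c fun x => f x + g x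
  | smul (a : ℝ) {f : E N → ℝ} : PolyGauss c f → PolyGauss c fun x => a * f x

/-- Decay faster than every power. -/
def Rapid (f : E N → ℝ) : Prop := ∀ M : ℕ, ∃ C : ℝ, ∀ x, (1 + ‖x‖) ^ M * |f x| ≤ C

lemma contDiff_coord (i : Fin N) : ContDiff ℝ ∞ (fun x : E N => x i) :=
  (EuclideanSpace.proj (𝕜 := ℝ) i).contDiff

lemma hasFDerivAt_coord (i : Fin N) (x : E N) :
    HasFDerivAt (fun x : E N => x i) (EuclideanSpace.proj (𝕜 := ℝ) i) x :=
  (EuclideanSpace.proj (𝕜 := ℝ) i).hasFDerivAt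

lemma abs_coord_le (x : E N) (i : Fin N) : |x i| ≤ ‖x‖ := by
  simpa using PiLp.norm_apply_le x i

lemma PolyGauss.contDiff {c : ℝ} {f : E N → ℝ} (h : PolyGauss c f) : ContDiff ℝ ∞ f := by
  induction h with
  | gauss => exact ((contDiff_const.mul (contDiff_norm_sq ℝ)).neg).exp
  | coord i _ ih => exact (contDiff_coord i).mul ih
  | add _ _ ih1 ih2 => exact ih1.add ih2
  | smul a _ ih => exact contDiff_const.mul ih

lemma PolyGauss.differentiable {c : ℝ} {f : E N → ℝ} (h : PolyGauss c f) : Differentiable ℝ f :=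
  h.contDiff.differentiable (by simp)

lemma PolyGauss.continuous {c : ℝ} {f : E N → ℝ} (h : PolyGauss c f) : Continuous f :=
  h.contDiff.continuous

lemma HasFDerivAt.partialDeriv_eq {f : E N → ℝ} {f' : E N →L[ℝ] ℝ} {x : E N}
    (h : HasFDerivAt f f' x) (i : Fin N) :
    partialDeriv i f x = f' (EuclideanSpace.single i 1) := by
  rw [partialDeriv, h.fderiv]

/-- Closure under differentiation with the same `c` replaces explicit Hermite polynomials: every
`∂^α G` lies in the class, hence is smooth and rapidly decreasing. -/
lemma PolyGauss.partialDeriv {c : ℝ} {f : E N → ℝ} (h : PolyGauss c f) (i : Fin N) :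
    PolyGauss c (partialDeriv i f) := by
  induction h with
  | gauss =>
    convert PolyGauss.smul (-(2 * c)) (PolyGauss.coord i (PolyGauss.gauss (N := N) (c := c))) using 1
    ext x
    have h1 : HasFDerivAt (fun x : E N => Real.exp (-(c * ‖x‖ ^ 2))) _ x :=
      (((hasStrictFDerivAt_norm_sq x).hasFDerivAt.const_mul c).neg).exp
    rw [HasFDerivAt.partialDeriv_eq h1]
    simp [EuclideanSpace.inner_single_right]
    ring
  | @coord j f hf ih =>
    have h1 : ∀ x, ParabolicExpansion.partialDeriv i (fun x => x j * f x) x =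
        (if j = i then 1 else 0) * f x + x j * ParabolicExpansion.partialDeriv i f x := by
      intro x
      refine (HasFDerivAt.partialDeriv_eq
        ((hasFDerivAt_coord j x).mul (hf.differentiable x).hasFDerivAt) i).trans ?_
      simp [ParabolicExpansion.partialDeriv, PiLp.single_apply]
      ring
    rw [funext h1]
    exact .add (.smul _ hf) (.coord j ih)
  | @add f g hf hg ih1 ih2 =>
    convert PolyGauss.add ih1 ih2 using 1
    ext x
    refine (HasFDerivAt.partialDeriv_eq
      ((hf.differentiable x).hasFDerivAt.add (hg.differentiable x).hasFDerivAt) i).trans ?_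
    simp [ParabolicExpansion.partialDeriv]
  | @smul a f hf ih =>
    convert PolyGauss.smul a ih using 1
    ext x
    rw [HasFDerivAt.partialDeriv_eq ((hf.differentiable x).hasFDerivAt.const_mul a)]
    simp [ParabolicExpansion.partialDeriv]

lemma Rapid.exists_nonneg {f : E N → ℝ} (h : Rapid f) (M : ℕ) :
    ∃ C : ℝ, 0 ≤ C ∧ ∀ x, |f x| ≤ C * ((1 + ‖x‖) ^ M)⁻¹ := by
  obtain ⟨C, hC⟩ := h M
  refine ⟨C, le_trans (by positivity) (hC 0), fun x => ?_⟩
  rw [← div_eq_mul_inv, le_div_iff₀ (by positivity), mul_comm]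
  exact hC x

lemma PolyGauss.rapid {c : ℝ} (hc : 0 < c) {f : E N → ℝ} (h : PolyGauss c f) : Rapid f := by
  induction h with
  | gauss =>
    -- `M²/(4c)` is the maximum over `r` of `M r - c r²`, and `(1 + r)^M ≤ e^{M r}`.
    refine fun M => ⟨Real.exp (M ^ 2 / (4 * c)), fun x => ?_⟩
    have h1 : (1 + ‖x‖) ^ M ≤ Real.exp (M * ‖x‖) := by
      rw [mul_comm, Real.exp_mul, Real.rpow_natCast]
      have := Real.add_one_le_exp ‖x‖
      gcongr
      linarith
    rw [abs_of_pos (Real.exp_pos _)]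
    calc _ ≤ Real.exp (M * ‖x‖) * Real.exp (-(c * ‖x‖ ^ 2)) := by gcongr
      _ = Real.exp (M * ‖x‖ - c * ‖x‖ ^ 2) := by rw [← Real.exp_add]; ring_nf
      _ ≤ _ := by
        apply Real.exp_le_exp.2
        rw [le_div_iff₀ (by positivity)]
        nlinarith [sq_nonneg (2 * c * ‖x‖ - M)]
  | @coord i f _ ih =>
    intro M
    -- The factor `x i` costs one power of the weight.
    obtain ⟨C, hC⟩ := ih (M + 1)
    refine ⟨C, fun x => le_trans ?_ (hC x)⟩
    rw [abs_mul, pow_succ, mul_assoc]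
    have := abs_coord_le x i
    gcongr
    linarith
  | @add f g _ _ ih1 ih2 =>
    intro M
    obtain ⟨C, hC⟩ := ih1 M
    obtain ⟨D, hD⟩ := ih2 M
    refine ⟨C + D, fun x => le_trans ?_ (add_le_add (hC x) (hD x))⟩
    rw [← mul_add]
    gcongr
    exact abs_add_le _ _
  | @smul a f _ ih =>
    intro M
    obtain ⟨C, hC⟩ := ih M
    refine ⟨|a| * C, fun x => ?_⟩
    rw [abs_mul, mul_left_comm]
    gcongr
    exact hC x

/-- A weight exponent beyond which the weights are integrable. -/
lemma integrable_inv_pow (M : ℕ) (hM : N < M) :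
    Integrable (fun x : E N => ((1 + ‖x‖) ^ M)⁻¹) := by
  have := integrable_one_add_norm (E := E N) (μ := volume) (r := M) (by simpa using hM)
  refine this.congr (ae_of_all _ fun x => ?_)
  simp only
  rw [Real.rpow_neg (by positivity), Real.rpow_natCast]

lemma Rapid.integrable_mul {f g : E N → ℝ} (hf : Rapid f) (hfc : Continuous f)
    (hg : Continuous g) {C : ℝ} {M : ℕ} (hgb : ∀ x, |g x| ≤ C * (1 + ‖x‖) ^ M) :
    Integrable (fun x => g x * f x) := by
  -- `M` powers absorb the growth of `g`; the other `N + 1` leave an integrable bound.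
  obtain ⟨D, hD, h⟩ := hf.exists_nonneg (M + (N + 1))
  refine ((integrable_inv_pow (N := N) (N + 1) (by omega)).const_mul (C * D)).mono'
    (by fun_prop) (ae_of_all _ fun x => ?_)
  have hC : 0 ≤ C := by
    have := (abs_nonneg _).trans (hgb 0); simpa using this
  rw [Real.norm_eq_abs, abs_mul]
  calc _ ≤ (C * (1 + ‖x‖) ^ M) * (D * ((1 + ‖x‖) ^ (M + (N + 1)))⁻¹) := by
        gcongr
        · exact hgb x
        · exact h x
    _ = _ := by
        rw [pow_add]
        field_simp

lemma Rapid.integrable {f : E N → ℝ} (hf : Rapid f) (hfc : Continuous f) : Integrable f := by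
  simpa using hf.integrable_mul hfc (g := fun _ => 1) (C := 1) (M := 0) (by fun_prop) (by simp)

lemma continuous_monomial (α : Fin N → ℕ) : Continuous (monomial α) := by
  unfold monomial
  fun_prop

lemma abs_monomial_le (α : Fin N → ℕ) (x : E N) : |monomial α x| ≤ ‖x‖ ^ deg α := by
  rw [monomial, Finset.abs_prod, deg, ← Finset.prod_pow_eq_pow_sum]
  refine Finset.prod_le_prod (fun _ _ => abs_nonneg _) fun i _ => ?_
  rw [abs_pow]
  gcongr
  exact abs_coord_le x i

lemma abs_monomial_le_one_add (α : Fin N → ℕ) (x : E N) :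
    |monomial α x| ≤ 1 * (1 + ‖x‖) ^ deg α := by
  rw [one_mul]
  refine (abs_monomial_le α x).trans ?_
  gcongr
  linarith

lemma Rapid.integrable_monomial {f : E N → ℝ} (hf : Rapid f) (hfc : Continuous f)
    (α : Fin N → ℕ) : Integrable (fun x => monomial α x * f x) :=
  hf.integrable_mul hfc (continuous_monomial α) (abs_monomial_le_one_add α)

/-- The partial derivatives in the directions of a list, `α i` times in the direction `i`. -/
def listDeriv (α : Fin N → ℕ) (L : List (Fin N)) (f : E N → ℝ) : E N → ℝ :=
  L.foldr (fun i h => (partialDeriv i)^[α i] h) f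

lemma PolyGauss.iterate {c : ℝ} {f : E N → ℝ} (h : PolyGauss c f) (i : Fin N) (a : ℕ) :
    PolyGauss c ((ParabolicExpansion.partialDeriv i)^[a] f) := by
  induction a with
  | zero => exact h
  | succ a ih => rw [Function.iterate_succ_apply']; exact ih.partialDeriv i

lemma PolyGauss.listDeriv {c : ℝ} {f : E N → ℝ} (h : PolyGauss c f) (α : Fin N → ℕ)
    (L : List (Fin N)) : PolyGauss c (listDeriv α L f) := by
  induction L with
  | nil => exact h
  | cons i L ih => exact ih.iterate i (α i)

lemma PolyGauss.multiDeriv {c : ℝ} {f : E N → ℝ} (h : PolyGauss c f) (α : Fin N → ℕ) :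
    PolyGauss c (multiDeriv α f) := h.listDeriv α _

lemma polyGauss_gaussKernel (t : ℝ) : PolyGauss (1 / (4 * t)) (fun x : E N => gaussKernel x t) := by
  convert PolyGauss.smul ((4 * Real.pi * t) ^ (-(N : ℝ) / 2))
    (PolyGauss.gauss (N := N) (c := 1 / (4 * t))) using 1
  ext x
  simp only [gaussKernel]
  congr 2
  ring

lemma polyGauss_gKernel (α : Fin N → ℕ) (t : ℝ) :
    PolyGauss (1 / (4 * (1 + t))) (gKernel α t) :=
  .smul _ ((polyGauss_gaussKernel (1 + t)).multiDeriv α)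

lemma rapid_gKernel (α : Fin N → ℕ) {t : ℝ} (ht : 0 ≤ t) : Rapid (gKernel α t) :=
  (polyGauss_gKernel α t).rapid (by positivity)

lemma continuous_gKernel (α : Fin N → ℕ) (t : ℝ) : Continuous (gKernel α t) :=
  (polyGauss_gKernel α t).continuous

lemma gaussKernel_pos (x : E N) {t : ℝ} (ht : 0 < t) : 0 < gaussKernel x t := by
  unfold gaussKernel; positivity

lemma integral_gaussKernel {t : ℝ} (ht : 0 < t) : ∫ x : E N, gaussKernel x t = 1 := by
  have h := GaussianFourier.integral_rexp_neg_mul_sq_norm (V := E N) (b := 1 / (4 * t))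
    (by positivity)
  simp only [gaussKernel]
  rw [integral_const_mul]
  have h2 : ∀ x : E N, -‖x‖ ^ 2 / (4 * t) = -(1 / (4 * t)) * ‖x‖ ^ 2 := fun x => by ring
  simp only [h2]
  rw [h, finrank_euclideanSpace, Fintype.card_fin, show Real.pi / (1 / (4 * t)) = 4 * Real.pi * t by
    field_simp, ← Real.rpow_add (by positivity)]
  rw [neg_div, neg_add_cancel, Real.rpow_zero]

/-! ### Scaling -/

lemma partialDeriv_comp_smul (i : Fin N) (f : E N → ℝ) (c : ℝ) :
    partialDeriv i (fun y => f (c • y)) = fun y => c * partialDeriv i f (c • y) := by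
  ext x
  simp only [partialDeriv]
  rw [fderiv_comp_smul]
  simp

lemma partialDeriv_const_mul (i : Fin N) (a : ℝ) (f : E N → ℝ) :
    partialDeriv i (fun y => a * f y) = fun y => a * partialDeriv i f y := by
  ext x
  simp only [partialDeriv]
  have := congrArg (fun g => g x (EuclideanSpace.single i 1))
    (fderiv_const_smul_field (𝕜 := ℝ) (f := f) a)
  exact this

/-- No smoothness is needed: the rules for dilations and constant factors remain true where `fderiv`
takes its default value `0`. -/
lemma listDeriv_comp_smul (α : Fin N → ℕ) (L : List (Fin N)) (f : E N → ℝ) (a c : ℝ) :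
    listDeriv α L (fun y => a * f (c • y)) =
      fun y => a * c ^ (L.map α).sum * listDeriv α L f (c • y) := by
  induction L with
  | nil => simp [listDeriv]
  | cons i L ih =>
    have h : ∀ (m : ℕ) (b : ℝ) (g : E N → ℝ), (partialDeriv i)^[m] (fun y => b * g (c • y)) =
        fun y => b * c ^ m * (partialDeriv i)^[m] g (c • y) := by
      intro m
      induction m with
      | zero => intro b g; simp
      | succ m ihm =>
        intro b g
        rw [Function.iterate_succ_apply, partialDeriv_const_mul, partialDeriv_comp_smul]
        have := ihm (b * c) (partialDeriv i g)
        simp only [← mul_assoc]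
        rw [this]
        ext y
        rw [Function.iterate_succ_apply]
        ring
    change (partialDeriv i)^[α i] (listDeriv α L fun y => a * f (c • y)) = _
    rw [ih, h]
    ext y
    change _ = _ * (partialDeriv i)^[α i] (listDeriv α L f) (c • y)
    simp only [List.map_cons, List.sum_cons, pow_add]
    ring

lemma multiDeriv_comp_smul (α : Fin N → ℕ) (f : E N → ℝ) (a c : ℝ) :
    multiDeriv α (fun y => a * f (c • y)) = fun y => a * c ^ deg α * multiDeriv α f (c • y) := by
  have := listDeriv_comp_smul α (List.finRange N) f a c
  rw [show ((List.finRange N).map α).sum = deg α by simp [deg, List.sum_ofFn, ← List.ofFn_eq_map]] at this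
  exact this

lemma gaussKernel_scale {t : ℝ} (ht : 0 < t) (x : E N) :
    gaussKernel x t = t ^ (-(N : ℝ) / 2) * gaussKernel ((Real.sqrt t)⁻¹ • x) 1 := by
  simp only [gaussKernel]
  rw [norm_smul, ← mul_assoc, Real.mul_rpow (by positivity) ht.le, mul_pow, mul_one]
  rw [mul_comm (t ^ _)]
  congr 2
  simp only [norm_inv, Real.norm_eq_abs, inv_pow, sq_abs, Real.sq_sqrt ht.le]
  field_simp

/-- Self-similarity of `g_α`. The factor `(1 + t)^{-|α|/2}` is what will cancel the growth of `M_α`.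
-/
lemma gKernel_scale (α : Fin N → ℕ) {t : ℝ} (ht : 0 ≤ t) (x : E N) :
    gKernel α t x = (1 + t) ^ (-(N : ℝ) / 2) * ((Real.sqrt (1 + t))⁻¹ ^ deg α *
      gKernel α 0 ((Real.sqrt (1 + t))⁻¹ • x)) := by
  have h1 : (fun y : E N => gaussKernel y (1 + t)) = fun y => (1 + t) ^ (-(N : ℝ) / 2) *
      (fun z => gaussKernel z (1 + 0)) ((Real.sqrt (1 + t))⁻¹ • y) := by
    ext y; rw [gaussKernel_scale (by positivity)]; simp
  simp only [gKernel]
  rw [h1, multiDeriv_comp_smul α (fun z => gaussKernel z (1 + 0))]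
  ring

/-! ### Moments of the kernels -/

lemma hasFDerivAt_monomial (β : Fin N → ℕ) (x : E N) :
    HasFDerivAt (monomial β) (∑ i, (∏ j ∈ Finset.univ.erase i, x j ^ β j) •
      (((β i : ℝ) * x i ^ (β i - 1)) • EuclideanSpace.proj (𝕜 := ℝ) i)) x := by
  refine HasFDerivAt.finsetProd (u := Finset.univ) (x := x)
    (g := fun i (x : E N) => x i ^ β i) fun i _ => ?_
  exact (hasDerivAt_pow (β i) (x i)).comp_hasFDerivAt x (hasFDerivAt_coord i x)

lemma monomial_update (β : Fin N → ℕ) (i : Fin N) (m : ℕ) (x : E N) :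
    monomial (Function.update β i m) x = x i ^ m * ∏ j ∈ Finset.univ.erase i, x j ^ β j := by
  rw [monomial, ← Finset.mul_prod_erase _ _ (Finset.mem_univ i), Function.update_self]
  congr 1
  refine Finset.prod_congr rfl fun j hj => ?_
  rw [Function.update_of_ne (Finset.ne_of_mem_erase hj)]

lemma partialDeriv_monomial (β : Fin N → ℕ) (i : Fin N) (x : E N) :
    partialDeriv i (monomial β) x = β i * monomial (Function.update β i (β i - 1)) x := by
  rw [HasFDerivAt.partialDeriv_eq (hasFDerivAt_monomial β x), monomial_update,
    sum_apply, Finset.sum_eq_single i]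
  · simp
    ring
  · intro j _ hj
    simp [hj]
  · simp

lemma integral_monomial_mul_partialDeriv {c : ℝ} (hc : 0 < c) {f : E N → ℝ} (hf : PolyGauss c f)
    (β : Fin N → ℕ) (i : Fin N) : ∫ x, monomial β x * partialDeriv i f x =
      -(β i) * ∫ x, monomial (Function.update β i (β i - 1)) x * f x := by
  have h := integral_mul_fderiv_eq_neg_fderiv_mul_of_integrable (μ := volume) (f := monomial β)
    (g := f) (v := EuclideanSpace.single i 1) ?_ ?_ ?_
    (fun x _ => (hasFDerivAt_monomial β x).differentiableAt) (fun x _ => hf.differentiable x)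
  · change ∫ x, monomial β x * partialDeriv i f x = -∫ x, partialDeriv i (monomial β) x * f x at h
    rw [h, neg_mul, ← integral_const_mul]
    simp_rw [partialDeriv_monomial, mul_assoc]
  · change Integrable fun x => partialDeriv i (monomial β) x * f x
    simp_rw [partialDeriv_monomial, mul_assoc]
    exact ((hf.rapid hc).integrable_monomial hf.continuous _).const_mul _
  · exact ((hf.partialDeriv i).rapid hc).integrable_monomial (hf.partialDeriv i).continuous _
  · exact (hf.rapid hc).integrable_monomial hf.continuous _

lemma integral_monomial_mul_iterate {c : ℝ} (hc : 0 < c) {f : E N → ℝ} (hf : PolyGauss c f)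
    (i : Fin N) (a : ℕ) (β : Fin N → ℕ) : ∫ x, monomial β x * (partialDeriv i)^[a] f x =
      (-1) ^ a * ((β i).descFactorial a : ℝ) *
        ∫ x, monomial (Function.update β i (β i - a)) x * f x := by
  induction a generalizing β with
  | zero => simp
  | succ a ih =>
    rw [Function.iterate_succ_apply', integral_monomial_mul_partialDeriv hc (hf.iterate i a), ih]
    simp only [Function.update_self, Function.update_idem]
    -- For `β i = 0` both sides vanish, so the truncated subtraction is harmless.
    have h2 : (β i : ℝ) * ((β i - 1).descFactorial a : ℝ) = ((β i).descFactorial (a + 1) : ℝ) := by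
      rcases Nat.eq_zero_or_pos (β i) with h | h
      · simp [h]
      · obtain ⟨m, hm⟩ := Nat.exists_eq_add_of_lt h
        rw [hm, Nat.succ_descFactorial_succ]
        simp
    rw [← h2, Nat.sub_sub, add_comm 1 a]
    ring

/-- `Nodup` ensures that each coordinate is treated in a single block, so the exponent met there is
still the original `β i`. -/
lemma integral_monomial_mul_listDeriv {c : ℝ} (hc : 0 < c) {f : E N → ℝ} (hf : PolyGauss c f)
    (α : Fin N → ℕ) (L : List (Fin N)) (hL : L.Nodup) (β : Fin N → ℕ) :
    ∫ x, monomial β x * listDeriv α L f x =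
      (L.map fun i => (-1) ^ α i * ((β i).descFactorial (α i) : ℝ)).prod *
        ∫ x, monomial (fun i => if i ∈ L then β i - α i else β i) x * f x := by
  induction L generalizing β with
  | nil => simp [listDeriv]
  | cons i L ih =>
    obtain ⟨hi, hL⟩ := List.nodup_cons.1 hL
    change ∫ x, monomial β x * (partialDeriv i)^[α i] (listDeriv α L f) x = _
    rw [integral_monomial_mul_iterate hc (hf.listDeriv α L), ih hL, List.map_cons, List.prod_cons,
      mul_assoc, mul_assoc, mul_assoc]
    congr 2
    rw [List.map_congr_left (g := fun i => (-1) ^ α i * ((β i).descFactorial (α i) : ℝ))]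
    · congr 2
      ext x
      congr 2
      ext j
      by_cases hj : j = i
      · subst hj; simp [hi]
      · simp [hj]
    · intro j hj
      have : j ≠ i := fun h => hi (h ▸ hj)
      simp [this]

/-- Integration by parts moves all derivatives to the monomial. The sign and the `α!` in `g_α` turn
the falling factorials into binomial coefficients, one of which vanishes as soon as some `β i < α
i`: the moment matrix is triangular. -/
lemma integral_monomial_mul_gKernel (α β : Fin N → ℕ) {t : ℝ} (ht : 0 ≤ t) :
    ∫ x, monomial β x * gKernel α t x =
      (∏ i, (((β i).descFactorial (α i) : ℝ) / (α i).factorial)) *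
        ∫ x, monomial (fun i => β i - α i) x * gaussKernel x (1 + t) := by
  have h := integral_monomial_mul_listDeriv (c := 1 / (4 * (1 + t))) (by positivity)
    (polyGauss_gaussKernel (N := N) (1 + t)) α (List.finRange N) (List.nodup_finRange N) β
  simp only [List.mem_finRange, if_true] at h
  simp only [gKernel]
  have h2 : ∀ x : E N, monomial β x * ((-1) ^ deg α / (∏ i, ((α i).factorial : ℝ)) *
      multiDeriv α (fun y => gaussKernel y (1 + t)) x) =
      ((-1) ^ deg α / (∏ i, ((α i).factorial : ℝ))) *
        (monomial β x * listDeriv α (List.finRange N) (fun y => gaussKernel y (1 + t)) x) :=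
    fun x => by rw [mul_left_comm]; rfl
  simp_rw [h2]
  rw [integral_const_mul, h, ← mul_assoc]
  congr 1
  rw [← List.ofFn_eq_map, List.prod_ofFn, Finset.prod_mul_distrib, Finset.prod_pow_eq_pow_sum,
    Finset.prod_div_distrib]
  change (-1) ^ deg α / _ * ((-1) ^ deg α * _) = _
  have : ((-1 : ℝ) ^ deg α) * (-1) ^ deg α = 1 := by rw [← mul_pow]; simp
  rw [div_mul_eq_mul_div, ← mul_assoc, this, one_mul]

lemma integral_monomial_mul_gKernel_of_lt {α β : Fin N → ℕ} {t : ℝ} (ht : 0 ≤ t) {i : Fin N}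
    (h : β i < α i) : ∫ x, monomial β x * gKernel α t x = 0 := by
  rw [integral_monomial_mul_gKernel α β ht, Finset.prod_eq_zero (Finset.mem_univ i), zero_mul]
  rw [Nat.descFactorial_of_lt h]
  simp

lemma integral_monomial_mul_gKernel_self (α : Fin N → ℕ) {t : ℝ} (ht : 0 ≤ t) :
    ∫ x, monomial α x * gKernel α t x = 1 := by
  rw [integral_monomial_mul_gKernel α α ht]
  have h1 : ∀ x : E N, monomial (fun i => α i - α i) x = 1 := fun x => by simp [monomial]
  simp_rw [h1, one_mul]
  rw [integral_gaussKernel (by positivity), mul_one]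
  refine Finset.prod_eq_one fun i _ => ?_
  rw [Nat.descFactorial_self, div_self]
  positivity

/-! ### Differentiation of convolutions -/

lemma sum_coord_smul (v : E N) : v = ∑ i, v i • EuclideanSpace.single i (1 : ℝ) := by
  ext j
  simp [Pi.single_apply]

lemma fderiv_apply_eq_sum (f : E N → ℝ) (x v : E N) :
    fderiv ℝ f x v = ∑ i, v i * partialDeriv i f x := by
  conv_lhs => rw [sum_coord_smul v]
  simp [partialDeriv]

lemma norm_fderiv_le_sum (f : E N → ℝ) (x : E N) :
    ‖fderiv ℝ f x‖ ≤ ∑ i, |partialDeriv i f x| := by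
  refine ContinuousLinearMap.opNorm_le_bound _ (by positivity) fun v => ?_
  rw [fderiv_apply_eq_sum, Finset.sum_mul]
  refine (norm_sum_le _ _).trans (Finset.sum_le_sum fun i _ => ?_)
  rw [Real.norm_eq_abs, abs_mul, mul_comm]
  gcongr
  exact abs_coord_le v i

lemma gradient_apply (f : E N → ℝ) (x : E N) (i : Fin N) :
    gradient f x i = partialDeriv i f x := by
  have h : inner ℝ (gradient f x) (EuclideanSpace.single i 1) = partialDeriv i f x := by
    rw [gradient, InnerProductSpace.toDual_symm_apply]; rfl
  rw [← h, EuclideanSpace.inner_single_right]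
  simp

lemma norm_le_sum_coord (v : E N) : ‖v‖ ≤ ∑ i, |v i| := by
  conv_lhs => rw [sum_coord_smul v]
  refine (norm_sum_le _ _).trans (Finset.sum_le_sum fun i _ => ?_)
  simp [norm_smul]

/-- A `C¹` function that is bounded together with its derivative. -/
structure BoundedC1 (Γ : E N → ℝ) : Prop where
  contDiff : ContDiff ℝ 1 Γ
  bdd : ∃ C, ∀ y, |Γ y| ≤ C
  bdd_fderiv : ∃ C, ∀ y, ‖fderiv ℝ Γ y‖ ≤ C

lemma Rapid.bdd {f : E N → ℝ} (h : Rapid f) : ∃ C, ∀ y, |f y| ≤ C := by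
  simpa using h 0

lemma PolyGauss.boundedC1 {c : ℝ} (hc : 0 < c) {f : E N → ℝ} (h : PolyGauss c f) :
    BoundedC1 f := by
  refine ⟨h.contDiff.of_le (by simp), (h.rapid hc).bdd, ?_⟩
  choose C hC using fun i => ((h.partialDeriv i).rapid hc).bdd
  exact ⟨∑ i, C i, fun y => (norm_fderiv_le_sum f y).trans (Finset.sum_le_sum fun i _ => hC i y)⟩

lemma BoundedC1.integrable_mul {Γ f : E N → ℝ} (hΓ : BoundedC1 Γ) (hf : Integrable f)
    (x : E N) : Integrable fun ξ => Γ (x - ξ) * f ξ := by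
  obtain ⟨C, hC⟩ := hΓ.bdd
  have : Continuous Γ := hΓ.contDiff.continuous
  exact hf.bdd_mul (c := C) (by fun_prop) (ae_of_all _ fun ξ => hC _)

/-- The derivative falls on the kernel, so `f` need only be integrable; `|f|` times the bound of
`fderiv ℝ Γ` dominates. -/
lemma BoundedC1.hasFDerivAt_integral {Γ f : E N → ℝ} (hΓ : BoundedC1 Γ) (hf : Integrable f)
    (x : E N) :
    HasFDerivAt (fun x => ∫ ξ, Γ (x - ξ) * f ξ) (∫ ξ, f ξ • fderiv ℝ Γ (x - ξ)) x := by
  obtain ⟨C, hC⟩ := hΓ.bdd_fderiv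
  have h1 : Continuous Γ := hΓ.contDiff.continuous
  have h2 : Continuous (fderiv ℝ Γ) := hΓ.contDiff.continuous_fderiv (by simp)
  refine hasFDerivAt_integral_of_dominated_of_fderiv_le (s := univ) (bound := fun ξ => |f ξ| * C)
    (F' := fun x ξ => f ξ • fderiv ℝ Γ (x - ξ)) univ_mem (Eventually.of_forall fun x => ?_)
    (hΓ.integrable_mul hf x) ?_ ?_ (hf.abs.mul_const C) ?_
  · exact (hΓ.integrable_mul hf x).aestronglyMeasurable
  · exact hf.aestronglyMeasurable.smul (by fun_prop)
  · refine ae_of_all _ fun ξ y _ => ?_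
    rw [norm_smul, Real.norm_eq_abs]
    gcongr
    exact hC _
  · refine ae_of_all _ fun ξ y _ => ?_
    have h3 : HasFDerivAt (fun x => Γ (x - ξ)) (fderiv ℝ Γ (y - ξ)) y := by
      have := (hΓ.contDiff.differentiable (by simp) (y - ξ)).hasFDerivAt
      rwa [hasFDerivAt_comp_sub] 
    simpa using h3.mul_const (f ξ)

lemma BoundedC1.contDiff_integral {Γ f : E N → ℝ} (hΓ : BoundedC1 Γ) (hf : Integrable f)
    : ContDiff ℝ 1 (fun x => ∫ ξ, Γ (x - ξ) * f ξ) := by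
  obtain ⟨C, hC⟩ := hΓ.bdd_fderiv
  have h2 : Continuous (fderiv ℝ Γ) := hΓ.contDiff.continuous_fderiv (by simp)
  refine contDiff_one_iff_fderiv.2
    ⟨fun x => (hΓ.hasFDerivAt_integral hf x).differentiableAt, ?_⟩
  rw [funext fun x => (hΓ.hasFDerivAt_integral hf x).fderiv]
  refine continuous_of_dominated (bound := fun ξ => |f ξ| * C)
    (fun x => hf.aestronglyMeasurable.smul (by fun_prop)) (fun x => ae_of_all _ fun ξ => ?_)
    (hf.abs.mul_const C) (ae_of_all _ fun ξ => by fun_prop)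
  rw [norm_smul, Real.norm_eq_abs]
  gcongr
  exact hC _

lemma BoundedC1.partialDeriv_integral {Γ f : E N → ℝ} (hΓ : BoundedC1 Γ) (hf : Integrable f)
    (i : Fin N) :
    partialDeriv i (fun x => ∫ ξ, Γ (x - ξ) * f ξ) =
      fun x => ∫ ξ, partialDeriv i Γ (x - ξ) * f ξ := by
  ext x
  obtain ⟨C, hC⟩ := hΓ.bdd_fderiv
  have h2 : Continuous (fderiv ℝ Γ) := hΓ.contDiff.continuous_fderiv (by simp)
  rw [HasFDerivAt.partialDeriv_eq (hΓ.hasFDerivAt_integral hf x),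
    ContinuousLinearMap.integral_apply]
  · simp only [partialDeriv, smul_apply, smul_eq_mul, mul_comm]
  · refine (hf.abs.mul_const C).mono' (hf.aestronglyMeasurable.smul (by fun_prop))
      (ae_of_all _ fun ξ => ?_)
    rw [norm_smul, Real.norm_eq_abs]
    gcongr
    exact hC _

/-! ### The heat semigroup on the kernels -/

/-- Completing the square in `ξ`. The last factor integrates to one, so the identity contains the
semigroup law. -/
lemma gaussKernel_mul_gaussKernel {σ τ : ℝ} (hσ : 0 < σ) (hτ : 0 < τ) (x ξ : E N) :
    gaussKernel (x - ξ) τ * gaussKernel ξ σ =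
      gaussKernel x (σ + τ) * gaussKernel (ξ - (σ / (σ + τ)) • x) (σ * τ / (σ + τ)) := by
  simp only [gaussKernel]
  rw [mul_mul_mul_comm, mul_mul_mul_comm (_ ^ _) _ (_ ^ _), ← Real.exp_add, ← Real.exp_add,
    ← Real.mul_rpow (by positivity) (by positivity),
    ← Real.mul_rpow (by positivity) (by positivity)]
  congr 2
  · field_simp
  · rw [norm_sub_sq_real, norm_sub_sq_real, norm_smul, real_inner_smul_right, real_inner_comm,
      mul_pow, Real.norm_eq_abs, sq_abs]
    field_simp
    ring

lemma heat_gaussKernel {σ τ : ℝ} (hσ : 0 < σ) (hτ : 0 < τ) :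
    heat τ (fun x : E N => gaussKernel x σ) = fun x => gaussKernel x (σ + τ) := by
  ext x
  simp only [heat, gaussKernel_mul_gaussKernel hσ hτ]
  rw [integral_const_mul, integral_sub_right_eq_self (fun ξ => gaussKernel ξ (σ * τ / (σ + τ))),
    integral_gaussKernel (by positivity), mul_one]

lemma integrable_gaussKernel {t : ℝ} (ht : 0 < t) : Integrable fun x : E N => gaussKernel x t :=
  ((polyGauss_gaussKernel t).rapid (by positivity)).integrable (polyGauss_gaussKernel t).continuous

/-- Moves `x` into `f`, so that the factor to be differentiated is `f` instead of the Gauss kernel.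
-/
lemma heat_eq_integral_sub (τ : ℝ) (f : E N → ℝ) :
    heat τ f = fun x => ∫ ξ, f (x - ξ) * gaussKernel ξ τ := by
  ext x
  rw [heat, ← integral_sub_left_eq_self _ volume x]
  simp [mul_comm]

lemma heat_partialDeriv {τ c : ℝ} (hτ : 0 < τ) (hc : 0 < c) {f : E N → ℝ} (hf : PolyGauss c f)
    (i : Fin N) : heat τ (partialDeriv i f) = partialDeriv i (heat τ f) := by
  rw [heat_eq_integral_sub, heat_eq_integral_sub,
    (hf.boundedC1 hc).partialDeriv_integral (integrable_gaussKernel hτ)]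

lemma heat_listDeriv {τ c : ℝ} (hτ : 0 < τ) (hc : 0 < c) {f : E N → ℝ} (hf : PolyGauss c f)
    (α : Fin N → ℕ) (L : List (Fin N)) :
    heat τ (listDeriv α L f) = listDeriv α L (heat τ f) := by
  induction L with
  | nil => rfl
  | cons i L ih =>
    have h : ∀ a, heat τ ((partialDeriv i)^[a] (listDeriv α L f)) =
        (partialDeriv i)^[a] (heat τ (listDeriv α L f)) := by
      intro a
      induction a with
      | zero => rfl
      | succ a iha =>
        rw [Function.iterate_succ_apply', heat_partialDeriv hτ hc ((hf.listDeriv α L).iterate i a),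
          iha, Function.iterate_succ_apply']
    change heat τ ((partialDeriv i)^[α i] (listDeriv α L f)) = _
    rw [h, ih]
    rfl

lemma heat_const_mul (τ a : ℝ) (f : E N → ℝ) :
    heat τ (fun x => a * f x) = fun x => a * heat τ f x := by
  ext x
  simp only [heat]
  rw [← integral_const_mul]
  congr 1
  ext ξ
  ring

/-- Derivatives commute with the semigroup, which moves `G(1 + s)` to `G(1 + s + τ)`. This
invariance is the reason for expanding in the `g_α`. -/
lemma heat_gKernel (α : Fin N → ℕ) {s τ : ℝ} (hs : 0 ≤ s) (hτ : 0 < τ) :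
    heat τ (gKernel α s) = gKernel α (s + τ) := by
  have h := heat_listDeriv hτ (c := 1 / (4 * (1 + s))) (by positivity)
    (polyGauss_gaussKernel (N := N) (1 + s)) α (List.finRange N)
  rw [heat_gaussKernel (by positivity) hτ] at h
  change heat τ (fun x => _ * _) = _
  rw [heat_const_mul]
  ext x
  rw [gKernel, ← add_assoc]
  congr 1
  exact congrFun h x

/-! ### Taylor expansion of the kernels -/

lemma hasDerivAt_line {f : E N → ℝ} (hf : Differentiable ℝ f) (y η : E N) (θ : ℝ) :
    HasDerivAt (fun θ : ℝ => f (y - θ • η)) (∑ i, -(η i * partialDeriv i f (y - θ • η))) θ := by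
  have h1 : HasDerivAt (fun θ : ℝ => y - θ • η) (-((1 : ℝ) • η)) θ :=
    ((hasDerivAt_id θ).smul_const η).const_sub y
  refine ((hf (y - θ • η)).hasFDerivAt.comp_hasDerivAt θ h1).congr_deriv ?_
  rw [fderiv_apply_eq_sum]
  simp

lemma deg_add_single (α : Fin N → ℕ) (i : Fin N) : deg (α + Pi.single i 1) = deg α + 1 := by
  simp [deg, Finset.sum_add_distrib]

lemma monomial_add_single (α : Fin N → ℕ) (i : Fin N) (x : E N) :
    monomial (α + Pi.single i 1) x = x i * monomial α x := by
  simp only [monomial, Pi.add_apply, pow_add, Finset.prod_mul_distrib]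
  rw [mul_comm, Finset.prod_eq_single i]
  · simp
  · intro j _ hj; simp [hj]
  · simp

/-- The index type records the directions chosen in successive differentiations. Multinomial
coefficients are never collected, since only the degree of the monomials and the decay of the
coefficients are used. -/
lemma PolyGauss.iteratedDeriv_line {c : ℝ} {f : E N → ℝ} (hf : PolyGauss c f) (m : ℕ) :
    ∃ (ι : Type) (_ : Fintype ι) (α : ι → Fin N → ℕ) (b : ι → E N → ℝ),
      (∀ a, deg (α a) = m) ∧ (∀ a, PolyGauss c (b a)) ∧
      ∀ y η : E N, iteratedDeriv m (fun θ : ℝ => f (y - θ • η)) =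
        fun θ => ∑ a, b a (y - θ • η) * monomial (α a) η := by
  induction m with
  | zero =>
    refine ⟨Unit, inferInstance, fun _ => 0, fun _ => f, fun _ => by simp [deg], fun _ => hf,
      fun y η => ?_⟩
    ext θ
    simp [monomial]
  | succ m ih =>
    obtain ⟨ι, _, α, b, hα, hb, h⟩ := ih
    refine ⟨ι × Fin N, inferInstance, fun p => α p.1 + Pi.single p.2 1,
      fun p x => -1 * ParabolicExpansion.partialDeriv p.2 (b p.1) x, fun p => by rw [deg_add_single, hα],
      fun p => .smul _ ((hb p.1).partialDeriv p.2), fun y η => ?_⟩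
    ext θ
    rw [iteratedDeriv_succ, h]
    have h1 : HasDerivAt (fun θ : ℝ => ∑ a, b a (y - θ • η) * monomial (α a) η)
        (∑ a, (∑ i, -(η i * ParabolicExpansion.partialDeriv i (b a) (y - θ • η))) *
          monomial (α a) η) θ :=
      HasDerivAt.fun_sum fun a _ =>
        (hasDerivAt_line (hb a).differentiable y η θ).mul_const _
    rw [h1.deriv, Fintype.sum_prod_type]
    refine Finset.sum_congr rfl fun a _ => ?_
    rw [Finset.sum_mul]
    refine Finset.sum_congr rfl fun i _ => ?_
    rw [monomial_add_single]
    ring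

/-- The polynomials of degree at most `k`. -/
def polyLE (N k : ℕ) : Submodule ℝ (E N → ℝ) :=
  Submodule.span ℝ (monomial '' {α | deg α ≤ k})

lemma monomial_mem_polyLE {k : ℕ} {α : Fin N → ℕ} (h : deg α ≤ k) : monomial α ∈ polyLE N k :=
  Submodule.subset_span ⟨α, h, rfl⟩

/-- The bound of the Taylor remainder of a rapidly decaying function. -/
def remBound (k M : ℕ) (y η : E N) : ℝ :=
  ‖η‖ ^ k * min 1 ‖η‖ * ((1 + ‖y‖) ^ M)⁻¹ + if 1 ≤ ‖η‖ then ((1 + ‖y - η‖) ^ M)⁻¹ else 0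

lemma measurable_remBound (k M : ℕ) :
    Measurable fun p : E N × E N => remBound k M p.1 p.2 := by
  unfold remBound
  refine Measurable.add (by fun_prop) (Measurable.ite ?_ (by fun_prop) measurable_const)
  exact measurableSet_le measurable_const (by fun_prop)

lemma inv_one_add_norm_shift (M : ℕ) (y : E N) {z : E N} (hz : ‖z‖ ≤ 1) :
    ((1 + ‖y - z‖) ^ M)⁻¹ ≤ 2 ^ M * ((1 + ‖y‖) ^ M)⁻¹ := by
  have h : 1 + ‖y‖ ≤ 2 * (1 + ‖y - z‖) := by
    have : ‖y‖ ≤ ‖y - z‖ + ‖z‖ := by simpa using norm_add_le (y - z) z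
    linarith [norm_nonneg (y - z)]
  rw [← div_eq_mul_inv, inv_eq_one_div, div_le_div_iff₀ (by positivity) (by positivity), one_mul,
    ← mul_pow]
  gcongr

/-- For `‖η‖ ≤ 1` the Taylor remainder of order `k + 1` is used; the segment from `y` to `y - η`
stays within distance one of `y`, so the decay in `y` survives. For `‖η‖ ≥ 1` there is no
cancellation to exploit, and `f (y - η)` and the polynomial are bounded separately. -/
lemma PolyGauss.taylor {c : ℝ} (hc : 0 < c) {f : E N → ℝ} (hf : PolyGauss c f) (k M : ℕ) :
    ∃ C : ℝ, 0 ≤ C ∧ ∀ y, ∃ p ∈ polyLE N k, ∀ η,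
      |f (y - η) - p η| ≤ C * remBound k M y η := by
  choose ι hι α b hα hb h using fun m => hf.iteratedDeriv_line m
  choose D hD0 hD using fun m a => ((hb m a).rapid hc).exists_nonneg M
  obtain ⟨D', hD'0, hD'⟩ := (hf.rapid hc).exists_nonneg M
  set S : ℕ → ℝ := fun m => ∑ a, D m a with hS
  have hS0 : ∀ m, 0 ≤ S m := fun m => Finset.sum_nonneg fun a _ => hD0 m a
  have hbd : ∀ m (y η z : E N), |∑ a, b m a z * monomial (α m a) η| ≤
      S m * ((1 + ‖z‖) ^ M)⁻¹ * ‖η‖ ^ m := by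
    intro m y η z
    rw [hS, Finset.sum_mul, Finset.sum_mul]
    refine (Finset.abs_sum_le_sum_abs _ _).trans (Finset.sum_le_sum fun a _ => ?_)
    rw [abs_mul]
    have := abs_monomial_le (α m a) η
    rw [hα] at this
    exact mul_le_mul (hD m a z) this (abs_nonneg _)
      (mul_nonneg (hD0 m a) (by positivity))
  set C₁ : ℝ := 2 ^ M * S (k + 1) with hC₁
  set C₂ : ℝ := ∑ m ∈ Finset.range (k + 1), S m with hC₂
  have hC₁0 : 0 ≤ C₁ := mul_nonneg (by positivity) (hS0 _)
  have hC₂0 : 0 ≤ C₂ := Finset.sum_nonneg fun m _ => hS0 m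
  refine ⟨C₁ + C₂ + D', by positivity, fun y => ?_⟩
  refine ⟨fun η => ∑ m ∈ Finset.range (k + 1), ((m.factorial : ℝ)⁻¹) *
    ∑ a, b m a y * monomial (α m a) η, ?_, fun η => ?_⟩
  · have : (fun η : E N => ∑ m ∈ Finset.range (k + 1), ((m.factorial : ℝ)⁻¹) *
        ∑ a, b m a y * monomial (α m a) η) = ∑ m ∈ Finset.range (k + 1), ((m.factorial : ℝ)⁻¹) •
        ∑ a, b m a y • monomial (α m a) := by
      ext η
      simp [Finset.sum_apply]
    rw [this]
    refine Submodule.sum_mem _ fun m hm => Submodule.smul_mem _ _ (Submodule.sum_mem _ fun a _ =>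
      Submodule.smul_mem _ _ (monomial_mem_polyLE ?_))
    rw [hα]
    have := Finset.mem_range.1 hm
    omega
  rcases le_total ‖η‖ 1 with h1 | h1
  · set g : ℝ → ℝ := fun θ => f (y - θ • η) with hg
    have hgs : ContDiff ℝ ∞ g := hf.contDiff.comp (by fun_prop)
    have hit : ∀ m, ∀ θ ∈ Icc (0 : ℝ) 1, iteratedDerivWithin m g (Icc 0 1) θ =
        ∑ a, b m a (y - θ • η) * monomial (α m a) η := fun m θ hθ => by
      rw [iteratedDerivWithin_eq_iteratedDeriv (uniqueDiffOn_Icc one_pos)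
        (hgs.contDiffAt.of_le (mod_cast le_top)) hθ, h]
    have ht := taylor_mean_remainder_bound (f := g) (a := 0) (b := 1) (x := 1) (n := k)
      (C := C₁ * ((1 + ‖y‖) ^ M)⁻¹ * ‖η‖ ^ (k + 1)) zero_le_one
      (hgs.contDiffOn.of_le (mod_cast le_top)) (by simp) ?_
    · have h3 : taylorWithinEval g k (Icc 0 1) 0 1 = ∑ m ∈ Finset.range (k + 1),
          ((m.factorial : ℝ)⁻¹) * ∑ a, b m a y * monomial (α m a) η := by
        rw [taylor_within_apply]
        refine Finset.sum_congr rfl fun m _ => ?_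
        rw [hit m 0 (by simp)]
        simp
      rw [h3] at ht
      simp only [hg, one_smul, Real.norm_eq_abs, sub_zero, one_pow, mul_one] at ht
      refine ht.trans ?_
      -- The factor `1 / k!` of the remainder bound is discarded.
      have h4 : (1 : ℝ) ≤ k.factorial := mod_cast Nat.succ_le_of_lt k.factorial_pos
      refine (div_le_self (by positivity) h4).trans ?_
      rw [remBound, min_eq_right h1, pow_succ]
      have h5 : (0 : ℝ) ≤ if 1 ≤ ‖η‖ then ((1 + ‖y - η‖) ^ M)⁻¹ else 0 := by
        split_ifs <;> positivity
      calc _ = C₁ * (‖η‖ ^ k * ‖η‖ * ((1 + ‖y‖) ^ M)⁻¹) := by ring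
        _ ≤ (C₁ + C₂ + D') * (‖η‖ ^ k * ‖η‖ * ((1 + ‖y‖) ^ M)⁻¹) := by gcongr; linarith
        _ ≤ _ := by gcongr; linarith
    · intro θ hθ
      rw [hit _ θ hθ, Real.norm_eq_abs]
      refine (hbd (k + 1) y η _).trans ?_
      have h6 : ‖θ • η‖ ≤ 1 := by
        rw [norm_smul, Real.norm_eq_abs, abs_of_nonneg hθ.1]
        exact mul_le_one₀ hθ.2 (norm_nonneg _) h1
      have := inv_one_add_norm_shift M y h6
      calc _ ≤ S (k + 1) * (2 ^ M * ((1 + ‖y‖) ^ M)⁻¹) * ‖η‖ ^ (k + 1) := by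
            gcongr; exact hS0 _
        _ = _ := by rw [hC₁]; ring
  · rw [remBound, if_pos h1, min_eq_left h1, mul_one]
    have e1 := hD' (y - η)
    have e2 : |∑ m ∈ Finset.range (k + 1), ((m.factorial : ℝ)⁻¹) *
        ∑ a, b m a y * monomial (α m a) η| ≤ C₂ * (‖η‖ ^ k * ((1 + ‖y‖) ^ M)⁻¹) := by
      rw [hC₂, Finset.sum_mul]
      refine (Finset.abs_sum_le_sum_abs _ _).trans (Finset.sum_le_sum fun m hm => ?_)
      have h4 : (1 : ℝ) ≤ m.factorial := mod_cast Nat.succ_le_of_lt m.factorial_pos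
      have hmk : m ≤ k := by have := Finset.mem_range.1 hm; omega
      rw [abs_mul, abs_of_nonneg (by positivity)]
      calc _ ≤ 1 * (S m * ((1 + ‖y‖) ^ M)⁻¹ * ‖η‖ ^ m) := by
            gcongr
            · exact inv_le_one_of_one_le₀ h4
            · exact hbd m y η y
        -- As `‖η‖ ≥ 1`, every power `m ≤ k` may be raised to `k`.
        _ ≤ 1 * (S m * ((1 + ‖y‖) ^ M)⁻¹ * ‖η‖ ^ k) := by
            have := hS0 m
            gcongr
        _ = _ := by ring
    have h8 : 0 ≤ ‖η‖ ^ k * ((1 + ‖y‖) ^ M)⁻¹ := by positivity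
    have h9 : 0 ≤ ((1 + ‖y - η‖) ^ M)⁻¹ := by positivity
    calc _ ≤ |f (y - η)| + _ := abs_sub _ _
      _ ≤ D' * ((1 + ‖y - η‖) ^ M)⁻¹ + C₂ * (‖η‖ ^ k * ((1 + ‖y‖) ^ M)⁻¹) := add_le_add e1 e2
      _ ≤ _ := by nlinarith

/-! ### Functions with vanishing moments -/

/-- The moments up to the order `k` vanish. -/
def ZeroMoments (k : ℕ) (f : E N → ℝ) : Prop := ∀ α, deg α ≤ k → ∫ x, monomial α x * f x = 0

/-- The moments up to the order `k` exist. -/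
def HasMoments (k : ℕ) (f : E N → ℝ) : Prop :=
  ∀ α, deg α ≤ k → Integrable fun x => monomial α x * f x

lemma monomial_smul (α : Fin N → ℕ) (a : ℝ) (x : E N) :
    monomial α (a • x) = a ^ deg α * monomial α x := by
  simp only [monomial, PiLp.smul_apply, smul_eq_mul, mul_pow, Finset.prod_mul_distrib, deg,
    Finset.prod_pow_eq_pow_sum]

/-- The dilation by `a` is included because the Taylor expansion is made in the rescaled variable `ξ
/ √τ`. -/
lemma HasMoments.integral_poly {k : ℕ} {f p : E N → ℝ} (hf : HasMoments k f) (hp : p ∈ polyLE N k)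
    (a : ℝ) : Integrable (fun x => p (a • x) * f x) ∧
      (ZeroMoments k f → ∫ x, p (a • x) * f x = 0) := by
  induction hp using Submodule.span_induction with
  | mem p hp =>
    obtain ⟨α, hα, rfl⟩ := hp
    simp_rw [monomial_smul, mul_assoc]
    refine ⟨(hf α hα).const_mul _, fun h0 => ?_⟩
    rw [integral_const_mul, h0 α hα, mul_zero]
  | zero => simp
  | add p q _ _ h1 h2 =>
    simp only [Pi.add_apply, add_mul]
    refine ⟨h1.1.add h2.1, fun h0 => ?_⟩
    rw [integral_add h1.1 h2.1, h1.2 h0, h2.2 h0, add_zero]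
  | smul b p _ h =>
    simp only [Pi.smul_apply, smul_eq_mul, mul_assoc]
    refine ⟨h.1.const_mul _, fun h0 => ?_⟩
    rw [integral_const_mul, h.2 h0, mul_zero]

lemma HasMoments.integrable {k : ℕ} {f : E N → ℝ} (hf : HasMoments k f) : Integrable f := by
  have := hf 0 (by simp [deg])
  simpa [monomial] using this

/-! ### Scaled kernels -/

/-- The kernel `τ^{-N/2} Γ(z/√τ)`. -/
def dil (Γ : E N → ℝ) (τ : ℝ) (z : E N) : ℝ := τ ^ (-(N : ℝ) / 2) * Γ ((Real.sqrt τ)⁻¹ • z)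

/-- The convolution with the scaled kernel. -/
def conv (Γ : E N → ℝ) (τ : ℝ) (f : E N → ℝ) (x : E N) : ℝ := ∫ ξ, dil Γ τ (x - ξ) * f ξ

/-- The Gauss kernel at time one. -/
def gauss (N : ℕ) : E N → ℝ := fun x => gaussKernel x 1

lemma polyGauss_gauss : PolyGauss (1 / 4) (gauss N) := by
  have := polyGauss_gaussKernel (N := N) 1
  rwa [mul_one] at this

lemma dil_gauss {τ : ℝ} (hτ : 0 < τ) : dil (gauss N) τ = fun x => gaussKernel x τ := by
  ext x; rw [gaussKernel_scale hτ]; rfl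

lemma heat_eq_conv {τ : ℝ} (hτ : 0 < τ) (f : E N → ℝ) : heat τ f = conv (gauss N) τ f := by
  ext x; simp only [heat, conv, dil_gauss hτ]

lemma measurable_dil {Γ : E N → ℝ} (hΓ : Continuous Γ) :
    Measurable fun p : ℝ × E N => dil Γ p.1 p.2 := by
  unfold dil
  refine Measurable.mul ?_ (hΓ.measurable.comp ?_)
  · exact (measurable_fst.pow_const _)
  · exact (Measurable.inv (Real.continuous_sqrt.measurable.comp measurable_fst)).smul measurable_snd

lemma continuous_dil {Γ : E N → ℝ} (hΓ : Continuous Γ) (τ : ℝ) : Continuous (dil Γ τ) := by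
  unfold dil; fun_prop

lemma partialDeriv_dil (Γ : E N → ℝ) {τ : ℝ} (i : Fin N) :
    partialDeriv i (dil Γ τ) = fun z => (Real.sqrt τ)⁻¹ * dil (partialDeriv i Γ) τ z := by
  unfold dil
  rw [partialDeriv_const_mul i _ (fun z => Γ ((Real.sqrt τ)⁻¹ • z)), partialDeriv_comp_smul]
  ext z
  ring

lemma boundedC1_dil {c : ℝ} (hc : 0 < c) {Γ : E N → ℝ} (hΓ : PolyGauss c Γ) (τ : ℝ) :
    BoundedC1 (dil Γ τ) := by
  have h := hΓ.boundedC1 hc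
  refine ⟨?_, ?_, ?_⟩
  · unfold dil
    exact contDiff_const.mul (h.contDiff.comp (contDiff_const_smul _))
  · obtain ⟨C, hC⟩ := h.bdd
    refine ⟨|τ ^ (-(N : ℝ) / 2)| * C, fun y => ?_⟩
    rw [dil, abs_mul]
    gcongr
    exact hC _
  · choose C hC using fun i => ((hΓ.partialDeriv i).boundedC1 hc).bdd
    refine ⟨∑ i, |(Real.sqrt τ)⁻¹| * (|τ ^ (-(N : ℝ) / 2)| * C i), fun y =>
      (norm_fderiv_le_sum _ y).trans (Finset.sum_le_sum fun i _ => ?_)⟩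
    rw [partialDeriv_dil, abs_mul, dil, abs_mul]
    gcongr
    exact hC _ _

lemma contDiff_conv {c : ℝ} (hc : 0 < c) {Γ f : E N → ℝ} (hΓ : PolyGauss c Γ) (τ : ℝ)
    (hf : Integrable f) : ContDiff ℝ 1 (conv Γ τ f) :=
  (boundedC1_dil hc hΓ τ).contDiff_integral hf

lemma partialDeriv_conv {c : ℝ} (hc : 0 < c) {Γ f : E N → ℝ} (hΓ : PolyGauss c Γ) (τ : ℝ)
    (hf : Integrable f) (i : Fin N) :
    partialDeriv i (conv Γ τ f) = fun x => (Real.sqrt τ)⁻¹ * conv (partialDeriv i Γ) τ f x := by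
  unfold conv
  rw [(boundedC1_dil hc hΓ τ).partialDeriv_integral hf, partialDeriv_dil]
  ext x
  rw [← integral_const_mul]
  simp only [mul_assoc]

/-! ### Weighted norms -/

/-- The weight `(1 + |x| / √(1 + s))^K`. -/
def omega (K s : ℝ) (x : E N) : ℝ := (1 + ‖x‖ / Real.sqrt (1 + s)) ^ K

/-- The weighted `L¹` norm at the time `s`. -/
def wnorm {V : Type*} [NormedAddCommGroup V] (K s : ℝ) (f : E N → V) : ℝ≥0∞ :=
  ∫⁻ x, ENNReal.ofReal (omega K s x) * ‖f x‖ₑ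

/-- The sum of the weighted `L¹` norm and the scaled `L^∞` norm at the time `s`. -/
def star {V : Type*} [NormedAddCommGroup V] (K s : ℝ) (f : E N → V) : ℝ≥0∞ :=
  wnorm K s f + ENNReal.ofReal (s ^ ((N : ℝ) / 2)) * eLpNorm f ∞ volume

/-- As `star`, with the supremum in place of the essential supremum. -/
def ostar {V : Type*} [NormedAddCommGroup V] (K s : ℝ) (f : E N → V) : ℝ≥0∞ :=
  wnorm K s f + ENNReal.ofReal (s ^ ((N : ℝ) / 2)) * ⨆ x, ‖f x‖ₑ

lemma one_le_omega {K : ℝ} (hK : 0 ≤ K) (s : ℝ) (x : E N) : 1 ≤ omega K s x := by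
  unfold omega
  exact Real.one_le_rpow (by have : 0 ≤ ‖x‖ / Real.sqrt (1 + s) := by positivity
                             linarith) hK

lemma omega_nonneg (K s : ℝ) (x : E N) : 0 ≤ omega K s x := by unfold omega; positivity

lemma measurable_omega (K s : ℝ) : Measurable (omega (N := N) K s) := by
  unfold omega; exact Measurable.pow_const (by fun_prop) _

lemma star_le_ostar {V : Type*} [NormedAddCommGroup V] (K s : ℝ) (f : E N → V) :
    star K s f ≤ ostar K s f := by
  unfold star ostar
  gcongr
  rw [eLpNorm_exponent_top]
  exact eLpNormEssSup_le_of_ae_enorm_bound (ae_of_all _ fun x => le_iSup (fun x => ‖f x‖ₑ) x)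

lemma lintegral_le_wnorm {V : Type*} [NormedAddCommGroup V] {K : ℝ} (hK : 0 ≤ K) (s : ℝ)
    (f : E N → V) : ∫⁻ x, ‖f x‖ₑ ≤ wnorm K s f := by
  refine lintegral_mono fun x => ?_
  have : (1 : ℝ≥0∞) ≤ ENNReal.ofReal (omega K s x) := by
    rw [ENNReal.one_le_ofReal]; exact one_le_omega hK s x
  simpa using mul_le_mul_left this ‖f x‖ₑ

lemma wnorm_le_star {V : Type*} [NormedAddCommGroup V] (K s : ℝ) (f : E N → V) :
    wnorm K s f ≤ star K s f := le_self_add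

lemma rpow_mul_rpow_neg_half {τ : ℝ} (hτ : 0 < τ) :
    ENNReal.ofReal (τ ^ (-(N : ℝ) / 2)) * ENNReal.ofReal (τ ^ ((N : ℝ) / 2)) = 1 := by
  rw [← ENNReal.ofReal_mul (by positivity), ← Real.rpow_add hτ, neg_div, neg_add_cancel,
    Real.rpow_zero, ENNReal.ofReal_one]

lemma lintegral_comp_inv_sqrt {τ : ℝ} (hτ : 0 < τ) {g : E N → ℝ≥0∞} (hg : Measurable g) :
    ∫⁻ x, g ((Real.sqrt τ)⁻¹ • x) = ENNReal.ofReal (τ ^ ((N : ℝ) / 2)) * ∫⁻ x, g x := by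
  have hr : (Real.sqrt τ)⁻¹ ≠ 0 := by positivity
  have h := Measure.map_addHaar_smul (volume : Measure (E N)) hr
  have h2 := lintegral_map (μ := (volume : Measure (E N))) hg
    (measurable_const_smul (Real.sqrt τ)⁻¹ : Measurable fun x : E N => _)
  rw [← h2, h, lintegral_smul_measure, smul_eq_mul]
  congr 2
  rw [finrank_euclideanSpace, Fintype.card_fin, inv_pow, inv_inv, abs_of_nonneg (by positivity),
    Real.sqrt_eq_rpow, ← Real.rpow_natCast, ← Real.rpow_mul hτ.le]
  congr 1
  ring

/-- For a weighted `L¹` bound only the integrals of the kernel over `x` matter: Tonelli and a bound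
uniform in `ξ`. -/
lemma lintegral_mul_le_of_kernel {κ : E N → E N → ℝ≥0∞} (hκ : Measurable (Function.uncurry κ))
    {a b : E N → ℝ≥0∞} (ha : Measurable a) {C : ℝ≥0∞} (hC : C ≠ ⊤)
    (h : ∀ ξ, ∫⁻ x, a x * κ x ξ ≤ C * b ξ) {f g : E N → ℝ} (hf : AEStronglyMeasurable f)
    (hg : ∀ x, ‖g x‖ₑ ≤ ∫⁻ ξ, κ x ξ * ‖f ξ‖ₑ) :
    ∫⁻ x, a x * ‖g x‖ₑ ≤ C * ∫⁻ ξ, b ξ * ‖f ξ‖ₑ := by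
  have hκx : ∀ x, Measurable (κ x) := fun x => hκ.comp measurable_prodMk_left
  have hκξ : ∀ ξ, Measurable fun x => κ x ξ := fun ξ => hκ.comp measurable_prodMk_right
  have hfm : AEMeasurable fun ξ => ‖f ξ‖ₑ := hf.enorm
  calc ∫⁻ x, a x * ‖g x‖ₑ ≤ ∫⁻ x, ∫⁻ ξ, a x * (κ x ξ * ‖f ξ‖ₑ) := by
        refine lintegral_mono fun x => ?_
        simp only
        refine (mul_le_mul_right (hg x) (a x)).trans (le_of_eq ?_)
        exact (lintegral_const_mul'' _ ((hκx x).aemeasurable.mul hfm)).symm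
    _ = ∫⁻ ξ, ∫⁻ x, a x * (κ x ξ * ‖f ξ‖ₑ) := by
        refine lintegral_lintegral_swap ?_
        refine ((ha.comp measurable_fst).aemeasurable).mul (hκ.aemeasurable.mul ?_)
        exact (hf.comp_snd (μ := volume)).enorm
    _ = ∫⁻ ξ, (∫⁻ x, a x * κ x ξ) * ‖f ξ‖ₑ := by
        refine lintegral_congr fun ξ => ?_
        simp only [← mul_assoc]
        exact lintegral_mul_const _ (ha.mul (hκξ ξ))
    _ ≤ ∫⁻ ξ, C * (b ξ * ‖f ξ‖ₑ) := by
        refine lintegral_mono fun ξ => ?_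
        simp only
        rw [← mul_assoc]
        gcongr
        exact h ξ
    _ = _ := lintegral_const_mul' _ _ hC

lemma lintegral_inv_pow_lt_top :
    ∫⁻ y : E N, ENNReal.ofReal (((1 + ‖y‖) ^ (N + 1))⁻¹) < ⊤ :=
  (integrable_inv_pow (N := N) (N + 1) (by omega)).lintegral_lt_top

lemma Rapid.lintegral_weight_lt_top {Γ : E N → ℝ} (hΓ : Rapid Γ) {K : ℝ} :
    ∫⁻ y, ENNReal.ofReal ((1 + ‖y‖) ^ K) * ‖Γ y‖ₑ < ⊤ := by
  obtain ⟨C, hC0, hC⟩ := hΓ.exists_nonneg (⌈K⌉₊ + (N + 1))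
  refine lt_of_le_of_lt (b := ∫⁻ y : E N, ENNReal.ofReal C *
    ENNReal.ofReal (((1 + ‖y‖) ^ (N + 1))⁻¹)) (lintegral_mono fun y => ?_) ?_
  · rw [Real.enorm_eq_ofReal_abs, ← ENNReal.ofReal_mul (by positivity), ← ENNReal.ofReal_mul hC0]
    refine ENNReal.ofReal_le_ofReal ?_
    have h1 : (1 + ‖y‖) ^ K ≤ (1 + ‖y‖) ^ ⌈K⌉₊ := by
      rw [← Real.rpow_natCast]
      exact Real.rpow_le_rpow_of_exponent_le (by linarith [norm_nonneg y]) (Nat.le_ceil K)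
    calc _ ≤ (1 + ‖y‖) ^ ⌈K⌉₊ * (C * ((1 + ‖y‖) ^ (⌈K⌉₊ + (N + 1)))⁻¹) := by gcongr; exact hC y
      _ = _ := by rw [pow_add]; field_simp
  · rw [lintegral_const_mul' _ _ ENNReal.ofReal_ne_top]
    exact ENNReal.mul_lt_top ENNReal.ofReal_lt_top lintegral_inv_pow_lt_top

lemma norm_inv_sqrt_smul (τ : ℝ) (x : E N) :
    ‖(Real.sqrt τ)⁻¹ • x‖ = ‖x‖ / Real.sqrt τ := by
  rw [norm_smul, Real.norm_eq_abs, abs_of_nonneg (by positivity)]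
  ring

lemma lintegral_weight_scale (K : ℝ) {τ : ℝ} (hτ : 0 < τ) {g : E N → ℝ≥0∞} (hg : Measurable g) :
    ∫⁻ x, ENNReal.ofReal ((1 + ‖x‖ / Real.sqrt τ) ^ K) *
      (ENNReal.ofReal (τ ^ (-(N : ℝ) / 2)) * g ((Real.sqrt τ)⁻¹ • x)) =
      ∫⁻ y, ENNReal.ofReal ((1 + ‖y‖) ^ K) * g y := by
  have hm : Measurable fun y : E N => ENNReal.ofReal ((1 + ‖y‖) ^ K) * g y :=
    (Measurable.pow_const (by fun_prop) _).ennreal_ofReal.mul hg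
  have h2 := lintegral_comp_inv_sqrt hτ hm
  simp only [norm_inv_sqrt_smul] at h2
  simp only [mul_left_comm]
  rw [lintegral_const_mul' _ _ ENNReal.ofReal_ne_top, h2, ← mul_assoc,
    rpow_mul_rpow_neg_half hτ, one_mul]

lemma lintegral_weight_dil {Γ : E N → ℝ} (hΓ : Continuous Γ) (K : ℝ) {τ : ℝ} (hτ : 0 < τ) :
    ∫⁻ z, ENNReal.ofReal ((1 + ‖z‖ / Real.sqrt τ) ^ K) * ‖dil Γ τ z‖ₑ =
      ∫⁻ y, ENNReal.ofReal ((1 + ‖y‖) ^ K) * ‖Γ y‖ₑ := by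
  rw [← lintegral_weight_scale K hτ hΓ.measurable.enorm]
  refine lintegral_congr fun z => ?_
  rw [dil, enorm_mul, Real.enorm_of_nonneg (by positivity)]

lemma enorm_conv_le (Γ : E N → ℝ) (τ : ℝ) (f : E N → ℝ) (x : E N) :
    ‖conv Γ τ f x‖ₑ ≤ ∫⁻ ξ, ‖dil Γ τ (x - ξ)‖ₑ * ‖f ξ‖ₑ := by
  unfold conv
  refine (enorm_integral_le_lintegral_enorm _).trans (le_of_eq ?_)
  simp only [enorm_mul]

/-- `1 + a + b ≤ (1 + a)(1 + b)`, after shrinking the length scales to `√(1 + s)` and `√τ`. The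
weight thus passes from time `s` to time `s + τ` at the price of a weight on the rescaled kernel. -/
lemma omega_add_le {K s τ : ℝ} (hK : 0 ≤ K) (hs : 0 ≤ s) (hτ : 0 < τ) (x ξ : E N) :
    omega K (s + τ) x ≤ omega K s ξ * (1 + ‖x - ξ‖ / Real.sqrt τ) ^ K := by
  unfold omega
  rw [← Real.mul_rpow (by positivity) (by positivity)]
  refine Real.rpow_le_rpow (by positivity) ?_ hK
  have h1 : ‖x‖ ≤ ‖ξ‖ + ‖x - ξ‖ := by simpa using norm_add_le ξ (x - ξ)
  have h2 : ‖ξ‖ / Real.sqrt (1 + (s + τ)) ≤ ‖ξ‖ / Real.sqrt (1 + s) := by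
    gcongr; linarith
  have h3 : ‖x - ξ‖ / Real.sqrt (1 + (s + τ)) ≤ ‖x - ξ‖ / Real.sqrt τ := by
    gcongr; linarith
  have h4 : ‖x‖ / Real.sqrt (1 + (s + τ)) ≤
      ‖ξ‖ / Real.sqrt (1 + (s + τ)) + ‖x - ξ‖ / Real.sqrt (1 + (s + τ)) := by
    rw [← add_div]; gcongr
  have h5 : 0 ≤ ‖ξ‖ / Real.sqrt (1 + s) * (‖x - ξ‖ / Real.sqrt τ) := by positivity
  nlinarith

lemma conv_wnorm_le {Γ : E N → ℝ} (hΓc : Continuous Γ) (hΓ : Rapid Γ) {K s τ : ℝ} (hK : 0 ≤ K)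
    (hs : 0 ≤ s) (hτ : 0 < τ) {f : E N → ℝ} (hf : AEStronglyMeasurable f) :
    wnorm K (s + τ) (conv Γ τ f) ≤
      (∫⁻ y, ENNReal.ofReal ((1 + ‖y‖) ^ K) * ‖Γ y‖ₑ) * wnorm K s f := by
  have hd := continuous_dil hΓc τ
  refine lintegral_mul_le_of_kernel (κ := fun x ξ => ‖dil Γ τ (x - ξ)‖ₑ) ?_
    (measurable_omega K (s + τ)).ennreal_ofReal hΓ.lintegral_weight_lt_top.ne (fun ξ => ?_) hf
    (enorm_conv_le Γ τ f)
  · exact (hd.comp (continuous_fst.sub continuous_snd)).measurable.enorm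
  · calc _ ≤ ∫⁻ x, ENNReal.ofReal (omega K s ξ) *
          (ENNReal.ofReal ((1 + ‖x - ξ‖ / Real.sqrt τ) ^ K) * ‖dil Γ τ (x - ξ)‖ₑ) := by
          refine lintegral_mono fun x => ?_
          simp only
          rw [← mul_assoc, ← ENNReal.ofReal_mul (omega_nonneg _ _ _)]
          gcongr
          exact omega_add_le hK hs hτ x ξ
      _ = _ := by
          rw [lintegral_const_mul' _ _ ENNReal.ofReal_ne_top, mul_comm,
            lintegral_sub_right_eq_self (fun z => ENNReal.ofReal ((1 + ‖z‖ / Real.sqrt τ) ^ K) *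
              ‖dil Γ τ z‖ₑ) ξ, lintegral_weight_dil hΓc K hτ]

lemma enorm_conv_le_of_L1 {Γ : E N → ℝ} {C : ℝ} (hC : ∀ y, |Γ y| ≤ C) {τ : ℝ}
    (f : E N → ℝ) (x : E N) :
    ‖conv Γ τ f x‖ₑ ≤ ENNReal.ofReal (|τ ^ (-(N : ℝ) / 2)|) * ENNReal.ofReal C * ∫⁻ ξ, ‖f ξ‖ₑ := by
  refine (enorm_conv_le Γ τ f x).trans ?_
  rw [← lintegral_const_mul' _ _ (ENNReal.mul_ne_top ENNReal.ofReal_ne_top ENNReal.ofReal_ne_top)]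
  refine lintegral_mono fun ξ => ?_
  simp only
  gcongr
  rw [dil, enorm_mul, Real.enorm_eq_ofReal_abs, Real.enorm_eq_ofReal_abs]
  gcongr
  exact hC _

lemma enorm_conv_le_of_Linfty {Γ : E N → ℝ} (hΓc : Continuous Γ) {τ : ℝ} (hτ : 0 < τ)
    (f : E N → ℝ) (x : E N) :
    ‖conv Γ τ f x‖ₑ ≤ (∫⁻ y, ‖Γ y‖ₑ) * eLpNorm f ∞ volume := by
  refine (enorm_conv_le Γ τ f x).trans ?_
  have h1 : ∫⁻ ξ, ‖dil Γ τ (x - ξ)‖ₑ = ∫⁻ y, ‖Γ y‖ₑ := by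
    rw [lintegral_sub_left_eq_self (fun z => ‖dil Γ τ z‖ₑ) x]
    simpa using lintegral_weight_dil hΓc 0 hτ
  have hd := continuous_dil hΓc τ
  have hm : Measurable fun ξ => ‖dil Γ τ (x - ξ)‖ₑ := (hd.measurable.comp (by fun_prop)).enorm
  rw [← h1, ← lintegral_mul_const _ hm]
  refine lintegral_mono_ae ?_
  filter_upwards [enorm_ae_le_eLpNormEssSup f volume] with ξ hξ
  rw [eLpNorm_exponent_top]
  gcongr

lemma rpow_half_le_of_le {a b : ℝ} (hb : 0 ≤ b) (h : b ≤ 2 * a) (ha : 0 ≤ a) :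
    ENNReal.ofReal (b ^ ((N : ℝ) / 2)) ≤
      ENNReal.ofReal (2 ^ ((N : ℝ) / 2)) * ENNReal.ofReal (a ^ ((N : ℝ) / 2)) := by
  rw [← ENNReal.ofReal_mul (by positivity), ← Real.mul_rpow (by positivity) ha]
  exact ENNReal.ofReal_le_ofReal (Real.rpow_le_rpow hb h (by positivity))

lemma mul_add_le_mul_add (a b c w x : ℝ≥0∞) :
    a * w + (b * w + c * x) ≤ (a + b + c) * (w + x) := by
  have : (a + b + c) * (w + x) = a * w + (b * w + c * x) + (c * w + (a + b) * x) := by ring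
  rw [this]
  exact le_self_add

/-- The supremum part uses the smoothing from `L¹` to `L^∞` when `s ≤ τ` and boundedness on `L^∞`
when `τ ≤ s`. In both cases the time that enters is at least half of `s + τ`, so the constant does
not degenerate as `s` or `τ` tends to zero. -/
lemma conv_ostar_le {Γ : E N → ℝ} (hΓc : Continuous Γ) (hΓ : Rapid Γ) {K : ℝ} (hK : 0 ≤ K) :
    ∃ C : ℝ≥0∞, C ≠ ⊤ ∧ ∀ (s τ : ℝ) (f : E N → ℝ), 0 ≤ s → 0 < τ → AEStronglyMeasurable f →
      ostar K (s + τ) (conv Γ τ f) ≤ C * star K s f := by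
  obtain ⟨B, hB⟩ := hΓ.bdd
  set W := ∫⁻ y, ENNReal.ofReal ((1 + ‖y‖) ^ K) * ‖Γ y‖ₑ with hW
  set D := ENNReal.ofReal (2 ^ ((N : ℝ) / 2)) with hD
  have hWt : W ≠ ⊤ := hΓ.lintegral_weight_lt_top.ne
  have hW1 : ∫⁻ y, ‖Γ y‖ₑ ≠ ⊤ := by
    have := (hΓ.lintegral_weight_lt_top (K := 0)).ne
    simpa using this
  have hDt : D ≠ ⊤ := ENNReal.ofReal_ne_top
  refine ⟨W + D * ENNReal.ofReal B + D * ∫⁻ y, ‖Γ y‖ₑ, ?_, fun s τ f hs hτ hf => ?_⟩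
  · exact ENNReal.add_ne_top.2 ⟨ENNReal.add_ne_top.2 ⟨hWt, ENNReal.mul_ne_top hDt
      ENNReal.ofReal_ne_top⟩, ENNReal.mul_ne_top hDt hW1⟩
  have h1 := conv_wnorm_le hΓc hΓ hK hs hτ hf
  have h2 : ENNReal.ofReal ((s + τ) ^ ((N : ℝ) / 2)) * (⨆ x, ‖conv Γ τ f x‖ₑ) ≤
      D * ENNReal.ofReal B * wnorm K s f +
        D * (∫⁻ y, ‖Γ y‖ₑ) * (ENNReal.ofReal (s ^ ((N : ℝ) / 2)) * eLpNorm f ∞ volume) := by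
    rw [ENNReal.mul_iSup]
    refine iSup_le fun x => ?_
    rcases le_total s τ with h | h
    · refine le_add_right ?_
      calc _ ≤ (D * ENNReal.ofReal (τ ^ ((N : ℝ) / 2))) *
            (ENNReal.ofReal (|τ ^ (-(N : ℝ) / 2)|) * ENNReal.ofReal B * ∫⁻ ξ, ‖f ξ‖ₑ) :=
            mul_le_mul' (rpow_half_le_of_le (by linarith) (by linarith) hτ.le)
              (enorm_conv_le_of_L1 hB f x)
        _ = (ENNReal.ofReal (τ ^ (-(N : ℝ) / 2)) * ENNReal.ofReal (τ ^ ((N : ℝ) / 2))) *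
            (D * ENNReal.ofReal B * ∫⁻ ξ, ‖f ξ‖ₑ) := by
            rw [abs_of_nonneg (by positivity)]; ring
        _ ≤ _ := by
            rw [rpow_mul_rpow_neg_half hτ, one_mul]
            gcongr
            exact lintegral_le_wnorm hK s f
    · refine le_add_left ?_
      calc _ ≤ (D * ENNReal.ofReal (s ^ ((N : ℝ) / 2))) * ((∫⁻ y, ‖Γ y‖ₑ) * eLpNorm f ∞ volume) :=
            mul_le_mul' (rpow_half_le_of_le (by linarith) (by linarith) hs)
              (enorm_conv_le_of_Linfty hΓc hτ f x)
        _ = _ := by ring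
  unfold ostar star
  refine (add_le_add h1 h2).trans ?_
  exact mul_add_le_mul_add _ _ _ _ _

/-! ### The gain from vanishing moments. -/

lemma lam_aux {K : ℝ} {k : ℕ} (hkK : (k : ℝ) ≤ K) {r : ℝ} (hr : 0 ≤ r) :
    r ^ k * min 1 r ≤ r ^ K * (min 1 r) ^ ((k : ℝ) + 1 - K) := by
  rcases hr.eq_or_lt with h0 | h0
  · subst h0
    have : min (1 : ℝ) 0 = 0 := by simp
    rw [this, mul_zero]
    positivity
  rcases le_total r 1 with h | h
  · rw [min_eq_right h, ← Real.rpow_add h0, ← pow_succ, ← Real.rpow_natCast]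
    apply le_of_eq
    congr 1
    push_cast
    ring
  · rw [min_eq_left h, Real.one_rpow, mul_one, mul_one, ← Real.rpow_natCast]
    exact Real.rpow_le_rpow_of_exponent_le h hkK

/-- The gain for functions with vanishing moments. -/
def lam (K : ℝ) (k : ℕ) (r : ℝ) : ℝ := r ^ K * (min 1 r) ^ ((k : ℝ) + 1 - K)

lemma lam_nonneg (K : ℝ) (k : ℕ) {r : ℝ} (hr : 0 ≤ r) : 0 ≤ lam K k r := by
  have : 0 ≤ min 1 r := le_min zero_le_one hr
  unfold lam
  positivity

lemma rpow_le_lam (K : ℝ) (k : ℕ) {r : ℝ} (hr : 1 ≤ r) : r ^ K ≤ lam K k r := by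
  rw [lam, min_eq_left hr, Real.one_rpow, mul_one]

lemma lam_le {K : ℝ} {k : ℕ} (hK1 : K ≤ k + 1) {r : ℝ} (hr : 0 ≤ r) : lam K k r ≤ r ^ K := by
  have h0 : 0 ≤ min 1 r := le_min zero_le_one hr
  unfold lam
  exact mul_le_of_le_one_right (by positivity)
    (Real.rpow_le_one h0 (min_le_left _ _) (by linarith))

lemma measurable_lam (K : ℝ) (k : ℕ) : Measurable (lam K k) := by
  unfold lam
  exact (measurable_id.pow_const _).mul ((measurable_const.min measurable_id).pow_const _)

/-- The Taylor remainder is of order `r^{k+1}` for small `r = ‖η‖`, and a growth like `r^K` is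
affordable for large `r` because `K` moments are available; `lam` has these two behaviours. -/
lemma remBound_le {K : ℝ} (hK : 0 ≤ K) {k : ℕ} (hkK : (k : ℝ) ≤ K) (M : ℕ) (y η : E N) :
    remBound k M y η ≤ 2 * lam K k ‖η‖ := by
  have h1 := lam_aux hkK (norm_nonneg η)
  have h2 : ((1 + ‖y‖) ^ M)⁻¹ ≤ 1 :=
    inv_le_one_of_one_le₀ (one_le_pow₀ (by linarith [norm_nonneg y]))
  have h3 : ((1 + ‖y - η‖) ^ M)⁻¹ ≤ 1 :=
    inv_le_one_of_one_le₀ (one_le_pow₀ (by linarith [norm_nonneg (y - η)]))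
  have h4 : 0 ≤ ‖η‖ ^ k * min 1 ‖η‖ := by
    have : 0 ≤ min 1 ‖η‖ := le_min zero_le_one (norm_nonneg _)
    positivity
  rw [two_mul, remBound]
  refine add_le_add ((mul_le_of_le_one_right h4 h2).trans h1) ?_
  split_ifs with h
  · exact h3.trans ((Real.one_le_rpow h hK).trans (rpow_le_lam K k h))
  · exact lam_nonneg K k (norm_nonneg _)

/-- In the exponent `k + 1 + (N + 1)`, the part `k + 1 ≥ K` absorbs the weight and `N + 1` leaves an
integrable function of `y`. For `‖η‖ ≥ 1` the weight at `y` is first bounded by the weight at `y -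
η` times `(2‖η‖)^K`. -/
lemma weight_mul_remBound_le {K : ℝ} (hK : 0 ≤ K) {k : ℕ} (hkK : (k : ℝ) ≤ K) (hK1 : K ≤ k + 1)
    (y η : E N) : (1 + ‖y‖) ^ K * remBound k (k + 1 + (N + 1)) y η ≤
      lam K k ‖η‖ * (((1 + ‖y‖) ^ (N + 1))⁻¹ + 2 ^ K * ((1 + ‖y - η‖) ^ (N + 1))⁻¹) := by
  have hl := lam_nonneg K k (norm_nonneg η)
  have hpow : ∀ z : E N, (1 + ‖z‖) ^ K * ((1 + ‖z‖) ^ (k + 1 + (N + 1)))⁻¹ ≤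
      ((1 + ‖z‖) ^ (N + 1))⁻¹ := by
    intro z
    have h1 : (1 + ‖z‖) ^ K ≤ (1 + ‖z‖) ^ (k + 1) := by
      rw [← Real.rpow_natCast]
      exact Real.rpow_le_rpow_of_exponent_le (by linarith [norm_nonneg z]) (by exact_mod_cast hK1)
    calc _ ≤ (1 + ‖z‖) ^ (k + 1) * ((1 + ‖z‖) ^ (k + 1 + (N + 1)))⁻¹ := by gcongr
      _ = _ := by rw [pow_add _ (k + 1)]; field_simp
  have h4 : 0 ≤ ‖η‖ ^ k * min 1 ‖η‖ := by
    have : 0 ≤ min 1 ‖η‖ := le_min zero_le_one (norm_nonneg _)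
    positivity
  rw [remBound, mul_add, mul_add]
  refine add_le_add ?_ ?_
  · rw [mul_left_comm]
    exact mul_le_mul (lam_aux hkK (norm_nonneg η)) (hpow y) (by positivity) hl
  · split_ifs with h
    · have h5 : (1 + ‖y‖) ^ K ≤ (1 + ‖y - η‖) ^ K * (2 ^ K * ‖η‖ ^ K) := by
        rw [← Real.mul_rpow (by positivity) (by positivity),
          ← Real.mul_rpow (by positivity) (by positivity)]
        refine Real.rpow_le_rpow (by positivity) ?_ hK
        have h6 : ‖y‖ ≤ ‖y - η‖ + ‖η‖ := by simpa using norm_add_le (y - η) η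
        nlinarith [norm_nonneg (y - η)]
      calc _ ≤ ((1 + ‖y - η‖) ^ K * (2 ^ K * ‖η‖ ^ K)) *
            ((1 + ‖y - η‖) ^ (k + 1 + (N + 1)))⁻¹ := by gcongr
        _ = (2 ^ K * ‖η‖ ^ K) * ((1 + ‖y - η‖) ^ K * ((1 + ‖y - η‖) ^ (k + 1 + (N + 1)))⁻¹) := by
            ring
        _ ≤ (2 ^ K * lam K k ‖η‖) * ((1 + ‖y - η‖) ^ (N + 1))⁻¹ := by
            gcongr
            · exact rpow_le_lam K k h
            · exact hpow _
        _ = _ := by ring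
    · rw [mul_zero]
      positivity

/-- The Taylor polynomial at `x / √τ` has degree at most `k` in `ξ`, so it integrates to zero
against `f` and only the remainder of the kernel is left. -/
lemma enorm_conv_le_of_zeroMoments {c : ℝ} (hc : 0 < c) {Γ : E N → ℝ} (hΓ : PolyGauss c Γ)
    (k M : ℕ) : ∃ C : ℝ, 0 ≤ C ∧ ∀ (τ : ℝ) (f : E N → ℝ), 0 < τ → HasMoments k f →
      ZeroMoments k f → ∀ x, ‖conv Γ τ f x‖ₑ ≤ ∫⁻ ξ, ENNReal.ofReal (τ ^ (-(N : ℝ) / 2)) *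
        ENNReal.ofReal (C * remBound k M ((Real.sqrt τ)⁻¹ • x) ((Real.sqrt τ)⁻¹ • ξ)) *
          ‖f ξ‖ₑ := by
  obtain ⟨C, hC0, hC⟩ := hΓ.taylor hc k M
  refine ⟨C, hC0, fun τ f hτ hf h0 x => ?_⟩
  obtain ⟨p, hp, hpb⟩ := hC ((Real.sqrt τ)⁻¹ • x)
  obtain ⟨h1, h2⟩ := hf.integral_poly hp ((Real.sqrt τ)⁻¹)
  have h3 : conv Γ τ f x = ∫ ξ, τ ^ (-(N : ℝ) / 2) *
      ((Γ ((Real.sqrt τ)⁻¹ • x - (Real.sqrt τ)⁻¹ • ξ) - p ((Real.sqrt τ)⁻¹ • ξ)) * f ξ) := by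
    have h4 := (boundedC1_dil hc hΓ τ).integrable_mul hf.integrable x
    have h5 : ∀ ξ, τ ^ (-(N : ℝ) / 2) * ((Γ ((Real.sqrt τ)⁻¹ • x - (Real.sqrt τ)⁻¹ • ξ) -
        p ((Real.sqrt τ)⁻¹ • ξ)) * f ξ) = dil Γ τ (x - ξ) * f ξ -
          τ ^ (-(N : ℝ) / 2) * (p ((Real.sqrt τ)⁻¹ • ξ) * f ξ) := fun ξ => by
      rw [dil, smul_sub]; ring
    simp_rw [h5]
    rw [integral_sub h4 (h1.const_mul _), integral_const_mul, h2 h0, mul_zero, sub_zero, conv]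
  rw [h3]
  refine (enorm_integral_le_lintegral_enorm _).trans (lintegral_mono fun ξ => ?_)
  simp only [enorm_mul]
  rw [Real.enorm_of_nonneg (by positivity), ← mul_assoc]
  gcongr
  rw [Real.enorm_eq_ofReal_abs]
  exact ENNReal.ofReal_le_ofReal (hpb _)

lemma lintegral_weight_remBound_le {K : ℝ} (hK : 0 ≤ K) {k : ℕ} (hkK : (k : ℝ) ≤ K)
    (hK1 : K ≤ k + 1) {C : ℝ} (hC0 : 0 ≤ C) (η : E N) :
    ∫⁻ y : E N, ENNReal.ofReal ((1 + ‖y‖) ^ K) *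
      ENNReal.ofReal (C * remBound k (k + 1 + (N + 1)) y η) ≤
    (ENNReal.ofReal C * ((∫⁻ y : E N, ENNReal.ofReal (((1 + ‖y‖) ^ (N + 1))⁻¹)) +
      ENNReal.ofReal (2 ^ K) * ∫⁻ y : E N, ENNReal.ofReal (((1 + ‖y‖) ^ (N + 1))⁻¹))) *
        ENNReal.ofReal (lam K k ‖η‖) := by
  have hl := lam_nonneg K k (norm_nonneg η)
  calc _ ≤ ∫⁻ y : E N, ENNReal.ofReal C * (ENNReal.ofReal (lam K k ‖η‖) *
        (ENNReal.ofReal (((1 + ‖y‖) ^ (N + 1))⁻¹) + ENNReal.ofReal (2 ^ K) *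
          ENNReal.ofReal (((1 + ‖y - η‖) ^ (N + 1))⁻¹))) := by
        refine lintegral_mono fun y => ?_
        simp only
        rw [ENNReal.ofReal_mul hC0, mul_left_comm,
          ← ENNReal.ofReal_mul (p := (1 + ‖y‖) ^ K) (by positivity),
          ← ENNReal.ofReal_mul (p := 2 ^ K) (by positivity),
          ← ENNReal.ofReal_add (by positivity) (by positivity),
          ← ENNReal.ofReal_mul hl]
        exact mul_le_mul_right (ENNReal.ofReal_le_ofReal
          (weight_mul_remBound_le hK hkK hK1 y η)) _
    _ = _ := by
        rw [lintegral_const_mul' _ _ ENNReal.ofReal_ne_top,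
          lintegral_const_mul' _ _ ENNReal.ofReal_ne_top,
          lintegral_add_left (by fun_prop), lintegral_const_mul' _ _ ENNReal.ofReal_ne_top,
          lintegral_sub_right_eq_self
            (fun y : E N => ENNReal.ofReal (((1 + ‖y‖) ^ (N + 1))⁻¹)) η]
        ring

lemma conv_le_of_zeroMoments {c : ℝ} (hc : 0 < c) {Γ : E N → ℝ} (hΓ : PolyGauss c Γ)
    {K : ℝ} (hK : 0 ≤ K) {k : ℕ} (hkK : (k : ℝ) ≤ K) (hK1 : K ≤ k + 1) :
    ∃ C : ℝ≥0∞, C ≠ ⊤ ∧ ∀ (τ : ℝ) (f : E N → ℝ), 0 < τ → HasMoments k f → ZeroMoments k f →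
      (∫⁻ x, ENNReal.ofReal ((1 + ‖x‖ / Real.sqrt τ) ^ K) * ‖conv Γ τ f x‖ₑ ≤
        C * ∫⁻ ξ, ENNReal.ofReal (lam K k (‖ξ‖ / Real.sqrt τ)) * ‖f ξ‖ₑ) ∧
      ∀ x, ENNReal.ofReal (τ ^ ((N : ℝ) / 2)) * ‖conv Γ τ f x‖ₑ ≤
        C * ∫⁻ ξ, ENNReal.ofReal (lam K k (‖ξ‖ / Real.sqrt τ)) * ‖f ξ‖ₑ := by
  obtain ⟨C, hC0, hC⟩ := enorm_conv_le_of_zeroMoments hc hΓ k (k + 1 + (N + 1))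
  set I := ∫⁻ y : E N, ENNReal.ofReal (((1 + ‖y‖) ^ (N + 1))⁻¹) with hI
  have hIt : I ≠ ⊤ := lintegral_inv_pow_lt_top.ne
  have h2K : ENNReal.ofReal (2 ^ K) ≠ ⊤ := ENNReal.ofReal_ne_top
  have hCt : ENNReal.ofReal C ≠ ⊤ := ENNReal.ofReal_ne_top
  set D₁ := ENNReal.ofReal C * (I + ENNReal.ofReal (2 ^ K) * I) with hD₁
  set D₂ := ENNReal.ofReal C * ENNReal.ofReal 2 with hD₂
  have hD₁t : D₁ ≠ ⊤ := ENNReal.mul_ne_top hCt (ENNReal.add_ne_top.2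
    ⟨hIt, ENNReal.mul_ne_top h2K hIt⟩)
  have hD₂t : D₂ ≠ ⊤ := ENNReal.mul_ne_top hCt ENNReal.ofReal_ne_top
  refine ⟨D₁ + D₂, ENNReal.add_ne_top.2 ⟨hD₁t, hD₂t⟩, fun τ f hτ hf h0 => ⟨?_, fun x => ?_⟩⟩
  · have hm : Measurable fun p : E N × E N => ENNReal.ofReal
        (C * remBound k (k + 1 + (N + 1)) p.1 p.2) :=
      Measurable.ennreal_ofReal (Measurable.const_mul (measurable_remBound k (k + 1 + (N + 1))) _)
    have hsm : Measurable fun x : E N => (Real.sqrt τ)⁻¹ • x := measurable_const_smul _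
    have hκ : Measurable (Function.uncurry fun x ξ : E N =>
        ENNReal.ofReal (τ ^ (-(N : ℝ) / 2)) * ENNReal.ofReal
          (C * remBound k (k + 1 + (N + 1)) ((Real.sqrt τ)⁻¹ • x) ((Real.sqrt τ)⁻¹ • ξ))) :=
      Measurable.const_mul (hm.comp ((hsm.comp measurable_fst).prodMk (hsm.comp measurable_snd))) _
    have ha : Measurable fun x : E N => ENNReal.ofReal ((1 + ‖x‖ / Real.sqrt τ) ^ K) :=
      (Measurable.pow_const (by fun_prop) _).ennreal_ofReal
    have hb : ∀ ξ : E N, ∫⁻ x : E N, ENNReal.ofReal ((1 + ‖x‖ / Real.sqrt τ) ^ K) *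
        (ENNReal.ofReal (τ ^ (-(N : ℝ) / 2)) * ENNReal.ofReal
          (C * remBound k (k + 1 + (N + 1)) ((Real.sqrt τ)⁻¹ • x) ((Real.sqrt τ)⁻¹ • ξ))) ≤
        D₁ * ENNReal.ofReal (lam K k (‖ξ‖ / Real.sqrt τ)) := fun ξ => by
      rw [← norm_inv_sqrt_smul]
      refine (lintegral_weight_scale K hτ (hm.comp (measurable_prodMk_right
        (y := (Real.sqrt τ)⁻¹ • ξ)))).le.trans ?_
      exact lintegral_weight_remBound_le hK hkK hK1 hC0 _
    refine (lintegral_mul_le_of_kernel hκ ha hD₁t hb hf.integrable.aestronglyMeasurable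
      (hC τ f hτ hf h0)).trans ?_
    gcongr
    exact le_self_add
  · calc _ ≤ ENNReal.ofReal (τ ^ ((N : ℝ) / 2)) * ∫⁻ ξ, ENNReal.ofReal (τ ^ (-(N : ℝ) / 2)) *
          (D₂ * (ENNReal.ofReal (lam K k (‖ξ‖ / Real.sqrt τ)) * ‖f ξ‖ₑ)) := by
          gcongr
          refine (hC τ f hτ hf h0 x).trans (lintegral_mono fun ξ => ?_)
          simp only
          rw [← mul_assoc D₂, mul_assoc (ENNReal.ofReal _)]
          gcongr
          rw [hD₂, ENNReal.ofReal_mul hC0, mul_assoc]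
          gcongr
          rw [← ENNReal.ofReal_mul (by positivity), ← norm_inv_sqrt_smul]
          exact ENNReal.ofReal_le_ofReal (remBound_le hK hkK _ _ _)
      _ = (ENNReal.ofReal (τ ^ (-(N : ℝ) / 2)) * ENNReal.ofReal (τ ^ ((N : ℝ) / 2))) *
          (D₂ * ∫⁻ ξ, ENNReal.ofReal (lam K k (‖ξ‖ / Real.sqrt τ)) * ‖f ξ‖ₑ) := by
          rw [lintegral_const_mul' _ _ ENNReal.ofReal_ne_top, lintegral_const_mul' _ _ hD₂t]
          ring
      _ ≤ _ := by
          rw [rpow_mul_rpow_neg_half hτ, one_mul]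
          gcongr
          exact le_add_self

/-- The constant `3^{K/2}` comes from `1 + s + τ ≤ 3 τ`. -/
lemma lam_le_omega {K : ℝ} (hK : 0 ≤ K) {k : ℕ} (hK1 : K ≤ k + 1) {s τ : ℝ} (hs : 0 ≤ s)
    (hsτ : s ≤ τ) (hτ : 1 ≤ τ) (ξ : E N) :
    lam K k (‖ξ‖ / Real.sqrt τ) ≤
      3 ^ (K / 2) * ((1 + s) / (1 + (s + τ))) ^ (K / 2) * omega K s ξ := by
  refine (lam_le hK1 (by positivity)).trans ?_
  have h1 : ‖ξ‖ / Real.sqrt τ = Real.sqrt ((1 + s) / τ) * (‖ξ‖ / Real.sqrt (1 + s)) := by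
    rw [Real.sqrt_div (by positivity)]
    field_simp
  have h0 : (0 : ℝ) < τ := by linarith
  rw [h1, Real.mul_rpow (by positivity) (by positivity), Real.sqrt_eq_rpow, ← Real.rpow_mul
    (by positivity), ← Real.mul_rpow (by positivity) (by positivity)]
  have h2 : (1 + s) / τ ≤ 3 * ((1 + s) / (1 + (s + τ))) := by
    rw [← mul_div_assoc, div_le_div_iff₀ (by positivity) (by positivity)]
    nlinarith
  unfold omega
  gcongr
  · rw [one_div, inv_mul_eq_div]
    gcongr
  · linarith

lemma omega_le_of_le {K : ℝ} (hK : 0 ≤ K) {s τ : ℝ} (hs : 0 ≤ s) (hτ : 0 < τ) (x : E N) :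
    omega K (s + τ) x ≤ (1 + ‖x‖ / Real.sqrt τ) ^ K := by
  unfold omega
  gcongr
  linarith

/-- The decay factor gained from vanishing moments. -/
def ratio (K s t : ℝ) : ℝ := ((1 + s) / (1 + t)) ^ (K / 2)

/-- The Taylor argument serves when `s ≤ τ` and `1 ≤ τ`. Otherwise `1 + s + τ ≤ 3 (1 + s)`, so the
claimed gain is bounded below and the estimate without moments suffices. -/
lemma conv_ostar_le_of_zeroMoments {c : ℝ} (hc : 0 < c) {Γ : E N → ℝ} (hΓ : PolyGauss c Γ)
    {K : ℝ} (hK : 0 ≤ K) {k : ℕ} (hkK : (k : ℝ) ≤ K) (hK1 : K ≤ k + 1) :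
    ∃ C : ℝ≥0∞, C ≠ ⊤ ∧ ∀ (s τ : ℝ) (f : E N → ℝ), 0 ≤ s → 0 < τ → HasMoments k f →
      ZeroMoments k f →
      ostar K (s + τ) (conv Γ τ f) ≤ C * ENNReal.ofReal (ratio K s (s + τ)) * star K s f := by
  obtain ⟨C₁, hC₁, h₁⟩ := conv_ostar_le hΓ.continuous (hΓ.rapid hc) hK
  obtain ⟨C₂, hC₂, h₂⟩ := conv_le_of_zeroMoments hc hΓ hK hkK hK1
  set D := ENNReal.ofReal (2 ^ ((N : ℝ) / 2))
  set Q := ENNReal.ofReal (3 ^ (K / 2)) with hQ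
  have hDt : D ≠ ⊤ := ENNReal.ofReal_ne_top
  have hQt : Q ≠ ⊤ := ENNReal.ofReal_ne_top
  refine ⟨C₁ * Q + (1 + D) * C₂ * Q, ENNReal.add_ne_top.2 ⟨ENNReal.mul_ne_top hC₁ hQt,
    ENNReal.mul_ne_top (ENNReal.mul_ne_top (ENNReal.add_ne_top.2 ⟨by simp, hDt⟩) hC₂) hQt⟩,
    fun s τ f hs hτ hf h0 => ?_⟩
  rw [add_mul, add_mul]
  by_cases hst : s ≤ τ ∧ 1 ≤ τ
  · refine le_add_left ?_
    obtain ⟨e1, e2⟩ := h₂ τ f hτ hf h0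
    set R := ENNReal.ofReal (ratio K s (s + τ)) with hR
    have h3 : ∫⁻ ξ, ENNReal.ofReal (lam K k (‖ξ‖ / Real.sqrt τ)) * ‖f ξ‖ₑ ≤ Q * R * wnorm K s f := by
      unfold wnorm
      rw [← lintegral_const_mul' _ _ (ENNReal.mul_ne_top hQt ENNReal.ofReal_ne_top)]
      refine lintegral_mono fun ξ => ?_
      simp only
      rw [← mul_assoc, hQ, ← ENNReal.ofReal_mul (by positivity), ← ENNReal.ofReal_mul
        (by unfold ratio; positivity)]
      gcongr
      exact lam_le_omega hK hK1 hs hst.1 hst.2 ξ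
    have h4 : wnorm K (s + τ) (conv Γ τ f) ≤ C₂ * (Q * R * wnorm K s f) := by
      refine le_trans (lintegral_mono fun x => ?_) (e1.trans (mul_le_mul_right h3 C₂))
      gcongr
      exact omega_le_of_le hK hs hτ x
    have h5 : ENNReal.ofReal ((s + τ) ^ ((N : ℝ) / 2)) * (⨆ x, ‖conv Γ τ f x‖ₑ) ≤
        D * (C₂ * (Q * R * wnorm K s f)) := by
      rw [ENNReal.mul_iSup]
      refine iSup_le fun x => ?_
      calc _ ≤ (D * ENNReal.ofReal (τ ^ ((N : ℝ) / 2))) * ‖conv Γ τ f x‖ₑ := by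
            gcongr
            exact rpow_half_le_of_le (by linarith) (by linarith) hτ.le
        _ = D * (ENNReal.ofReal (τ ^ ((N : ℝ) / 2)) * ‖conv Γ τ f x‖ₑ) := by ring
        _ ≤ _ := mul_le_mul_right ((e2 x).trans (mul_le_mul_right h3 C₂)) D
    calc _ ≤ C₂ * (Q * R * wnorm K s f) + D * (C₂ * (Q * R * wnorm K s f)) := add_le_add h4 h5
      _ = (1 + D) * C₂ * Q * R * wnorm K s f := by ring
      _ ≤ _ := by gcongr; exact wnorm_le_star K s f
  · refine le_add_right ((h₁ s τ f hs hτ hf.integrable.aestronglyMeasurable).trans ?_)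
    have h6 : (1 : ℝ≥0∞) ≤ Q * ENNReal.ofReal (ratio K s (s + τ)) := by
      rw [hQ, ← ENNReal.ofReal_mul (by positivity), ratio, ← Real.mul_rpow (by positivity)
        (by positivity), ENNReal.one_le_ofReal]
      refine Real.one_le_rpow ?_ (by positivity)
      rw [← mul_div_assoc, one_le_div (by positivity)]
      by_contra hcon
      push Not at hcon
      exact hst ⟨by linarith, by linarith⟩
    calc C₁ * star K s f = C₁ * 1 * star K s f := by rw [mul_one]
      _ ≤ C₁ * (Q * ENNReal.ofReal (ratio K s (s + τ))) * star K s f := by gcongr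
      _ = _ := by ring

/-! ### Calculus of the weighted norms -/

section
variable {V : Type*} [NormedAddCommGroup V]

lemma star_congr {K s : ℝ} {f g : E N → V} (h : f =ᵐ[volume] g) : star K s f = star K s g := by
  unfold star wnorm
  rw [eLpNorm_congr_ae h]
  congr 1
  exact lintegral_congr_ae (h.mono fun x hx => by simp only [hx])

lemma star_mono_enorm {W : Type*} [NormedAddCommGroup W] {K s : ℝ} {f : E N → V} {g : E N → W}
    (h : ∀ᵐ x, ‖f x‖ₑ ≤ ‖g x‖ₑ) : star K s f ≤ star K s g := by
  unfold star wnorm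
  gcongr ?_ + _ * ?_
  · exact lintegral_mono_ae (h.mono fun x hx => by gcongr)
  · exact eLpNorm_mono_enorm_ae h

lemma star_add_le {K s : ℝ} {f g : E N → V} (hf : AEStronglyMeasurable f)
    (hg : AEStronglyMeasurable g) :
    star K s (fun x => f x + g x) ≤ star K s f + star K s g := by
  unfold star wnorm
  have h1 : ∫⁻ x, ENNReal.ofReal (omega K s x) * ‖f x + g x‖ₑ ≤
      (∫⁻ x, ENNReal.ofReal (omega K s x) * ‖f x‖ₑ) +
        ∫⁻ x, ENNReal.ofReal (omega K s x) * ‖g x‖ₑ := by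
    have hm : AEMeasurable fun x => ENNReal.ofReal (omega K s x) * ‖f x‖ₑ :=
      (measurable_omega K s).ennreal_ofReal.aemeasurable.mul hf.enorm
    rw [← lintegral_add_left' hm]
    refine lintegral_mono fun x => ?_
    simp only [← mul_add]
    gcongr
    exact enorm_add_le _ _
  have h2 : eLpNorm (fun x => f x + g x) ∞ volume ≤ eLpNorm f ∞ volume + eLpNorm g ∞ volume :=
    eLpNorm_add_le hf hg le_top
  calc _ ≤ _ + ENNReal.ofReal (s ^ ((N : ℝ) / 2)) * _ := add_le_add h1 (mul_le_mul_right h2 _)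
    _ = _ := by ring

lemma star_neg {K s : ℝ} {f : E N → V} : star K s (fun x => -f x) = star K s f := by
  unfold star wnorm
  have := eLpNorm_neg (f := f) (p := ∞) (μ := volume)
  simp only [enorm_neg]
  congr 2

lemma star_sub_le {K s : ℝ} {f g : E N → V} (hf : AEStronglyMeasurable f)
    (hg : AEStronglyMeasurable g) :
    star K s (fun x => f x - g x) ≤ star K s f + star K s g := by
  simp only [sub_eq_add_neg]
  rw [← star_neg (f := g)]
  exact star_add_le hf hg.neg

lemma star_const_mul {K s : ℝ} (a : ℝ) (f : E N → ℝ) :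
    star K s (fun x => a * f x) = ‖a‖ₑ * star K s f := by
  unfold star wnorm
  have h := eLpNorm_const_smul a f ∞ (volume : Measure (E N))
  have h' : eLpNorm (fun x => a * f x) ∞ volume = ‖a‖ₑ * eLpNorm f ∞ volume := h
  rw [h', mul_add]
  simp only [enorm_mul, mul_left_comm]
  rw [lintegral_const_mul' _ _ enorm_ne_top]

lemma star_sum_le {ι : Type*} {K s : ℝ} (t : Finset ι) {f : ι → E N → V}
    (hf : ∀ i ∈ t, AEStronglyMeasurable (f i)) :
    star K s (fun x => ∑ i ∈ t, f i x) ≤ ∑ i ∈ t, star K s (f i) := by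
  classical
  induction t using Finset.induction_on with
  | empty =>
    have h := eLpNorm_zero' (α := E N) (p := ∞) (μ := volume) (ε := V)
    simp [star, wnorm, h]
  | insert i t hi ih =>
    simp only [Finset.sum_insert hi]
    have hft : ∀ j ∈ t, AEStronglyMeasurable (f j) := fun j hj => hf j (Finset.mem_insert_of_mem hj)
    refine (star_add_le (hf i (Finset.mem_insert_self i t))
      (Finset.aestronglyMeasurable_fun_sum t hft)).trans ?_
    gcongr
    exact ih hft

end

lemma star_le_sum_coord {K s : ℝ} {v : E N → E N} (hv : AEStronglyMeasurable v) :
    star K s v ≤ ∑ i, star K s fun x => v x i := by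
  have hi : ∀ i : Fin N, AEStronglyMeasurable fun x => v x i := fun i =>
    (EuclideanSpace.proj (𝕜 := ℝ) i).continuous.comp_aestronglyMeasurable hv
  calc star K s v ≤ star K s fun x => ∑ i, |v x i| := by
        refine star_mono_enorm (ae_of_all _ fun x => ?_)
        rw [← ofReal_norm, Real.enorm_of_nonneg (by positivity)]
        exact ENNReal.ofReal_le_ofReal (norm_le_sum_coord _)
    _ ≤ ∑ i, star K s fun x => |v x i| := star_sum_le _ fun i _ => (hi i).norm
    _ ≤ _ := Finset.sum_le_sum fun i _ => star_mono_enorm (ae_of_all _ fun x => by simp)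

lemma abs_monomial_le_omega {K : ℝ} {s : ℝ} (hs : 0 ≤ s) {α : Fin N → ℕ} (hα : (deg α : ℝ) ≤ K)
    (x : E N) : |monomial α x| ≤ Real.sqrt (1 + s) ^ deg α * omega K s x := by
  refine (abs_monomial_le α x).trans ?_
  have h0 : 0 < Real.sqrt (1 + s) := by positivity
  have h1 : ‖x‖ = Real.sqrt (1 + s) * (‖x‖ / Real.sqrt (1 + s)) := by field_simp
  have h2 : 0 ≤ ‖x‖ / Real.sqrt (1 + s) := by positivity
  conv_lhs => rw [h1]
  rw [mul_pow]
  gcongr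
  unfold omega
  calc _ ≤ (1 + ‖x‖ / Real.sqrt (1 + s)) ^ deg α := by gcongr; linarith
    _ ≤ _ := by
      rw [← Real.rpow_natCast]
      exact Real.rpow_le_rpow_of_exponent_le (by linarith) hα

lemma lintegral_monomial_le {K : ℝ} {s : ℝ} (hs : 0 ≤ s) {α : Fin N → ℕ} (hα : (deg α : ℝ) ≤ K)
    (f : E N → ℝ) : ∫⁻ x, ‖monomial α x * f x‖ₑ ≤
      ENNReal.ofReal (Real.sqrt (1 + s) ^ deg α) * wnorm K s f := by
  unfold wnorm
  rw [← lintegral_const_mul' _ _ ENNReal.ofReal_ne_top]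
  refine lintegral_mono fun x => ?_
  simp only
  rw [enorm_mul, ← mul_assoc, ← ENNReal.ofReal_mul (by positivity), Real.enorm_eq_ofReal_abs]
  gcongr
  exact abs_monomial_le_omega hs hα x

lemma hasMoments_of_wnorm {K : ℝ} {k : ℕ} (hkK : (k : ℝ) ≤ K) {s : ℝ} (hs : 0 ≤ s) {f : E N → ℝ}
    (hf : AEStronglyMeasurable f) (h : wnorm K s f ≠ ⊤) : HasMoments k f := by
  intro α hα
  refine ⟨(continuous_monomial α).aestronglyMeasurable.mul hf, ?_⟩
  exact lt_of_le_of_lt (lintegral_monomial_le hs (le_trans (by exact_mod_cast hα) hkK) f)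
    (ENNReal.mul_lt_top ENNReal.ofReal_lt_top h.lt_top)

/-! ### Properties of the coefficients and the projections -/

/-- The integrand is odd. -/
lemma integral_monomial_mul_gKernel_zero {α : Fin N → ℕ} (hα : deg α = 1) {t : ℝ} (ht : 0 ≤ t) :
    ∫ x, monomial α x * gKernel 0 t x = 0 := by
  rw [integral_monomial_mul_gKernel 0 α ht]
  have h1 : ∫ x : E N, monomial (fun i => α i - (0 : Fin N → ℕ) i) x * gaussKernel x (1 + t) =
      -∫ x : E N, monomial (fun i => α i - (0 : Fin N → ℕ) i) x * gaussKernel x (1 + t) := by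
    rw [← integral_neg, ← integral_neg_eq_self]
    congr 1
    ext x
    have := monomial_smul α (-1) x
    rw [hα, neg_one_smul] at this
    simp [this, gaussKernel]
  have : ∫ x : E N, monomial (fun i => α i - (0 : Fin N → ℕ) i) x * gaussKernel x (1 + t) = 0 := by
    linarith
  rw [this, mul_zero]

/-- The recursion is also valid for `|α| ≤ 1`: the only possible lower index is then `0`, and the
first moments of `g_0` vanish. This removes the case distinction from everything that follows. -/
lemma moment_eq (f : E N → ℝ) {t : ℝ} (ht : 0 ≤ t) (α : Fin N → ℕ) :
    moment f t α = (∫ x, monomial α x * f x) -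
      ∑ ρ ∈ lowerIndices α, moment f t ρ * ∫ x, monomial α x * gKernel ρ t x := by
  rw [moment]
  split_ifs with h
  · rw [Finset.sum_eq_zero, sub_zero]
    intro ρ hρ
    have h1 := deg_lt_of_mem_lowerIndices hρ
    have h2 : deg ρ = 0 := by omega
    have h3 : ρ = 0 := by
      ext i
      have := Finset.single_le_sum (f := ρ) (fun j _ => Nat.zero_le (ρ j)) (Finset.mem_univ i)
      rw [deg] at h2
      simp only [Pi.zero_apply]
      omega
    rw [h3, integral_monomial_mul_gKernel_zero (by omega) ht, mul_zero]
  · rw [Finset.sum_attach (lowerIndices α)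
      (fun ρ => moment f t ρ * ∫ x, monomial α x * gKernel ρ t x)]

/-- Triangularity: indices not below `α` contribute nothing, and the diagonal entry is one. -/
lemma sum_multiIndices_mul_integral {k : ℕ} {α : Fin N → ℕ} (hα : deg α ≤ k) {t : ℝ} (ht : 0 ≤ t)
    (c : (Fin N → ℕ) → ℝ) :
    ∑ β ∈ multiIndices N k, c β * ∫ x, monomial α x * gKernel β t x =
      c α + ∑ ρ ∈ lowerIndices α, c ρ * ∫ x, monomial α x * gKernel ρ t x := by
  have hnot : α ∉ lowerIndices α := fun h => (mem_lowerIndices.1 h).1 rfl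
  have h1 : c α + ∑ ρ ∈ lowerIndices α, c ρ * ∫ x, monomial α x * gKernel ρ t x =
      ∑ ρ ∈ insert α (lowerIndices α), c ρ * ∫ x, monomial α x * gKernel ρ t x := by
    rw [Finset.sum_insert hnot, integral_monomial_mul_gKernel_self α ht, mul_one]
  rw [h1]
  symm
  refine Finset.sum_subset ?_ ?_
  · intro β hβ
    rw [mem_multiIndices]
    rcases Finset.mem_insert.1 hβ with h | h
    · rw [h]; exact hα
    · exact (deg_lt_of_mem_lowerIndices h).le.trans hα
  · intro β _ hβ
    have : ∃ i, α i < β i := by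
      by_contra hcon
      push Not at hcon
      by_cases h : β = α
      · exact hβ (by rw [h]; exact Finset.mem_insert_self _ _)
      · exact hβ (Finset.mem_insert_of_mem (mem_lowerIndices.2 ⟨h, hcon⟩))
    obtain ⟨i, hi⟩ := this
    rw [integral_monomial_mul_gKernel_of_lt ht hi, mul_zero]

lemma integrable_monomial_mul_gKernel (α β : Fin N → ℕ) {t : ℝ} (ht : 0 ≤ t) :
    Integrable fun x => monomial α x * gKernel β t x :=
  (rapid_gKernel β ht).integrable_monomial (continuous_gKernel β t) α

lemma hasMoments_sum_gKernel (j k : ℕ) {t : ℝ} (ht : 0 ≤ t) (c : (Fin N → ℕ) → ℝ) :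
    HasMoments j fun x => ∑ β ∈ multiIndices N k, c β * gKernel β t x := by
  intro α _
  simp only [Finset.mul_sum, mul_left_comm]
  exact integrable_finsetSum _ fun β _ => (integrable_monomial_mul_gKernel α β ht).const_mul _

lemma integral_monomial_mul_sum_gKernel (k : ℕ) (α : Fin N → ℕ) {t : ℝ} (ht : 0 ≤ t)
    (c : (Fin N → ℕ) → ℝ) :
    ∫ x, monomial α x * ∑ β ∈ multiIndices N k, c β * gKernel β t x =
      ∑ β ∈ multiIndices N k, c β * ∫ x, monomial α x * gKernel β t x := by
  simp only [Finset.mul_sum, mul_left_comm]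
  rw [integral_finsetSum _ fun β _ => (integrable_monomial_mul_gKernel α β ht).const_mul _]
  simp only [integral_const_mul]

lemma zeroMoments_proj {k : ℕ} {f : E N → ℝ} (hf : HasMoments k f) {t : ℝ} (ht : 0 ≤ t) :
    ZeroMoments k (proj k t f) := by
  intro α hα
  have h1 := hasMoments_sum_gKernel k k ht (moment f t) α hα
  simp only [proj, momentExpansion, mul_sub]
  rw [integral_sub (hf α hα) h1, integral_monomial_mul_sum_gKernel k α ht,
    sum_multiIndices_mul_integral hα ht, moment_eq f ht α]
  ring

lemma HasMoments.add {k : ℕ} {f g : E N → ℝ} (hf : HasMoments k f) (hg : HasMoments k g) :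
    HasMoments k fun x => f x + g x := fun α hα => by
  simp only [mul_add]
  exact (hf α hα).add (hg α hα)

lemma HasMoments.sub {k : ℕ} {f g : E N → ℝ} (hf : HasMoments k f) (hg : HasMoments k g) :
    HasMoments k fun x => f x - g x := fun α hα => by
  simp only [mul_sub]
  exact (hf α hα).sub (hg α hα)

lemma ZeroMoments.add {k : ℕ} {f g : E N → ℝ} (hf : HasMoments k f) (hg : HasMoments k g)
    (hf0 : ZeroMoments k f) (hg0 : ZeroMoments k g) : ZeroMoments k fun x => f x + g x :=
  fun α hα => by
    simp only [mul_add]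
    rw [integral_add (hf α hα) (hg α hα), hf0 α hα, hg0 α hα, add_zero]

lemma ZeroMoments.sub {k : ℕ} {f g : E N → ℝ} (hf : HasMoments k f) (hg : HasMoments k g)
    (hf0 : ZeroMoments k f) (hg0 : ZeroMoments k g) : ZeroMoments k fun x => f x - g x :=
  fun α hα => by
    simp only [mul_sub]
    rw [integral_sub (hf α hα) (hg α hα), hf0 α hα, hg0 α hα, sub_zero]

lemma hasMoments_proj {k : ℕ} {f : E N → ℝ} (hf : HasMoments k f) {t : ℝ} (ht : 0 ≤ t) :
    HasMoments k (proj k t f) := hf.sub (hasMoments_sum_gKernel k k ht (moment f t))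

/-- Uniqueness of the splitting: testing with `x^α` gives a unit triangular system, solved by
induction on `|α|`. Equality almost everywhere is enough, and for `u(t)` no more is known. -/
lemma moment_eq_of_decomposition {k : ℕ} {W : E N → ℝ} (hW : HasMoments k W)
    (hW0 : ZeroMoments k W) {t : ℝ} (ht : 0 ≤ t) (c : (Fin N → ℕ) → ℝ) {f : E N → ℝ}
    (hf : f =ᵐ[volume] fun x => W x + ∑ β ∈ multiIndices N k, c β * gKernel β t x)
    {α : Fin N → ℕ} (hα : deg α ≤ k) : moment f t α = c α := by
  induction hd : deg α using Nat.strong_induction_on generalizing α with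
  | _ d ih =>
    rw [moment_eq f ht α]
    have h1 : ∫ x, monomial α x * f x =
        ∑ β ∈ multiIndices N k, c β * ∫ x, monomial α x * gKernel β t x := by
      rw [integral_congr_ae (g := fun x => monomial α x * W x +
        monomial α x * ∑ β ∈ multiIndices N k, c β * gKernel β t x)
        (hf.mono fun x hx => by simp only [hx, mul_add]),
        integral_add (hW α hα) (hasMoments_sum_gKernel k k ht c α hα), hW0 α hα, zero_add,
        integral_monomial_mul_sum_gKernel k α ht]
    have h2 : ∑ ρ ∈ lowerIndices α, moment f t ρ * ∫ x, monomial α x * gKernel ρ t x =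
        ∑ ρ ∈ lowerIndices α, c ρ * ∫ x, monomial α x * gKernel ρ t x :=
      Finset.sum_congr rfl fun ρ hρ => by
        rw [ih (deg ρ) (hd ▸ deg_lt_of_mem_lowerIndices hρ)
          ((deg_lt_of_mem_lowerIndices hρ).le.trans hα) rfl]
    rw [h1, sum_multiIndices_mul_integral hα ht, h2]
    ring

/-- Linearity follows from uniqueness: the difference of two splittings is a splitting of the
difference. -/
lemma proj_sub {k : ℕ} {f g : E N → ℝ} (hf : HasMoments k f) (hg : HasMoments k g) {t : ℝ}
    (ht : 0 ≤ t) : proj k t (fun x => f x - g x) = fun x => proj k t f x - proj k t g x := by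
  have h : ∀ α, deg α ≤ k → moment (fun x => f x - g x) t α = moment f t α - moment g t α := by
    intro α hα
    refine moment_eq_of_decomposition ((hasMoments_proj hf ht).sub (hasMoments_proj hg ht))
      (ZeroMoments.sub (hasMoments_proj hf ht) (hasMoments_proj hg ht)
        (zeroMoments_proj hf ht) (zeroMoments_proj hg ht)) ht
      (fun α => moment f t α - moment g t α) (ae_of_all _ fun x => ?_) hα
    simp only [proj, momentExpansion, sub_mul, Finset.sum_sub_distrib]
    ring
  ext x
  simp only [proj, momentExpansion]
  rw [Finset.sum_congr rfl fun α hα => by rw [h α (mem_multiIndices.1 hα)]]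
  simp only [sub_mul, Finset.sum_sub_distrib]
  ring

/-! ### Bounds of the coefficients and the projections -/

lemma gKernel_eq_dil (α : Fin N → ℕ) {t : ℝ} (ht : 0 ≤ t) :
    gKernel α t = fun x => (Real.sqrt (1 + t))⁻¹ ^ deg α * dil (gKernel α 0) (1 + t) x := by
  ext x
  rw [gKernel_scale α ht, dil]
  ring

/-- By self-similarity, rescaling turns the weight at time `s` into the fixed weight `(1 + ‖y‖)^K`.
-/
lemma star_gKernel_le (K : ℝ) (α : Fin N → ℕ) : ∃ C : ℝ≥0∞, C ≠ ⊤ ∧ ∀ s, 0 ≤ s →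
    star K s (gKernel α s) ≤ C * ENNReal.ofReal ((Real.sqrt (1 + s))⁻¹ ^ deg α) := by
  have hr := rapid_gKernel α le_rfl
  obtain ⟨B, hB⟩ := hr.bdd
  refine ⟨(∫⁻ y, ENNReal.ofReal ((1 + ‖y‖) ^ K) * ‖gKernel α 0 y‖ₑ) + ENNReal.ofReal B,
    ENNReal.add_ne_top.2 ⟨hr.lintegral_weight_lt_top.ne, ENNReal.ofReal_ne_top⟩, fun s hs => ?_⟩
  rw [gKernel_eq_dil α hs, star_const_mul, Real.enorm_of_nonneg (by positivity), mul_comm]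
  gcongr
  have h0 : (0 : ℝ) < 1 + s := by positivity
  unfold star wnorm omega
  rw [lintegral_weight_dil (continuous_gKernel α 0) K h0]
  gcongr
  calc _ ≤ ENNReal.ofReal ((1 + s) ^ ((N : ℝ) / 2)) *
        (ENNReal.ofReal ((1 + s) ^ (-(N : ℝ) / 2)) * ENNReal.ofReal B) := by
        gcongr
        · linarith
        · rw [eLpNorm_exponent_top]
          refine eLpNormEssSup_le_of_ae_enorm_bound (ae_of_all _ fun x => ?_)
          rw [dil, enorm_mul, Real.enorm_of_nonneg (by positivity), Real.enorm_eq_ofReal_abs]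
          gcongr
          exact hB _
    _ = _ := by
      rw [← mul_assoc, mul_comm (ENNReal.ofReal ((1 + s) ^ ((N : ℝ) / 2))),
        rpow_mul_rpow_neg_half h0, one_mul]

/-- Induction along the recursion; the factor `(1 + s)^{|ρ|/2}` of `M_ρ` cancels against the factor
`(1 + s)^{-|ρ|/2}` of `g_ρ`. -/
lemma moment_bound {K : ℝ} {k : ℕ} (hkK : (k : ℝ) ≤ K) (α : Fin N → ℕ)
    (hα : deg α ≤ k) : ∃ C : ℝ≥0∞, C ≠ ⊤ ∧ ∀ (s : ℝ) (f : E N → ℝ), 0 ≤ s →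
      ‖moment f s α‖ₑ ≤ C * ENNReal.ofReal (Real.sqrt (1 + s) ^ deg α) * wnorm K s f := by
  induction hd : deg α using Nat.strong_induction_on generalizing α with
  | _ d ih =>
    subst hd
    have ih' : ∀ ρ : lowerIndices α, ∃ C : ℝ≥0∞, C ≠ ⊤ ∧ ∀ (s : ℝ) (f : E N → ℝ), 0 ≤ s →
        ‖moment f s ρ.1‖ₑ ≤ C * ENNReal.ofReal (Real.sqrt (1 + s) ^ deg ρ.1) * wnorm K s f :=
      fun ρ => ih (deg ρ.1) (deg_lt_of_mem_lowerIndices ρ.2) ρ.1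
        ((deg_lt_of_mem_lowerIndices ρ.2).le.trans hα) rfl
    choose C hC hCb using ih'
    choose D hD hDb using fun ρ : Fin N → ℕ => star_gKernel_le K ρ
    have hαK : (deg α : ℝ) ≤ K := le_trans (by exact_mod_cast hα) hkK
    refine ⟨1 + ∑ ρ, C ρ * D ρ.1, ENNReal.add_ne_top.2 ⟨by simp, ENNReal.sum_ne_top.2 fun ρ _ =>
      ENNReal.mul_ne_top (hC ρ) (hD ρ.1)⟩, fun s f hs => ?_⟩
    rw [moment_eq f hs α, ← Finset.sum_attach]
    have h1 : ‖∫ x, monomial α x * f x‖ₑ ≤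
        ENNReal.ofReal (Real.sqrt (1 + s) ^ deg α) * wnorm K s f :=
      (enorm_integral_le_lintegral_enorm _).trans (lintegral_monomial_le hs hαK f)
    have h2 : ∀ ρ : lowerIndices α, ‖moment f s ρ.1 * ∫ x, monomial α x * gKernel ρ.1 s x‖ₑ ≤
        C ρ * D ρ.1 * (ENNReal.ofReal (Real.sqrt (1 + s) ^ deg α) * wnorm K s f) := by
      intro ρ
      have h3 : ‖∫ x, monomial α x * gKernel ρ.1 s x‖ₑ ≤
          ENNReal.ofReal (Real.sqrt (1 + s) ^ deg α) *
            (D ρ.1 * ENNReal.ofReal ((Real.sqrt (1 + s))⁻¹ ^ deg ρ.1)) :=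
        ((enorm_integral_le_lintegral_enorm _).trans (lintegral_monomial_le hs hαK _)).trans
          (mul_le_mul_right ((wnorm_le_star _ _ _).trans (hDb ρ.1 s hs)) _)
      have h4 : ENNReal.ofReal (Real.sqrt (1 + s) ^ deg ρ.1) *
          ENNReal.ofReal ((Real.sqrt (1 + s))⁻¹ ^ deg ρ.1) = 1 := by
        rw [← ENNReal.ofReal_mul (by positivity), ← mul_pow, mul_inv_cancel₀ (by positivity),
          one_pow, ENNReal.ofReal_one]
      rw [enorm_mul]
      calc _ ≤ _ := mul_le_mul' (hCb ρ s f hs) h3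
        _ = C ρ * D ρ.1 * (ENNReal.ofReal (Real.sqrt (1 + s) ^ deg α) * wnorm K s f) *
            (ENNReal.ofReal (Real.sqrt (1 + s) ^ deg ρ.1) *
              ENNReal.ofReal ((Real.sqrt (1 + s))⁻¹ ^ deg ρ.1)) := by ring
        _ = _ := by rw [h4, mul_one]
    calc _ ≤ ‖∫ x, monomial α x * f x‖ₑ + _ := enorm_sub_le
      _ ≤ _ + ∑ ρ, C ρ * D ρ.1 * (ENNReal.ofReal (Real.sqrt (1 + s) ^ deg α) * wnorm K s f) := by
          gcongr
          exact (enorm_sum_le _ _).trans (Finset.sum_le_sum fun ρ _ => h2 ρ)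
      _ = ENNReal.ofReal (Real.sqrt (1 + s) ^ deg α) * wnorm K s f + _ := rfl
      _ = _ := by rw [← Finset.sum_mul]; ring

/-- The powers of `1 + s` in `M_α` and `g_α` cancel, so `P_k(s)` is bounded uniformly in `s` for the
norm at time `s`. -/
lemma star_proj_le {K : ℝ} {k : ℕ} (hkK : (k : ℝ) ≤ K) : ∃ C : ℝ≥0∞, C ≠ ⊤ ∧
    ∀ (s : ℝ) (f : E N → ℝ), 0 ≤ s → AEStronglyMeasurable f →
      star K s (proj k s f) ≤ C * star K s f := by
  have hM : ∀ α : multiIndices N k, ∃ C : ℝ≥0∞, C ≠ ⊤ ∧ ∀ (s : ℝ) (f : E N → ℝ), 0 ≤ s →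
      ‖moment f s α.1‖ₑ ≤ C * ENNReal.ofReal (Real.sqrt (1 + s) ^ deg α.1) * wnorm K s f :=
    fun α => moment_bound hkK α.1 (mem_multiIndices.1 α.2)
  choose C hC hCb using hM
  choose D hD hDb using fun ρ : Fin N → ℕ => star_gKernel_le K ρ
  refine ⟨1 + ∑ α, C α * D α.1, ENNReal.add_ne_top.2 ⟨by simp, ENNReal.sum_ne_top.2 fun ρ _ =>
      ENNReal.mul_ne_top (hC ρ) (hD ρ.1)⟩, fun s f hs hf => ?_⟩
  have hg : ∀ α, AEStronglyMeasurable fun x => moment f s α * gKernel α s x := fun α =>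
    ((continuous_gKernel α s).const_mul _).aestronglyMeasurable
  unfold proj momentExpansion
  refine (star_sub_le hf (Finset.aestronglyMeasurable_fun_sum _ fun α _ => hg α)).trans ?_
  rw [add_mul, one_mul]
  gcongr
  refine (star_sum_le _ fun α _ => hg α).trans ?_
  rw [← Finset.sum_attach, Finset.sum_mul]
  refine Finset.sum_le_sum fun α _ => ?_
  have h4 : ENNReal.ofReal (Real.sqrt (1 + s) ^ deg α.1) *
      ENNReal.ofReal ((Real.sqrt (1 + s))⁻¹ ^ deg α.1) = 1 := by
    rw [← ENNReal.ofReal_mul (by positivity), ← mul_pow, mul_inv_cancel₀ (by positivity),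
      one_pow, ENNReal.ofReal_one]
  rw [star_const_mul]
  calc _ ≤ _ := mul_le_mul' (hCb α s f hs) (hDb α.1 s hs)
    _ = C α * D α.1 * wnorm K s f * (ENNReal.ofReal (Real.sqrt (1 + s) ^ deg α.1) *
          ENNReal.ofReal ((Real.sqrt (1 + s))⁻¹ ^ deg α.1)) := by ring
    _ ≤ _ := by
      rw [h4, mul_one]
      gcongr
      exact wnorm_le_star _ _ _

/-! ### The semigroup and vanishing moments -/

lemma monomial_add_eq_sum (α : Fin N → ℕ) (z ξ : E N) :
    monomial α (z + ξ) = ∑ γ ∈ Fintype.piFinset fun i => Finset.range (α i + 1),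
      (∏ i, ((α i).choose (γ i) : ℝ)) * (monomial γ z * monomial (fun i => α i - γ i) ξ) := by
  simp only [monomial, PiLp.add_apply, add_pow]
  rw [Finset.prod_univ_sum]
  refine Finset.sum_congr rfl fun γ _ => ?_
  rw [← Finset.prod_mul_distrib, ← Finset.prod_mul_distrib]
  exact Finset.prod_congr rfl fun i _ => by ring

/-- The binomial expansion of `((x - ξ) + ξ)^α` turns the moment into a sum of integrals of
convolutions. Each factors, and one factor is a moment of `f` of order at most `k`. -/
lemma ZeroMoments.heat {k : ℕ} {f : E N → ℝ} (hf : HasMoments k f) (h0 : ZeroMoments k f) {τ : ℝ}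
    (hτ : 0 < τ) : ZeroMoments k (heat τ f) := by
  intro α hα
  have hG := polyGauss_gaussKernel (N := N) τ
  have hGr := hG.rapid (by positivity)
  have hi1 : ∀ γ, Integrable fun z : E N => monomial γ z * gaussKernel z τ := fun γ =>
    hGr.integrable_monomial hG.continuous γ
  set S := Fintype.piFinset fun i => Finset.range (α i + 1) with hS
  have hdeg : ∀ γ : Fin N → ℕ, deg (fun i => α i - γ i) ≤ k := fun γ =>
    (Finset.sum_le_sum fun i _ => Nat.sub_le _ _).trans hα
  have hi2 : ∀ γ : Fin N → ℕ, Integrable fun ξ => monomial (fun i => α i - γ i) ξ * f ξ :=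
    fun γ => hf _ (hdeg γ)
  have hbd : ∀ γ, ∃ C, ∀ z : E N, ‖monomial γ z * gaussKernel z τ‖ ≤ C := by
    intro γ
    obtain ⟨C, hC⟩ := hGr (deg γ)
    refine ⟨C, fun z => le_trans ?_ (hC z)⟩
    rw [Real.norm_eq_abs, abs_mul]
    gcongr
    simpa using abs_monomial_le_one_add γ z
  have hi3 : ∀ γ x, Integrable fun ξ => (monomial (fun i => α i - γ i) ξ * f ξ) *
      (monomial γ (x - ξ) * gaussKernel (x - ξ) τ) := by
    intro γ x
    obtain ⟨C, hC⟩ := hbd γ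
    refine (hi2 γ).mul_bdd (c := C) ?_ (ae_of_all _ fun ξ => hC _)
    have h1 : Continuous fun z : E N => monomial γ z * gaussKernel z τ :=
      (continuous_monomial γ).mul hG.continuous
    exact (h1.comp (continuous_const.sub continuous_id)).aestronglyMeasurable
  have h1 : ∀ x, monomial α x * ParabolicExpansion.heat τ f x =
      ∑ γ ∈ S, (∏ i, ((α i).choose (γ i) : ℝ)) *
        ∫ ξ, (monomial (fun i => α i - γ i) ξ * f ξ) *
          (monomial γ (x - ξ) * gaussKernel (x - ξ) τ) := by
    intro x
    simp only [← integral_const_mul]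
    rw [← integral_finsetSum _ fun γ _ => (hi3 γ x).const_mul _, ParabolicExpansion.heat,
      ← integral_const_mul]
    congr 1
    ext ξ
    have := monomial_add_eq_sum α (x - ξ) ξ
    rw [sub_add_cancel] at this
    rw [this, Finset.sum_mul]
    exact Finset.sum_congr rfl fun γ _ => by ring
  have hconv : ∀ γ : Fin N → ℕ, Integrable (fun x => ∫ ξ, (monomial (fun i => α i - γ i) ξ * f ξ) *
      (monomial γ (x - ξ) * gaussKernel (x - ξ) τ)) := fun γ =>
    ((hi2 γ).convolution_integrand (ContinuousLinearMap.mul ℝ ℝ) (hi1 γ)).integral_prod_left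
  simp_rw [h1]
  rw [integral_finsetSum _ fun γ _ => (hconv γ).const_mul _]
  refine Finset.sum_eq_zero fun γ _ => ?_
  rw [integral_const_mul]
  have h2 := integral_convolution (ContinuousLinearMap.mul ℝ ℝ) (hi2 γ) (hi1 γ)
    (μ := (volume : Measure (E N))) (ν := (volume : Measure (E N)))
  simp only [h0 _ (hdeg γ), map_zero, zero_apply] at h2
  have h3 : ∫ x, ∫ ξ, (monomial (fun i => α i - γ i) ξ * f ξ) *
      (monomial γ (x - ξ) * gaussKernel (x - ξ) τ) = 0 := h2
  rw [h3, mul_zero]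

/-! ### Duhamel integrals -/

/-- The Duhamel integral with the kernel `w(τ) Γ_τ`. -/
def duh (Γ : E N → ℝ) (w : ℝ → ℝ) (h : ℝ → E N → ℝ) (t : ℝ) (x : E N) : ℝ :=
  ∫ s in Ioo 0 t, w (t - s) * conv Γ (t - s) (h s) x

lemma conv_congr {Γ : E N → ℝ} {τ : ℝ} {f g : E N → ℝ} (h : f =ᵐ[volume] g) :
    conv Γ τ f = conv Γ τ g := by
  ext x
  exact integral_congr_ae (h.mono fun ξ hξ => by simp only [hξ])

lemma ae_Ioo_of_ae_Ioi {p : ℝ → Prop} (h : ∀ᵐ s ∂(volume.restrict (Ioi (0 : ℝ))), p s) (t : ℝ) :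
    ∀ᵐ s ∂(volume.restrict (Ioo 0 t)), p s :=
  ae_mono (Measure.restrict_mono Ioo_subset_Ioi_self le_rfl) h

/-- Permits replacing a source by a Borel representative, for which all sections are measurable. -/
lemma duh_congr {Γ : E N → ℝ} {w : ℝ → ℝ} {h g : ℝ → E N → ℝ}
    (hg : ∀ᵐ s ∂(volume.restrict (Ioi (0 : ℝ))), h s =ᵐ[volume] g s) :
    duh Γ w h = duh Γ w g := by
  ext t x
  refine integral_congr_ae ?_
  filter_upwards [ae_Ioo_of_ae_Ioi hg t] with s hs
  simp only [conv_congr hs]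

/-- Joint measurability on space-time. -/
def JointMeas (h : ℝ → E N → ℝ) : Prop :=
  AEStronglyMeasurable (fun p : ℝ × E N => h p.1 p.2) (spaceTime N)

lemma JointMeas.exists_measurable {h : ℝ → E N → ℝ} (hh : JointMeas h) :
    ∃ g : ℝ → E N → ℝ, Measurable (fun p : ℝ × E N => g p.1 p.2) ∧
      ∀ᵐ s ∂(volume.restrict (Ioi (0 : ℝ))), h s =ᵐ[volume] g s := by
  obtain ⟨g, hg, hgh⟩ := hh
  refine ⟨fun s x => g (s, x), hg.measurable, ?_⟩
  exact Measure.ae_ae_of_ae_prod hgh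

lemma JointMeas.ae_aestronglyMeasurable {h : ℝ → E N → ℝ} (hh : JointMeas h) :
    ∀ᵐ s ∂(volume.restrict (Ioi (0 : ℝ))), AEStronglyMeasurable (h s) := by
  obtain ⟨g, hg, hgh⟩ := hh.exists_measurable
  filter_upwards [hgh] with s hs
  have : Measurable (g s) := hg.comp measurable_prodMk_left
  exact this.aestronglyMeasurable.congr hs.symm

lemma stronglyMeasurable_conv {Γ : E N → ℝ} (hΓ : Continuous Γ) {g : ℝ → E N → ℝ}
    (hg : Measurable (fun p : ℝ × E N => g p.1 p.2)) :
    StronglyMeasurable fun q : (ℝ × ℝ) × E N => conv Γ q.1.1 (g q.1.2) q.2 := by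
  have h1 : Measurable fun q : ((ℝ × ℝ) × E N) × E N =>
      dil Γ q.1.1.1 (q.1.2 - q.2) * g q.1.1.2 q.2 := by
    refine Measurable.mul ?_ ?_
    · exact (measurable_dil hΓ).comp (by fun_prop : Measurable fun q : ((ℝ × ℝ) × E N) × E N =>
        (q.1.1.1, q.1.2 - q.2))
    · exact hg.comp (by fun_prop : Measurable fun q : ((ℝ × ℝ) × E N) × E N => (q.1.1.2, q.2))
  exact h1.stronglyMeasurable.integral_prod_right

lemma measurable_conv_time {Γ : E N → ℝ} (hΓ : Continuous Γ) {w : ℝ → ℝ} (hw : Measurable w)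
    {g : ℝ → E N → ℝ} (hg : Measurable (fun p : ℝ × E N => g p.1 p.2)) (t : ℝ) :
    Measurable fun p : ℝ × E N => w (t - p.1) * conv Γ (t - p.1) (g p.1) p.2 := by
  refine Measurable.mul (hw.comp (by fun_prop)) ?_
  exact (stronglyMeasurable_conv hΓ hg).measurable.comp
    (by fun_prop : Measurable fun p : ℝ × E N => ((t - p.1, p.1), p.2))

lemma jointMeas_duh {Γ : E N → ℝ} (hΓ : Continuous Γ) {w : ℝ → ℝ} (hw : Measurable w)
    {h : ℝ → E N → ℝ} (hh : JointMeas h) : JointMeas (duh Γ w h) := by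
  obtain ⟨g, hg, hgh⟩ := hh.exists_measurable
  rw [duh_congr hgh]
  have h1 : Measurable fun q : (ℝ × E N) × ℝ => (Ioo 0 q.1.1).indicator
      (fun s => w (q.1.1 - s) * conv Γ (q.1.1 - s) (g s) q.1.2) q.2 := by
    have h2 : (fun q : (ℝ × E N) × ℝ => (Ioo 0 q.1.1).indicator
        (fun s => w (q.1.1 - s) * conv Γ (q.1.1 - s) (g s) q.1.2) q.2) =
        {q : (ℝ × E N) × ℝ | 0 < q.2 ∧ q.2 < q.1.1}.indicator
          (fun q => w (q.1.1 - q.2) * conv Γ (q.1.1 - q.2) (g q.2) q.1.2) := by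
      ext q
      simp only [indicator, mem_Ioo, mem_ofPred_eq]
    rw [h2]
    refine Measurable.indicator ?_ ?_
    · refine Measurable.mul (hw.comp (by fun_prop)) ?_
      exact (stronglyMeasurable_conv hΓ hg).measurable.comp
        (by fun_prop : Measurable fun q : (ℝ × E N) × ℝ => ((q.1.1 - q.2, q.2), q.1.2))
    · exact (measurableSet_lt measurable_const measurable_snd).inter
        (measurableSet_lt measurable_snd (measurable_fst.comp measurable_fst))
  have h3 : (fun p : ℝ × E N => duh Γ w g p.1 p.2) = fun p => ∫ s, (Ioo 0 p.1).indicator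
      (fun s => w (p.1 - s) * conv Γ (p.1 - s) (g s) p.2) s := by
    ext p
    rw [integral_indicator measurableSet_Ioo, duh]
  unfold JointMeas
  rw [h3]
  exact (h1.stronglyMeasurable.integral_prod_right).aestronglyMeasurable

/-- Minkowski's integral inequality. The supremum over all `x`, unlike the essential one, passes
under the time integral without any discussion of exceptional sets. -/
lemma duh_ostar_le {Γ : E N → ℝ} (hΓ : Continuous Γ) {w : ℝ → ℝ} (hw : Measurable w)
    {h : ℝ → E N → ℝ} (hh : JointMeas h) (K t : ℝ) :
    ostar K t (duh Γ w h t) ≤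
      ∫⁻ s in Ioo 0 t, ‖w (t - s)‖ₑ * ostar K t (conv Γ (t - s) (h s)) := by
  obtain ⟨g, hg, hgh⟩ := hh.exists_measurable
  rw [duh_congr hgh]
  have h0 : ∫⁻ s in Ioo 0 t, ‖w (t - s)‖ₑ * ostar K t (conv Γ (t - s) (h s)) =
      ∫⁻ s in Ioo 0 t, ‖w (t - s)‖ₑ * ostar K t (conv Γ (t - s) (g s)) := by
    refine lintegral_congr_ae ?_
    filter_upwards [ae_Ioo_of_ae_Ioi hgh t] with s hs
    rw [conv_congr hs]
  rw [h0]
  have hm := measurable_conv_time hΓ hw hg t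
  have hmx : ∀ x, Measurable fun s => w (t - s) * conv Γ (t - s) (g s) x := fun x =>
    hm.comp measurable_prodMk_right
  have hms : ∀ s, Measurable fun x => w (t - s) * conv Γ (t - s) (g s) x := fun s =>
    hm.comp measurable_prodMk_left
  have h1 : wnorm K t (duh Γ w g t) ≤
      ∫⁻ s in Ioo 0 t, ‖w (t - s)‖ₑ * wnorm K t (conv Γ (t - s) (g s)) := by
    unfold wnorm
    calc _ ≤ ∫⁻ x, ∫⁻ s in Ioo 0 t, ENNReal.ofReal (omega K t x) *
          ‖w (t - s) * conv Γ (t - s) (g s) x‖ₑ := by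
          refine lintegral_mono fun x => ?_
          simp only
          rw [lintegral_const_mul' _ _ ENNReal.ofReal_ne_top]
          gcongr
          exact enorm_integral_le_lintegral_enorm _
      _ = ∫⁻ s in Ioo 0 t, ∫⁻ x, ENNReal.ofReal (omega K t x) *
          ‖w (t - s) * conv Γ (t - s) (g s) x‖ₑ := by
          refine lintegral_lintegral_swap (Measurable.aemeasurable ?_)
          refine Measurable.mul ((measurable_omega K t).ennreal_ofReal.comp measurable_fst) ?_
          exact (hm.comp measurable_swap).enorm
      _ = _ := by
          refine lintegral_congr fun s => ?_
          simp only [enorm_mul, mul_left_comm]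
          rw [lintegral_const_mul' _ _ enorm_ne_top]
  have h2 : ENNReal.ofReal (t ^ ((N : ℝ) / 2)) * (⨆ x, ‖duh Γ w g t x‖ₑ) ≤
      ∫⁻ s in Ioo 0 t, ‖w (t - s)‖ₑ * (ENNReal.ofReal (t ^ ((N : ℝ) / 2)) *
        ⨆ x, ‖conv Γ (t - s) (g s) x‖ₑ) := by
    rw [ENNReal.mul_iSup]
    refine iSup_le fun x => ?_
    refine (mul_le_mul_right (enorm_integral_le_lintegral_enorm _) _).trans ?_
    rw [← lintegral_const_mul' _ _ ENNReal.ofReal_ne_top]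
    refine lintegral_mono fun s => ?_
    simp only
    rw [enorm_mul, mul_left_comm]
    gcongr
    exact le_iSup (fun x => ‖conv Γ (t - s) (g s) x‖ₑ) x
  -- Superadditivity of the lower integral needs no measurability, which is not established for the
  -- supremum over `x` as a function of `s`.
  refine (add_le_add h1 h2).trans ((le_lintegral_add _ _).trans (le_of_eq ?_))
  simp only [ostar, mul_add]

/-! ### Source terms and differentiation of Duhamel integrals. -/

/-- A source term: its weighted norm is `O(s^{-1/2})`. -/
structure Source (K : ℝ) (h : ℝ → E N → ℝ) : Prop where
  meas : JointMeas h
  bdd : ∃ C : ℝ, ∀ᵐ s ∂(volume.restrict (Ioi (0 : ℝ))),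
    star K s (h s) ≤ ENNReal.ofReal (C * s ^ (-(1 / 2) : ℝ))

lemma Source.ae_star_lt_top {K : ℝ} {h : ℝ → E N → ℝ} (hh : Source K h) :
    ∀ᵐ s ∂(volume.restrict (Ioi (0 : ℝ))), star K s (h s) < ⊤ := by
  obtain ⟨C, hC⟩ := hh.bdd
  exact hC.mono fun s hs => hs.trans_lt ENNReal.ofReal_lt_top

lemma hasMoments_of_star {K : ℝ} {k : ℕ} (hkK : (k : ℝ) ≤ K) {s : ℝ} (hs : 0 ≤ s) {f : E N → ℝ}
    (hf : AEStronglyMeasurable f) (h : star K s f < ⊤) : HasMoments k f :=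
  hasMoments_of_wnorm hkK hs hf ((wnorm_le_star K s f).trans_lt h).ne

lemma Source.ae_hasMoments {K : ℝ} {k : ℕ} (hkK : (k : ℝ) ≤ K) {h : ℝ → E N → ℝ}
    (hh : Source K h) : ∀ᵐ s ∂(volume.restrict (Ioi (0 : ℝ))), HasMoments k (h s) := by
  filter_upwards [hh.ae_star_lt_top, hh.meas.ae_aestronglyMeasurable,
    ae_restrict_mem measurableSet_Ioi] with s h1 h2 h3
  exact hasMoments_of_star hkK (le_of_lt h3) h2 h1

lemma Source.ae_integrable {K : ℝ} (hK : 0 ≤ K) {h : ℝ → E N → ℝ}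
    (hh : Source K h) : ∀ᵐ s ∂(volume.restrict (Ioi (0 : ℝ))), Integrable (h s) :=
  (hh.ae_hasMoments (k := 0) (by simpa using hK)).mono fun _ hs => hs.integrable

lemma conv_abs_le {Γ : E N → ℝ} (hΓc : Continuous Γ) (hΓ : Rapid Γ) {K : ℝ} (hK : 0 ≤ K) :
    ∃ C : ℝ, 0 ≤ C ∧ ∀ (s τ : ℝ) (f : E N → ℝ) (B : ℝ), 0 ≤ s → 0 < τ → AEStronglyMeasurable f →
      0 ≤ B → star K s f ≤ ENNReal.ofReal B →
      ∀ x, |conv Γ τ f x| ≤ C * (s + τ) ^ (-(N : ℝ) / 2) * B := by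
  obtain ⟨C, hC, h⟩ := conv_ostar_le hΓc hΓ hK
  refine ⟨C.toReal, ENNReal.toReal_nonneg, fun s τ f B hs hτ hf hB hfB x => ?_⟩
  have hst : 0 < s + τ := by positivity
  have h1 : ENNReal.ofReal ((s + τ) ^ ((N : ℝ) / 2)) * ‖conv Γ τ f x‖ₑ ≤ C * ENNReal.ofReal B := by
    refine le_trans ?_ ((h s τ f hs hτ hf).trans (mul_le_mul_right hfB C))
    refine le_trans ?_ le_add_self
    gcongr
    exact le_iSup (fun x => ‖conv Γ τ f x‖ₑ) x
  have h2 : ‖conv Γ τ f x‖ₑ ≤ ENNReal.ofReal (C.toReal * (s + τ) ^ (-(N : ℝ) / 2) * B) := by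
    calc _ = ENNReal.ofReal ((s + τ) ^ (-(N : ℝ) / 2)) *
          (ENNReal.ofReal ((s + τ) ^ ((N : ℝ) / 2)) * ‖conv Γ τ f x‖ₑ) := by
          rw [← mul_assoc, rpow_mul_rpow_neg_half hst, one_mul]
      _ ≤ ENNReal.ofReal ((s + τ) ^ (-(N : ℝ) / 2)) * (C * ENNReal.ofReal B) := by gcongr
      _ = _ := by
          rw [ENNReal.ofReal_mul (by positivity), ENNReal.ofReal_mul (by positivity),
            ENNReal.ofReal_toReal hC]
          ring
  rw [Real.enorm_eq_ofReal_abs] at h2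
  exact (ENNReal.ofReal_le_ofReal_iff (by positivity)).1 h2

lemma integrableOn_rpow_neg_half (t : ℝ) :
    IntegrableOn (fun s : ℝ => s ^ (-(1 / 2) : ℝ)) (Ioo 0 t) := by
  rcases le_or_gt t 0 with h | h
  · simp [Ioo_eq_empty_of_le h]
  have h1 := (intervalIntegral.intervalIntegrable_rpow' (a := 0) (b := t) (r := -(1 / 2))
    (by norm_num))
  rw [intervalIntegrable_iff_integrableOn_Ioo_of_le h.le] at h1
  exact h1

lemma integrableOn_sub_rpow_neg_half (t : ℝ) :
    IntegrableOn (fun s : ℝ => (t - s) ^ (-(1 / 2) : ℝ)) (Ioo 0 t) := by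
  rcases le_or_gt t 0 with h | h
  · simp [Ioo_eq_empty_of_le h]
  have h1 := (intervalIntegral.intervalIntegrable_rpow' (a := 0) (b := t) (r := -(1 / 2))
    (by norm_num)).comp_sub_left t
  simp only [sub_zero, sub_self] at h1
  have h2 := h1.symm
  rw [intervalIntegrable_iff_integrableOn_Ioo_of_le h.le] at h2
  exact h2

lemma inv_sqrt_eq {τ : ℝ} (hτ : 0 ≤ τ) : (Real.sqrt τ)⁻¹ = τ ^ (-(1 / 2) : ℝ) := by
  rw [Real.sqrt_eq_rpow, Real.rpow_neg hτ]

/-- One of `s` and `t - s` is at least `t / 2`; this separates the two singularities. -/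
lemma rpow_mul_sub_rpow_le {s t : ℝ} (hs : s ∈ Ioo 0 t) :
    (t - s) ^ (-(1 / 2) : ℝ) * s ^ (-(1 / 2) : ℝ) ≤
      (t / 2) ^ (-(1 / 2) : ℝ) * (s ^ (-(1 / 2) : ℝ) + (t - s) ^ (-(1 / 2) : ℝ)) := by
  obtain ⟨h1, h2⟩ := hs
  have e1 : 0 < t - s := by linarith
  have e0 : 0 < t / 2 := by linarith
  have p1 : 0 < (t - s) ^ (-(1 / 2) : ℝ) := by positivity
  have p2 : 0 < s ^ (-(1 / 2) : ℝ) := by positivity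
  have p3 : 0 < (t / 2) ^ (-(1 / 2) : ℝ) := by positivity
  rcases le_total s (t / 2) with h | h
  · have : (t - s) ^ (-(1 / 2) : ℝ) ≤ (t / 2) ^ (-(1 / 2) : ℝ) :=
      Real.rpow_le_rpow_of_nonpos e0 (by linarith) (by norm_num)
    nlinarith
  · have : s ^ (-(1 / 2) : ℝ) ≤ (t / 2) ^ (-(1 / 2) : ℝ) :=
      Real.rpow_le_rpow_of_nonpos e0 h (by norm_num)
    nlinarith

/-- The weights of the Duhamel integral and of its gradient. -/
structure TimeWeight (w : ℝ → ℝ) : Prop where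
  meas : Measurable w
  integrableOn : ∀ t, IntegrableOn (fun s => |w (t - s)| * s ^ (-(1 / 2) : ℝ)) (Ioo 0 t)

lemma timeWeight_one : TimeWeight fun _ => 1 :=
  ⟨measurable_const, fun t => by simpa using integrableOn_rpow_neg_half t⟩

lemma timeWeight_inv_sqrt : TimeWeight fun τ => (Real.sqrt τ)⁻¹ := by
  refine ⟨Real.continuous_sqrt.measurable.inv, fun t => ?_⟩
  refine Integrable.mono' (g := fun s => (t / 2) ^ (-(1 / 2) : ℝ) *
    (s ^ (-(1 / 2) : ℝ) + (t - s) ^ (-(1 / 2) : ℝ))) ?_ ?_ ?_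
  · exact ((integrableOn_rpow_neg_half t).add (integrableOn_sub_rpow_neg_half t)).const_mul _
  · have h1 : Measurable fun s : ℝ => (Real.sqrt (t - s))⁻¹ :=
      (Real.continuous_sqrt.measurable.comp (by fun_prop)).inv
    exact (h1.abs.mul (measurable_id.pow_const _)).aestronglyMeasurable
  · filter_upwards [ae_restrict_mem measurableSet_Ioo] with s hs
    have h1 : 0 < t - s := by linarith [hs.2]
    have h2 : 0 < s := hs.1
    rw [Real.norm_of_nonneg (by positivity), abs_of_nonneg (by positivity), inv_sqrt_eq h1.le]
    exact rpow_mul_sub_rpow_le hs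

/-- A majorant uniform in `x`, used for continuity and differentiation under the integral. The
kernel bound involves only `s + (t - s) = t`, so it contributes a constant. -/
lemma Source.exists_duh_bound {K : ℝ} (hK : 0 ≤ K) {h : ℝ → E N → ℝ} (hh : Source K h)
    {Γ : E N → ℝ} (hΓc : Continuous Γ) (hΓ : Rapid Γ) {w : ℝ → ℝ} (hw : TimeWeight w) (t : ℝ) :
    ∃ b : ℝ → ℝ, IntegrableOn b (Ioo 0 t) ∧ ∀ᵐ s ∂(volume.restrict (Ioo 0 t)),
      ∀ x, |w (t - s) * conv Γ (t - s) (h s) x| ≤ b s := by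
  obtain ⟨C, hC⟩ := hh.bdd
  obtain ⟨D, hD, hDb⟩ := conv_abs_le hΓc hΓ hK
  refine ⟨fun s => D * t ^ (-(N : ℝ) / 2) * |C| * (|w (t - s)| * s ^ (-(1 / 2) : ℝ)),
    (hw.integrableOn t).const_mul _, ?_⟩
  filter_upwards [ae_Ioo_of_ae_Ioi hC t, ae_Ioo_of_ae_Ioi hh.meas.ae_aestronglyMeasurable t,
    ae_restrict_mem measurableSet_Ioo] with s h1 h2 h3 x
  have hs : 0 < s := h3.1
  have h4 := hDb s (t - s) (h s) (|C| * s ^ (-(1 / 2) : ℝ)) hs.le (by linarith [h3.2]) h2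
    (by positivity) (h1.trans (ENNReal.ofReal_le_ofReal (by gcongr; exact le_abs_self C))) x
  rw [add_sub_cancel] at h4
  rw [abs_mul]
  calc _ ≤ |w (t - s)| * (D * t ^ (-(N : ℝ) / 2) * (|C| * s ^ (-(1 / 2) : ℝ))) := by gcongr
    _ = _ := by ring

lemma Source.aestronglyMeasurable_conv {K : ℝ} {h : ℝ → E N → ℝ} (hh : Source K h)
    {Γ : E N → ℝ} (hΓc : Continuous Γ) {w : ℝ → ℝ} (hw : Measurable w) (t : ℝ) (x : E N) :
    AEStronglyMeasurable (fun s => w (t - s) * conv Γ (t - s) (h s) x)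
      (volume.restrict (Ioo 0 t)) := by
  obtain ⟨g, hg, hgh⟩ := hh.meas.exists_measurable
  have h1 : Measurable fun s => w (t - s) * conv Γ (t - s) (g s) x :=
    (measurable_conv_time hΓc hw hg t).comp measurable_prodMk_right
  refine h1.aestronglyMeasurable.congr ?_
  filter_upwards [ae_Ioo_of_ae_Ioi hgh t] with s hs
  rw [conv_congr hs]

lemma Source.integrableOn_duh {K : ℝ} (hK : 0 ≤ K) {h : ℝ → E N → ℝ} (hh : Source K h)
    {Γ : E N → ℝ} (hΓc : Continuous Γ) (hΓ : Rapid Γ) {w : ℝ → ℝ} (hw : TimeWeight w) (t : ℝ)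
    (x : E N) : IntegrableOn (fun s => w (t - s) * conv Γ (t - s) (h s) x) (Ioo 0 t) := by
  obtain ⟨b, hb, hbb⟩ := hh.exists_duh_bound hK hΓc hΓ hw t
  exact Integrable.mono' hb (hh.aestronglyMeasurable_conv hΓc hw.meas t x)
    (hbb.mono fun s hs => hs x)

lemma fderiv_eq_sum_proj (f : E N → ℝ) (x : E N) :
    fderiv ℝ f x = ∑ i, partialDeriv i f x • EuclideanSpace.proj (𝕜 := ℝ) i := by
  ext v
  rw [fderiv_apply_eq_sum, sum_apply]
  exact Finset.sum_congr rfl fun i _ => by simp [mul_comm]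

/-- A derivative of the kernel costs `(t - s)^{-1/2}`, which is integrable together with the
singularity `s^{-1/2}` of the source. -/
lemma Source.hasFDerivAt_duh {K : ℝ} (hK : 0 ≤ K) {h : ℝ → E N → ℝ} (hh : Source K h)
    {c : ℝ} (hc : 0 < c) {Γ : E N → ℝ} (hΓ : PolyGauss c Γ) (t : ℝ) (x : E N) :
    HasFDerivAt (duh Γ (fun _ => 1) h t) (∑ i, duh (partialDeriv i Γ)
      (fun τ => (Real.sqrt τ)⁻¹) h t x • EuclideanSpace.proj (𝕜 := ℝ) i) x := by
  have hp : ∀ i, PolyGauss c (partialDeriv i Γ) := fun i => hΓ.partialDeriv i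
  choose b hb hbb using fun i => hh.exists_duh_bound hK (hp i).continuous ((hp i).rapid hc)
    timeWeight_inv_sqrt t
  have hint := fun x i => hh.integrableOn_duh hK (hp i).continuous ((hp i).rapid hc)
    timeWeight_inv_sqrt t x
  have h1 := hasFDerivAt_integral_of_dominated_of_fderiv_le (μ := volume.restrict (Ioo 0 t))
    (s := univ) (x₀ := x) (𝕜 := ℝ) (F := fun x s => 1 * conv Γ (t - s) (h s) x)
    (F' := fun x s => ∑ i, ((Real.sqrt (t - s))⁻¹ * conv (partialDeriv i Γ) (t - s) (h s) x) •
      EuclideanSpace.proj (𝕜 := ℝ) i)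
    (bound := fun s => ∑ i : Fin N, b i s * ‖(EuclideanSpace.proj i : E N →L[ℝ] ℝ)‖)
    univ_mem
    (Eventually.of_forall fun x => hh.aestronglyMeasurable_conv hΓ.continuous measurable_const t x)
    (hh.integrableOn_duh hK hΓ.continuous (hΓ.rapid hc) timeWeight_one t x) ?_ ?_ ?_ ?_
  · refine h1.congr_fderiv ?_
    rw [integral_finsetSum _ fun i _ => (hint x i).smul_const _]
    refine Finset.sum_congr rfl fun i _ => ?_
    rw [integral_smul_const]
    rfl
  · exact Finset.aestronglyMeasurable_fun_sum _ fun i _ => (hint x i).aestronglyMeasurable.smul_const _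
  · filter_upwards [ae_all_iff.2 hbb] with s hs y _
    refine (norm_sum_le _ _).trans (Finset.sum_le_sum fun i _ => ?_)
    rw [norm_smul]
    gcongr
    exact hs i y
  · exact integrable_finsetSum _ fun i _ => (hb i).mul_const _
  · filter_upwards [ae_Ioo_of_ae_Ioi (hh.ae_integrable hK) t] with s hs y _
    have h2 := ((contDiff_conv hc hΓ (t - s) hs).differentiable (by simp) y).hasFDerivAt
    rw [fderiv_eq_sum_proj] at h2
    simp only [one_mul]
    refine h2.congr_fderiv (Finset.sum_congr rfl fun i _ => ?_)
    rw [partialDeriv_conv hc hΓ (t - s) hs]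

lemma Source.continuous_duh {K : ℝ} (hK : 0 ≤ K) {h : ℝ → E N → ℝ} (hh : Source K h)
    {c : ℝ} (hc : 0 < c) {Γ : E N → ℝ} (hΓ : PolyGauss c Γ) {w : ℝ → ℝ} (hw : TimeWeight w)
    (t : ℝ) : Continuous (duh Γ w h t) := by
  obtain ⟨b, hb, hbb⟩ := hh.exists_duh_bound hK hΓ.continuous (hΓ.rapid hc) hw t
  unfold duh
  refine continuous_of_dominated (bound := b)
    (fun x => hh.aestronglyMeasurable_conv hΓ.continuous hw.meas t x)
    (fun x => hbb.mono fun s hs => hs x) hb ?_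
  filter_upwards [ae_Ioo_of_ae_Ioi (hh.ae_integrable hK) t] with s hs
  exact (contDiff_conv hc hΓ (t - s) hs).continuous.const_mul _

lemma Source.contDiff_duh {K : ℝ} (hK : 0 ≤ K) {h : ℝ → E N → ℝ} (hh : Source K h)
    {c : ℝ} (hc : 0 < c) {Γ : E N → ℝ} (hΓ : PolyGauss c Γ) (t : ℝ) :
    ContDiff ℝ 1 (duh Γ (fun _ => 1) h t) := by
  refine contDiff_one_iff_fderiv.2
    ⟨fun x => (hh.hasFDerivAt_duh hK hc hΓ t x).differentiableAt, ?_⟩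
  rw [funext fun x => (hh.hasFDerivAt_duh hK hc hΓ t x).fderiv]
  exact continuous_finsetSum _ fun i _ =>
    (hh.continuous_duh hK hc (hΓ.partialDeriv i) timeWeight_inv_sqrt t).smul continuous_const

lemma Source.partialDeriv_duh {K : ℝ} (hK : 0 ≤ K) {h : ℝ → E N → ℝ} (hh : Source K h)
    {c : ℝ} (hc : 0 < c) {Γ : E N → ℝ} (hΓ : PolyGauss c Γ) (t : ℝ) (i : Fin N) :
    partialDeriv i (duh Γ (fun _ => 1) h t) =
      duh (partialDeriv i Γ) (fun τ => (Real.sqrt τ)⁻¹) h t := by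
  ext x
  rw [HasFDerivAt.partialDeriv_eq (hh.hasFDerivAt_duh hK hc hΓ t x), sum_apply,
    Finset.sum_eq_single i]
  · simp
  · intro j _ hj
    simp [hj]
  · simp

/-! ### Measurability of the coefficients -/

lemma jointMeas_gKernel (α : Fin N → ℕ) : JointMeas (gKernel (N := N) α) := by
  have h1 : Measurable fun p : ℝ × E N =>
      (Real.sqrt (1 + p.1))⁻¹ ^ deg α * dil (gKernel α 0) (1 + p.1) p.2 := by
    refine Measurable.mul ?_ ?_
    · exact ((Real.continuous_sqrt.measurable.comp (by fun_prop)).inv).pow_const _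
    · exact (measurable_dil (continuous_gKernel α 0)).comp
        (by fun_prop : Measurable fun p : ℝ × E N => (1 + p.1, p.2))
  refine h1.aestronglyMeasurable.congr ?_
  have h2 : ∀ᵐ p : ℝ × E N ∂(spaceTime N), p.1 ∈ Ioi (0 : ℝ) :=
    Measure.quasiMeasurePreserving_fst.ae (ae_restrict_mem measurableSet_Ioi)
  filter_upwards [h2] with p hp
  rw [gKernel_eq_dil α (le_of_lt hp)]

lemma JointMeas.integral_monomial {h : ℝ → E N → ℝ} (hh : JointMeas h) (α : Fin N → ℕ) :
    AEStronglyMeasurable (fun s => ∫ x, monomial α x * h s x) (volume.restrict (Ioi (0 : ℝ))) := by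
  have h1 : AEStronglyMeasurable (fun p : ℝ × E N => monomial α p.2 * h p.1 p.2) (spaceTime N) :=
    ((continuous_monomial α).comp continuous_snd).aestronglyMeasurable.mul hh
  exact h1.integral_prod_right'

lemma JointMeas.moment {h : ℝ → E N → ℝ} (hh : JointMeas h) (α : Fin N → ℕ) :
    AEStronglyMeasurable (fun s => moment (h s) s α) (volume.restrict (Ioi (0 : ℝ))) := by
  induction hd : deg α using Nat.strong_induction_on generalizing α with
  | _ d ih =>
    have h1 : AEStronglyMeasurable (fun s => (∫ x, monomial α x * h s x) -
        ∑ ρ ∈ lowerIndices α, ParabolicExpansion.moment (h s) s ρ *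
          ∫ x, monomial α x * gKernel ρ s x) (volume.restrict (Ioi (0 : ℝ))) := by
      refine (hh.integral_monomial α).sub (Finset.aestronglyMeasurable_fun_sum _ fun ρ hρ => ?_)
      exact (ih (deg ρ) (hd ▸ deg_lt_of_mem_lowerIndices hρ) ρ rfl).mul
        ((jointMeas_gKernel ρ).integral_monomial α)
    refine h1.congr ?_
    filter_upwards [ae_restrict_mem measurableSet_Ioi] with s hs
    exact (moment_eq (h s) (le_of_lt hs) α).symm

lemma JointMeas.sub {h g : ℝ → E N → ℝ} (hh : JointMeas h) (hg : JointMeas g) :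
    JointMeas fun s x => h s x - g s x := AEStronglyMeasurable.sub hh hg

lemma JointMeas.momentExpansion {h : ℝ → E N → ℝ} (hh : JointMeas h) (k : ℕ) :
    JointMeas fun s => momentExpansion k s (h s) := by
  unfold JointMeas ParabolicExpansion.momentExpansion
  refine Finset.aestronglyMeasurable_fun_sum _ fun α _ => ?_
  exact AEStronglyMeasurable.mul (hh.moment α).comp_fst (jointMeas_gKernel α)

lemma JointMeas.proj {h : ℝ → E N → ℝ} (hh : JointMeas h) (k : ℕ) :
    JointMeas fun s => proj k s (h s) := hh.sub (hh.momentExpansion k)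

lemma Source.proj {K : ℝ} {k : ℕ} (hkK : (k : ℝ) ≤ K) {h : ℝ → E N → ℝ} (hh : Source K h) :
    Source K fun s => proj k s (h s) := by
  obtain ⟨C, hC⟩ := hh.bdd
  obtain ⟨D, hD, hDb⟩ := star_proj_le (N := N) hkK
  refine ⟨hh.meas.proj k, D.toReal * C, ?_⟩
  filter_upwards [hC, hh.meas.ae_aestronglyMeasurable, ae_restrict_mem measurableSet_Ioi]
    with s h1 h2 h3
  refine (hDb s (h s) (le_of_lt h3) h2).trans ?_
  rw [mul_assoc, ENNReal.ofReal_mul ENNReal.toReal_nonneg, ENNReal.ofReal_toReal hD]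
  gcongr

lemma Source.of_le {K : ℝ} {h g : ℝ → E N → ℝ} (hh : Source K h) (hg : JointMeas g) (D : ℝ≥0∞)
    (hD : D ≠ ⊤) (hb : ∀ᵐ s ∂(volume.restrict (Ioi (0 : ℝ))), star K s (g s) ≤ D * star K s (h s)) :
    Source K g := by
  obtain ⟨C, hC⟩ := hh.bdd
  refine ⟨hg, D.toReal * C, ?_⟩
  filter_upwards [hC, hb] with s h1 h2
  refine h2.trans ?_
  rw [mul_assoc, ENNReal.ofReal_mul ENNReal.toReal_nonneg, ENNReal.ofReal_toReal hD]
  gcongr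

lemma Source.sub {K : ℝ} {h g : ℝ → E N → ℝ} (hh : Source K h) (hg : Source K g) :
    Source K fun s x => h s x - g s x := by
  obtain ⟨C, hC⟩ := hh.bdd
  obtain ⟨D, hD⟩ := hg.bdd
  refine ⟨hh.meas.sub hg.meas, |C| + |D|, ?_⟩
  filter_upwards [hC, hD, hh.meas.ae_aestronglyMeasurable, hg.meas.ae_aestronglyMeasurable,
    ae_restrict_mem measurableSet_Ioi] with s h1 h2 h3 h4 h5
  have hs : (0 : ℝ) < s := h5
  refine (star_sub_le h3 h4).trans ?_
  rw [add_mul, ENNReal.ofReal_add (by positivity) (by positivity)]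
  refine add_le_add (h1.trans (ENNReal.ofReal_le_ofReal ?_))
    (h2.trans (ENNReal.ofReal_le_ofReal ?_))
  · gcongr; exact le_abs_self _
  · gcongr; exact le_abs_self _

lemma Source.integrableOn_moment {K : ℝ} {k : ℕ} (hkK : (k : ℝ) ≤ K) {h : ℝ → E N → ℝ}
    (hh : Source K h) {α : Fin N → ℕ} (hα : deg α ≤ k) (t : ℝ) :
    IntegrableOn (fun s => moment (h s) s α) (Ioo 0 t) := by
  obtain ⟨C, hC⟩ := hh.bdd
  obtain ⟨D, hD, hDb⟩ := moment_bound hkK α hα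
  refine Integrable.mono' (g := fun s => D.toReal * Real.sqrt (1 + t) ^ deg α *
    |C| * s ^ (-(1 / 2) : ℝ)) ((integrableOn_rpow_neg_half t).const_mul _)
    ((hh.meas.moment α).mono_measure (Measure.restrict_mono Ioo_subset_Ioi_self le_rfl)) ?_
  filter_upwards [ae_Ioo_of_ae_Ioi hC t, ae_restrict_mem measurableSet_Ioo] with s h1 h2
  have hs : 0 < s := h2.1
  have h3 : ‖moment (h s) s α‖ₑ ≤ ENNReal.ofReal (D.toReal * Real.sqrt (1 + t) ^ deg α *
      |C| * s ^ (-(1 / 2) : ℝ)) := by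
    refine (hDb s (h s) hs.le).trans ?_
    rw [mul_assoc (_ * _), ENNReal.ofReal_mul (by positivity), ENNReal.ofReal_mul (by positivity),
      ENNReal.ofReal_toReal hD]
    gcongr
    · exact h2.2.le
    · refine (wnorm_le_star _ _ _).trans (h1.trans (ENNReal.ofReal_le_ofReal ?_))
      gcongr
      exact le_abs_self C
  rw [← ofReal_norm] at h3
  exact (ENNReal.ofReal_le_ofReal_iff (by positivity)).1 h3

/-! ### Solutions of the inhomogeneous heat equation -/

/-- The mild solution with the initial function `φ` and the source `h`. -/
def sol (φ : E N → ℝ) (h : ℝ → E N → ℝ) (t : ℝ) (x : E N) : ℝ :=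
  heat t φ x + ∫ s in (0 : ℝ)..t, heat (t - s) (h s) x

lemma integral_heat_eq_duh (h : ℝ → E N → ℝ) {t : ℝ} (ht : 0 < t) (x : E N) :
    ∫ s in (0 : ℝ)..t, heat (t - s) (h s) x = duh (gauss N) (fun _ => 1) h t x := by
  rw [intervalIntegral.integral_of_le ht.le, integral_Ioc_eq_integral_Ioo, duh]
  refine setIntegral_congr_fun measurableSet_Ioo fun s hs => ?_
  simp only [one_mul]
  rw [heat_eq_conv (by linarith [hs.2])]

lemma sol_eq (φ : E N → ℝ) (h : ℝ → E N → ℝ) {t : ℝ} (ht : 0 < t) :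
    sol φ h t = fun x => conv (gauss N) t φ x + duh (gauss N) (fun _ => 1) h t x := by
  ext x
  rw [sol, integral_heat_eq_duh h ht, heat_eq_conv ht]

lemma quarter_pos : (0 : ℝ) < 1 / 4 := by norm_num

lemma contDiff_sol {K : ℝ} (hK : 0 ≤ K) {φ : E N → ℝ} (hφ : Integrable φ) {h : ℝ → E N → ℝ}
    (hh : Source K h) {t : ℝ} (ht : 0 < t) : ContDiff ℝ 1 (sol φ h t) := by
  rw [sol_eq φ h ht]
  exact (contDiff_conv quarter_pos polyGauss_gauss t hφ).add
    (hh.contDiff_duh hK quarter_pos polyGauss_gauss t)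

lemma partialDeriv_add {f g : E N → ℝ} {x : E N} (hf : DifferentiableAt ℝ f x)
    (hg : DifferentiableAt ℝ g x) (i : Fin N) :
    partialDeriv i (fun x => f x + g x) x = partialDeriv i f x + partialDeriv i g x :=
  HasFDerivAt.partialDeriv_eq (hf.hasFDerivAt.add hg.hasFDerivAt) i

lemma partialDeriv_sol {K : ℝ} (hK : 0 ≤ K) {φ : E N → ℝ} (hφ : Integrable φ) {h : ℝ → E N → ℝ}
    (hh : Source K h) {t : ℝ} (ht : 0 < t) (i : Fin N) :
    partialDeriv i (sol φ h t) = fun x =>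
      (Real.sqrt t)⁻¹ * conv (partialDeriv i (gauss N)) t φ x +
        duh (partialDeriv i (gauss N)) (fun τ => (Real.sqrt τ)⁻¹) h t x := by
  rw [sol_eq φ h ht]
  ext x
  rw [partialDeriv_add
    ((contDiff_conv quarter_pos polyGauss_gauss t hφ).differentiable (by simp) x)
    ((hh.contDiff_duh hK quarter_pos polyGauss_gauss t).differentiable (by simp) x),
    partialDeriv_conv quarter_pos polyGauss_gauss t hφ,
    hh.partialDeriv_duh hK quarter_pos polyGauss_gauss]

lemma jointMeas_sol {φ : E N → ℝ} (hφ : AEStronglyMeasurable φ) {h : ℝ → E N → ℝ}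
    (hh : JointMeas h) : JointMeas (sol φ h) := by
  obtain ⟨ψ, hψ, hφψ⟩ := hφ
  have hc : Continuous (gauss N) := polyGauss_gauss.continuous
  have h1 : Measurable fun p : ℝ × E N => conv (gauss N) p.1 ψ p.2 :=
    (stronglyMeasurable_conv hc (g := fun _ => ψ) (hψ.measurable.comp measurable_snd)).measurable.comp
      (by fun_prop : Measurable fun p : ℝ × E N => ((p.1, p.1), p.2))
  have h2 := AEStronglyMeasurable.add (μ := spaceTime N) h1.aestronglyMeasurable
    (jointMeas_duh hc measurable_const hh (w := fun _ => 1))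
  refine h2.congr ?_
  have h3 : ∀ᵐ p : ℝ × E N ∂(spaceTime N), p.1 ∈ Ioi (0 : ℝ) :=
    Measure.quasiMeasurePreserving_fst.ae (ae_restrict_mem measurableSet_Ioi)
  filter_upwards [h3] with p hp
  rw [sol_eq φ h hp, conv_congr hφψ]
  rfl

/-! ### Norms including the gradient -/

/-- The norm of a function and its gradient at the time `t`. -/
def dnorm (K t : ℝ) (f : E N → ℝ) : ℝ≥0∞ :=
  ostar K t f + ENNReal.ofReal (Real.sqrt t) * ∑ i, ostar K t (partialDeriv i f)

lemma ostar_add_le {K t : ℝ} {f g : E N → ℝ} (hf : Continuous f) :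
    ostar K t (fun x => f x + g x) ≤ ostar K t f + ostar K t g := by
  have hm : Measurable fun x => ENNReal.ofReal (omega K t x) * ‖f x‖ₑ :=
    (measurable_omega K t).ennreal_ofReal.mul hf.measurable.enorm
  have h1 : wnorm K t (fun x => f x + g x) ≤ wnorm K t f + wnorm K t g := by
    unfold wnorm
    rw [← lintegral_add_left hm]
    refine lintegral_mono fun x => ?_
    simp only [← mul_add]
    gcongr
    exact enorm_add_le _ _
  have h2 : (⨆ x, ‖f x + g x‖ₑ) ≤ (⨆ x, ‖f x‖ₑ) + ⨆ x, ‖g x‖ₑ :=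
    iSup_le fun x => (enorm_add_le _ _).trans
      (add_le_add (le_iSup (fun x => ‖f x‖ₑ) x) (le_iSup (fun x => ‖g x‖ₑ) x))
  calc _ ≤ _ + ENNReal.ofReal (t ^ ((N : ℝ) / 2)) * _ := add_le_add h1 (mul_le_mul_right h2 _)
    _ = _ := by unfold ostar; ring

lemma ostar_const_mul {K t : ℝ} (a : ℝ) (f : E N → ℝ) :
    ostar K t (fun x => a * f x) = ‖a‖ₑ * ostar K t f := by
  unfold ostar wnorm
  simp only [enorm_mul, mul_left_comm]
  rw [lintegral_const_mul' _ _ enorm_ne_top, ← ENNReal.mul_iSup]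
  ring

/-- The time weight that appears in the estimates of Duhamel integrals. -/
def tw (s t : ℝ) : ℝ := 1 + Real.sqrt t / Real.sqrt (t - s)

/-- The passage from one kernel to a mild solution, made once and applied to three bounds `B`:
without moments, with the factor `ratio`, and with a split at `t / 2`. `P` is the class where the
kernel bound holds. In `tw` the `1` belongs to the value and `√t / √(t - s)` to the gradient. -/
lemma dnorm_sol_le {K : ℝ} (hK : 0 ≤ K) (B : ℝ → ℝ → (E N → ℝ) → ℝ≥0∞)
    (P : (E N → ℝ) → Prop)
    (hP : ∀ (c : ℝ) (Γ : E N → ℝ), 0 < c → PolyGauss c Γ → ∃ C : ℝ≥0∞, C ≠ ⊤ ∧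
      ∀ (s τ : ℝ) (f : E N → ℝ), 0 ≤ s → 0 < τ → P f →
        ostar K (s + τ) (conv Γ τ f) ≤ C * B s (s + τ) f) :
    ∃ C : ℝ≥0∞, C ≠ ⊤ ∧ ∀ (φ : E N → ℝ) (h : ℝ → E N → ℝ) (t : ℝ), Integrable φ → P φ →
      Source K h → (∀ᵐ s ∂(volume.restrict (Ioi (0 : ℝ))), P (h s)) → 0 < t →
      dnorm K t (sol φ h t) ≤ C * (B 0 t φ + ∫⁻ s in Ioo 0 t, ENNReal.ofReal (tw s t) * B s t (h s)) := by
  have hp : ∀ i, PolyGauss (1 / 4) (partialDeriv i (gauss N)) := fun i =>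
    polyGauss_gauss.partialDeriv i
  obtain ⟨C₀, hC₀, h₀⟩ := hP _ _ quarter_pos polyGauss_gauss
  choose C₁ hC₁ h₁ using fun i => hP _ _ quarter_pos (hp i)
  refine ⟨C₀ + ∑ i, C₁ i, ENNReal.add_ne_top.2 ⟨hC₀, ENNReal.sum_ne_top.2 fun i _ => hC₁ i⟩,
    fun φ h t hφi hφ hh hPh ht => ?_⟩
  set R := B 0 t φ
  have hduh : ∀ (Γ : E N → ℝ) (c : ℝ), PolyGauss c Γ → ∀ (w : ℝ → ℝ), TimeWeight w →
      ∀ (C : ℝ≥0∞), C ≠ ⊤ → (∀ (s τ : ℝ) (f : E N → ℝ), 0 ≤ s → 0 < τ → P f →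
        ostar K (s + τ) (conv Γ τ f) ≤ C * B s (s + τ) f) →
      ostar K t (duh Γ w h t) ≤ C * ∫⁻ s in Ioo 0 t, ‖w (t - s)‖ₑ * B s t (h s) := by
    intro Γ c hΓ w hw C hC hb
    refine (duh_ostar_le hΓ.continuous hw.meas hh.meas K t).trans ?_
    rw [← lintegral_const_mul' _ _ hC]
    refine lintegral_mono_ae ?_
    filter_upwards [ae_Ioo_of_ae_Ioi hPh t, ae_restrict_mem measurableSet_Ioo] with s h1 h2
    have := hb s (t - s) (h s) h2.1.le (by linarith [h2.2]) h1
    rw [add_sub_cancel] at this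
    rw [mul_left_comm]
    gcongr
  have e0 : ostar K t (sol φ h t) ≤ C₀ * (R + ∫⁻ s in Ioo 0 t, ENNReal.ofReal (tw s t) * B s t (h s)) := by
    rw [sol_eq φ h ht]
    refine (ostar_add_le (contDiff_conv quarter_pos polyGauss_gauss t hφi).continuous).trans ?_
    rw [mul_add]
    have e1 := h₀ 0 t φ le_rfl ht hφ
    rw [zero_add] at e1
    refine add_le_add e1 ((hduh _ _ polyGauss_gauss _ timeWeight_one C₀ hC₀ h₀).trans ?_)
    gcongr with s
    rw [← ofReal_norm]
    refine ENNReal.ofReal_le_ofReal ?_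
    rw [tw, norm_one]
    have : 0 ≤ Real.sqrt t / Real.sqrt (t - s) := by positivity
    linarith
  have e2 : ∀ i, ENNReal.ofReal (Real.sqrt t) * ostar K t (partialDeriv i (sol φ h t)) ≤
      C₁ i * (R + ∫⁻ s in Ioo 0 t, ENNReal.ofReal (tw s t) * B s t (h s)) := by
    intro i
    rw [partialDeriv_sol hK hφi hh ht i]
    have e1 := h₁ i 0 t φ le_rfl ht hφ
    rw [zero_add] at e1
    have hcc : Continuous fun x => (Real.sqrt t)⁻¹ * conv (partialDeriv i (gauss N)) t φ x :=
      (contDiff_conv quarter_pos (hp i) t hφi).continuous.const_mul _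
    refine (mul_le_mul_right (ostar_add_le hcc) _).trans ?_
    rw [mul_add, mul_add]
    have hst : 0 < Real.sqrt t := Real.sqrt_pos.2 ht
    refine add_le_add ?_ ?_
    · rw [ostar_const_mul, ← mul_assoc, Real.enorm_of_nonneg (by positivity),
        ← ENNReal.ofReal_mul hst.le, mul_inv_cancel₀ hst.ne', ENNReal.ofReal_one, one_mul]
      exact e1
    · refine (mul_le_mul_right (hduh _ _ (hp i) _ timeWeight_inv_sqrt (C₁ i) (hC₁ i) (h₁ i))
        _).trans ?_
      rw [mul_left_comm, ← lintegral_const_mul' _ _ ENNReal.ofReal_ne_top]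
      refine mul_le_mul_right (lintegral_mono fun s => ?_) _
      simp only
      rw [← mul_assoc, Real.enorm_of_nonneg (by positivity), ← ENNReal.ofReal_mul hst.le]
      gcongr
      rw [tw, ← div_eq_mul_inv]
      linarith
  unfold dnorm
  rw [Finset.mul_sum]
  calc _ ≤ _ + ∑ i, _ := add_le_add e0 (Finset.sum_le_sum fun i _ => e2 i)
    _ = _ := by rw [← Finset.sum_mul, add_mul]

/-! ### Early sources and the split at half time. -/

lemma lam_mono {K : ℝ} (hK : 0 ≤ K) {k : ℕ} (hK1 : K ≤ k + 1) {r r' : ℝ} (hr : 0 ≤ r)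
    (h : r ≤ r') : lam K k r ≤ lam K k r' := by
  have h0 : 0 ≤ min 1 r := le_min zero_le_one hr
  unfold lam
  exact mul_le_mul (Real.rpow_le_rpow hr h hK)
    (Real.rpow_le_rpow h0 (min_le_min le_rfl h) (by linarith)) (by positivity)
    (Real.rpow_nonneg (hr.trans h) _)

/-- The functional that controls the long-time contribution of a function with vanishing
moments. -/
def lamMass (K : ℝ) (k : ℕ) (t : ℝ) (f : E N → ℝ) : ℝ≥0∞ :=
  ∫⁻ ξ, ENNReal.ofReal (lam K k (Real.sqrt 2 * ‖ξ‖ / Real.sqrt t)) * ‖f ξ‖ₑ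

/-- For `s` below half the final time, `τ` exceeds half of it, so `√τ` may be replaced by `√(s + τ)
/ √2`. The functional then depends on the final time alone, as dominated convergence in `s`
requires. -/
lemma conv_ostar_le_lamMass {c : ℝ} (hc : 0 < c) {Γ : E N → ℝ} (hΓ : PolyGauss c Γ)
    {K : ℝ} (hK : 0 ≤ K) {k : ℕ} (hkK : (k : ℝ) ≤ K) (hK1 : K ≤ k + 1) :
    ∃ C : ℝ≥0∞, C ≠ ⊤ ∧ ∀ (s τ : ℝ) (f : E N → ℝ), 0 ≤ s → 0 < τ → s < (s + τ) / 2 →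
      HasMoments k f → ZeroMoments k f →
      ostar K (s + τ) (conv Γ τ f) ≤ C * lamMass K k (s + τ) f := by
  obtain ⟨C, hC, hb⟩ := conv_le_of_zeroMoments hc hΓ hK hkK hK1
  refine ⟨C + ENNReal.ofReal (2 ^ ((N : ℝ) / 2)) * C, by finiteness,
    fun s τ f hs hτ hst hf hf0 => ?_⟩
  obtain ⟨h1, h2⟩ := hb τ f hτ hf hf0
  have hL : (∫⁻ ξ, ENNReal.ofReal (lam K k (‖ξ‖ / Real.sqrt τ)) * ‖f ξ‖ₑ) ≤
      lamMass K k (s + τ) f := by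
    refine lintegral_mono fun ξ => mul_le_mul_left (ENNReal.ofReal_le_ofReal
      (lam_mono hK hK1 (by positivity) ?_)) _
    have h3 : Real.sqrt (s + τ) ≤ Real.sqrt 2 * Real.sqrt τ := by
      rw [← Real.sqrt_mul zero_le_two]
      exact Real.sqrt_le_sqrt (by linarith)
    have h4 : 0 < Real.sqrt τ := Real.sqrt_pos.2 hτ
    have h5 : 0 < Real.sqrt (s + τ) := Real.sqrt_pos.2 (by linarith)
    rw [div_le_div_iff₀ h4 h5]
    nlinarith [norm_nonneg ξ]
  rw [add_mul]
  refine add_le_add ?_ ?_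
  · refine le_trans (lintegral_mono fun x => ?_) (h1.trans (mul_le_mul_right hL C))
    exact mul_le_mul_left (ENNReal.ofReal_le_ofReal (omega_le_of_le hK hs hτ x)) _
  · rw [ENNReal.mul_iSup]
    refine iSup_le fun x => ?_
    refine le_trans ?_ ((mul_le_mul_right ((h2 x).trans (mul_le_mul_right hL C)) _).trans
      (mul_assoc _ _ _).ge)
    rw [← mul_assoc, ← ENNReal.ofReal_mul (by positivity), ← Real.mul_rpow zero_le_two hτ.le]
    gcongr
    linarith

lemma dnorm_sol_le_general {K : ℝ} (hK : 0 ≤ K) :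
    ∃ C : ℝ≥0∞, C ≠ ⊤ ∧ ∀ (φ : E N → ℝ) (h : ℝ → E N → ℝ) (t : ℝ), Integrable φ →
      Source K h → 0 < t →
      dnorm K t (sol φ h t) ≤ C * (star K 0 φ +
        ∫⁻ s in Ioo 0 t, ENNReal.ofReal (tw s t) * star K s (h s)) := by
  obtain ⟨C, hC, hb⟩ := dnorm_sol_le (N := N) hK (fun s _ f => star K s f)
    (fun f => AEStronglyMeasurable f) (by
    intro c Γ hc hΓ
    obtain ⟨C, hC, hb⟩ := conv_ostar_le hΓ.continuous (hΓ.rapid hc) hK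
    exact ⟨C, hC, fun s τ f hs hτ hf => hb s τ f hs hτ hf⟩)
  exact ⟨C, hC, fun φ h t hφ hh ht =>
    hb φ h t hφ hφ.aestronglyMeasurable hh hh.meas.ae_aestronglyMeasurable ht⟩

lemma dnorm_sol_le_of_zeroMoments {K : ℝ} (hK : 0 ≤ K) {k : ℕ} (hkK : (k : ℝ) ≤ K)
    (hK1 : K ≤ k + 1) :
    ∃ C : ℝ≥0∞, C ≠ ⊤ ∧ ∀ (φ : E N → ℝ) (h : ℝ → E N → ℝ) (t : ℝ), HasMoments k φ →
      ZeroMoments k φ → Source K h →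
      (∀ᵐ s ∂(volume.restrict (Ioi (0 : ℝ))), ZeroMoments k (h s)) → 0 < t →
      dnorm K t (sol φ h t) ≤ C * (ENNReal.ofReal (ratio K 0 t) * star K 0 φ +
        ∫⁻ s in Ioo 0 t, ENNReal.ofReal (tw s t) * (ENNReal.ofReal (ratio K s t) *
          star K s (h s))) := by
  obtain ⟨C, hC, hb⟩ := dnorm_sol_le (N := N) hK
    (fun s t f => ENNReal.ofReal (ratio K s t) * star K s f) (fun f => HasMoments k f ∧ ZeroMoments k f) (by
    intro c Γ hc hΓ
    obtain ⟨C, hC, hb⟩ := conv_ostar_le_of_zeroMoments hc hΓ hK hkK hK1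
    exact ⟨C, hC, fun s τ f hs hτ hf => (hb s τ f hs hτ hf.1 hf.2).trans (mul_assoc _ _ _).le⟩)
  refine ⟨C, hC, fun φ h t hφ hφ0 hh h0 ht => hb φ h t hφ.integrable ⟨hφ, hφ0⟩ hh ?_ ht⟩
  filter_upwards [hh.ae_hasMoments hkK, h0] with s h1 h2
  exact ⟨h1, h2⟩

/-- Before `t / 2` the functional `lamMass` is kept because its limit is needed; after `t / 2` the
factor `ratio` is good enough. -/
lemma dnorm_sol_le_split {K : ℝ} (hK : 0 ≤ K) {k : ℕ} (hkK : (k : ℝ) ≤ K)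
    (hK1 : K ≤ k + 1) :
    ∃ C : ℝ≥0∞, C ≠ ⊤ ∧ ∀ (φ : E N → ℝ) (h : ℝ → E N → ℝ) (t : ℝ), HasMoments k φ →
      ZeroMoments k φ → Source K h →
      (∀ᵐ s ∂(volume.restrict (Ioi (0 : ℝ))), ZeroMoments k (h s)) → 0 < t →
      dnorm K t (sol φ h t) ≤ C * (lamMass K k t φ +
        ∫⁻ s in Ioo 0 t, ENNReal.ofReal (tw s t) * (if s < t / 2 then lamMass K k t (h s) else
          ENNReal.ofReal (ratio K s t) * star K s (h s))) := by
  obtain ⟨C, hC, hb⟩ := dnorm_sol_le (N := N) hK (fun s t f => if s < t / 2 then lamMass K k t f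
    else ENNReal.ofReal (ratio K s t) * star K s f) (fun f => HasMoments k f ∧ ZeroMoments k f) (by
    intro c Γ hc hΓ
    obtain ⟨C, hC, hb⟩ := conv_ostar_le_of_zeroMoments hc hΓ hK hkK hK1
    obtain ⟨D, hD, hd⟩ := conv_ostar_le_lamMass hc hΓ hK hkK hK1
    refine ⟨C + D, by finiteness, fun s τ f hs hτ hf => ?_⟩
    split_ifs with h1
    · exact (hd s τ f hs hτ h1 hf.1 hf.2).trans (mul_le_mul_left le_add_self _)
    · refine (hb s τ f hs hτ hf.1 hf.2).trans ((mul_assoc _ _ _).le.trans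
        (mul_le_mul_left le_self_add _)))
  refine ⟨C, hC, fun φ h t hφ hφ0 hh h0 ht => ?_⟩
  have := hb φ h t hφ.integrable ⟨hφ, hφ0⟩ hh ?_ ht
  -- The initial function enters at `s = 0`, which lies below `t / 2`.
  · simpa only [half_pos ht, if_true] using this
  · filter_upwards [hh.ae_hasMoments hkK, h0] with s h1 h2
    exact ⟨h1, h2⟩

/-! ### Moments of solutions -/

lemma Source.wnorm_duh_lt_top {K : ℝ} (hK : 0 ≤ K) {h : ℝ → E N → ℝ} (hh : Source K h) (t : ℝ) :
    ∫⁻ s in Ioo 0 t, ostar K t (conv (gauss N) (t - s) (h s)) < ⊤ := by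
  obtain ⟨C, hC, hb⟩ := conv_ostar_le (polyGauss_gauss (N := N)).continuous
    (polyGauss_gauss.rapid quarter_pos) hK
  obtain ⟨D, hD⟩ := hh.bdd
  refine lt_of_le_of_lt (b := ∫⁻ s in Ioo 0 t, C * ENNReal.ofReal (D * s ^ (-(1 / 2) : ℝ)))
    (lintegral_mono_ae ?_) ?_
  · filter_upwards [ae_Ioo_of_ae_Ioi hD t, ae_Ioo_of_ae_Ioi hh.meas.ae_aestronglyMeasurable t,
      ae_restrict_mem measurableSet_Ioo] with s h1 h2 h3
    have := hb s (t - s) (h s) h3.1.le (by linarith [h3.2]) h2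
    rw [add_sub_cancel] at this
    exact this.trans (by gcongr)
  · rw [lintegral_const_mul' _ _ hC]
    exact ENNReal.mul_lt_top hC.lt_top
      ((integrableOn_rpow_neg_half t).const_mul D).lintegral_lt_top

lemma Source.hasMoments_duh {K : ℝ} (hK : 0 ≤ K) {k : ℕ} (hkK : (k : ℝ) ≤ K) {h : ℝ → E N → ℝ}
    (hh : Source K h) {t : ℝ} (ht : 0 < t) :
    HasMoments k (duh (gauss N) (fun _ => 1) h t) := by
  refine hasMoments_of_star hkK ht.le
    (hh.continuous_duh hK quarter_pos polyGauss_gauss timeWeight_one t).aestronglyMeasurable ?_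
  refine (star_le_ostar _ _ _).trans_lt ((duh_ostar_le polyGauss_gauss.continuous measurable_const
    hh.meas K t).trans_lt ?_)
  simpa using hh.wnorm_duh_lt_top hK t

/-- Fubini reduces the moments of the Duhamel integral to those of `e^{(t-s)Δ} h(s)`, which vanish.
-/
lemma Source.zeroMoments_duh {K : ℝ} (hK : 0 ≤ K) {k : ℕ} (hkK : (k : ℝ) ≤ K) {h : ℝ → E N → ℝ}
    (hh : Source K h) (h0 : ∀ᵐ s ∂(volume.restrict (Ioi (0 : ℝ))), ZeroMoments k (h s)) {t : ℝ}
    (ht : 0 < t) : ZeroMoments k (duh (gauss N) (fun _ => 1) h t) := by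
  intro α hα
  have hαK : (deg α : ℝ) ≤ K := le_trans (by exact_mod_cast hα) hkK
  obtain ⟨g, hg, hgh⟩ := hh.meas.exists_measurable
  have hc : Continuous (gauss N) := polyGauss_gauss.continuous
  have hm : Measurable fun p : E N × ℝ =>
      monomial α p.1 * (1 * conv (gauss N) (t - p.2) (g p.2) p.1) :=
    ((continuous_monomial α).measurable.comp measurable_fst).mul
      ((measurable_conv_time hc measurable_const hg t (w := fun _ => 1)).comp measurable_swap)
  have hfin : ∫⁻ s in Ioo 0 t, ∫⁻ x, ‖monomial α x * (1 * conv (gauss N) (t - s) (g s) x)‖ₑ < ⊤ := by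
    refine lt_of_le_of_lt (b := ∫⁻ s in Ioo 0 t, ENNReal.ofReal (Real.sqrt (1 + t) ^ deg α) *
      ostar K t (conv (gauss N) (t - s) (h s))) (lintegral_mono_ae ?_) ?_
    · filter_upwards [ae_Ioo_of_ae_Ioi hgh t] with s hs
      simp only [one_mul]
      rw [conv_congr hs]
      refine (lintegral_monomial_le ht.le hαK _).trans ?_
      gcongr
      exact le_self_add
    · rw [lintegral_const_mul' _ _ ENNReal.ofReal_ne_top]
      exact ENNReal.mul_lt_top ENNReal.ofReal_lt_top (hh.wnorm_duh_lt_top hK t)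
  have hint : Integrable (Function.uncurry fun (x : E N) (s : ℝ) =>
      monomial α x * (1 * conv (gauss N) (t - s) (g s) x))
      ((volume : Measure (E N)).prod (volume.restrict (Ioo 0 t))) := by
    refine ⟨hm.aestronglyMeasurable, ?_⟩
    rw [HasFiniteIntegral]
    exact (lintegral_prod_symm' _ hm.enorm).le.trans_lt hfin
  rw [duh_congr hgh]
  unfold duh
  simp only [← integral_const_mul]
  rw [integral_integral_swap hint]
  refine integral_eq_zero_of_ae ?_
  filter_upwards [ae_Ioo_of_ae_Ioi hgh t, ae_Ioo_of_ae_Ioi h0 t,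
    ae_Ioo_of_ae_Ioi (hh.ae_hasMoments hkK) t, ae_restrict_mem measurableSet_Ioo] with s h1 h2 h3 h4
  have := ZeroMoments.heat h3 h2 (τ := t - s) (by linarith [h4.2]) α hα
  rw [heat_eq_conv (by linarith [h4.2])] at this
  simp only [one_mul, conv_congr h1.symm, Pi.zero_apply]
  exact this

lemma hasMoments_conv_gauss {K : ℝ} (hK : 0 ≤ K) {k : ℕ} (hkK : (k : ℝ) ≤ K) {φ : E N → ℝ}
    (hφ : AEStronglyMeasurable φ) (hφs : star K 0 φ < ⊤) {t : ℝ} (ht : 0 < t) :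
    HasMoments k (conv (gauss N) t φ) := by
  obtain ⟨C, hC, hb⟩ := conv_ostar_le (polyGauss_gauss (N := N)).continuous
    (polyGauss_gauss.rapid quarter_pos) hK
  have h1 := hb 0 t φ le_rfl ht hφ
  rw [zero_add] at h1
  have hi : Integrable φ := (hasMoments_of_star hkK le_rfl hφ hφs).integrable
  exact hasMoments_of_star hkK ht.le
    (contDiff_conv quarter_pos polyGauss_gauss t hi).continuous.aestronglyMeasurable
    ((star_le_ostar _ _ _).trans_lt (h1.trans_lt (ENNReal.mul_lt_top hC.lt_top hφs)))

lemma hasMoments_sol {K : ℝ} (hK : 0 ≤ K) {k : ℕ} (hkK : (k : ℝ) ≤ K) {φ : E N → ℝ}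
    (hφ : AEStronglyMeasurable φ) (hφs : star K 0 φ < ⊤) {h : ℝ → E N → ℝ} (hh : Source K h) {t : ℝ}
    (ht : 0 < t) : HasMoments k (sol φ h t) := by
  rw [sol_eq φ h ht]
  exact (hasMoments_conv_gauss hK hkK hφ hφs ht).add (hh.hasMoments_duh hK hkK ht)

lemma zeroMoments_sol {K : ℝ} (hK : 0 ≤ K) {k : ℕ} (hkK : (k : ℝ) ≤ K) {φ : E N → ℝ}
    (hφ : AEStronglyMeasurable φ) (hφs : star K 0 φ < ⊤) (hφ0 : ZeroMoments k φ)
    {h : ℝ → E N → ℝ} (hh : Source K h)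
    (h0 : ∀ᵐ s ∂(volume.restrict (Ioi (0 : ℝ))), ZeroMoments k (h s)) {t : ℝ}
    (ht : 0 < t) : ZeroMoments k (sol φ h t) := by
  have h1 := ZeroMoments.heat (hasMoments_of_star hkK le_rfl hφ hφs) hφ0 ht
  rw [heat_eq_conv ht] at h1
  rw [sol_eq φ h ht]
  exact ZeroMoments.add (hasMoments_conv_gauss hK hkK hφ hφs ht) (hh.hasMoments_duh hK hkK ht)
    h1 (hh.zeroMoments_duh hK hkK h0 ht)

/-- `f` is split at time `s` and the semigroup carries its part along `g_α(s)` to `g_α(s + τ)`. -/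
lemma conv_gauss_eq_add {k : ℕ} {f : E N → ℝ} (hf : HasMoments k f) {s τ : ℝ} (hs : 0 ≤ s)
    (hτ : 0 < τ) (x : E N) : conv (gauss N) τ f x = conv (gauss N) τ (proj k s f) x +
      ∑ α ∈ multiIndices N k, moment f s α * gKernel α (s + τ) x := by
  have hb := boundedC1_dil quarter_pos (polyGauss_gauss (N := N)) τ
  have h1 := hb.integrable_mul (hasMoments_proj hf hs).integrable x
  have h2 : ∀ α, Integrable fun ξ => moment f s α * (dil (gauss N) τ (x - ξ) * gKernel α s ξ) :=
    fun α => (hb.integrable_mul ((rapid_gKernel α hs).integrable (continuous_gKernel α s)) x).const_mul _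
  have h3 : ∀ ξ, dil (gauss N) τ (x - ξ) * f ξ = dil (gauss N) τ (x - ξ) * proj k s f ξ +
      ∑ α ∈ multiIndices N k, moment f s α * (dil (gauss N) τ (x - ξ) * gKernel α s ξ) := by
    intro ξ
    simp only [mul_left_comm (moment f s _), ← Finset.mul_sum]
    rw [← mul_add, proj, momentExpansion, sub_add_cancel]
  unfold conv
  simp_rw [h3]
  rw [integral_add h1 (integrable_finsetSum _ fun α _ => h2 α),
    integral_finsetSum _ fun α _ => h2 α]
  congr 1
  refine Finset.sum_congr rfl fun α _ => ?_
  rw [integral_const_mul, ← heat_gKernel α hs hτ, heat_eq_conv hτ]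
  rfl

/-- The coefficients of the expansion of a mild solution. -/
def coeff (φ : E N → ℝ) (h : ℝ → E N → ℝ) (t : ℝ) (α : Fin N → ℕ) : ℝ :=
  moment φ 0 α + ∫ s in Ioo 0 t, moment (h s) s α

/-- Sources of all times `s` contribute to the same kernels `g_α(t)`, so their coefficients may be
integrated in time. What is left is a mild solution whose data have vanishing moments. -/
lemma sol_eq_add {K : ℝ} (hK : 0 ≤ K) {k : ℕ} (hkK : (k : ℝ) ≤ K) {φ : E N → ℝ}
    (hφ : HasMoments k φ) {h : ℝ → E N → ℝ} (hh : Source K h) {t : ℝ} (ht : 0 < t) (x : E N) :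
    sol φ h t x = sol (proj k 0 φ) (fun s => proj k s (h s)) t x +
      ∑ α ∈ multiIndices N k, coeff φ h t α * gKernel α t x := by
  have hc : Continuous (gauss N) := polyGauss_gauss.continuous
  have h1 := conv_gauss_eq_add hφ le_rfl ht x
  rw [zero_add] at h1
  have hm : ∀ α ∈ multiIndices N k, IntegrableOn (fun s => moment (h s) s α * gKernel α t x)
      (Ioo 0 t) := fun α hα =>
    (hh.integrableOn_moment hkK (mem_multiIndices.1 hα) t).mul_const _
  have h2 : duh (gauss N) (fun _ => 1) h t x =
      duh (gauss N) (fun _ => 1) (fun s => proj k s (h s)) t x +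
        ∑ α ∈ multiIndices N k, (∫ s in Ioo 0 t, moment (h s) s α) * gKernel α t x := by
    unfold duh
    simp only [← integral_mul_const]
    rw [← integral_finsetSum _ hm, ← integral_add ((hh.proj hkK).integrableOn_duh hK hc
      (polyGauss_gauss.rapid quarter_pos) timeWeight_one t x) (integrable_finsetSum _ hm)]
    refine integral_congr_ae ?_
    filter_upwards [ae_Ioo_of_ae_Ioi (hh.ae_hasMoments hkK) t, ae_restrict_mem measurableSet_Ioo]
      with s h3 h4
    have := conv_gauss_eq_add h3 h4.1.le (τ := t - s) (by linarith [h4.2]) x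
    rw [add_sub_cancel] at this
    simp only [one_mul]
    exact this
  rw [sol_eq φ h ht, sol_eq _ _ ht]
  simp only
  rw [h1, h2]
  simp only [coeff, add_mul, Finset.sum_add_distrib]
  ring

/-! ### Rates -/

/-- The growth rate of `∫₀ᵗ (1 + s)^{-1-q} ds`. -/
def growth (q t : ℝ) : ℝ :=
  if 0 < q then 1 else if q = 0 then Real.log (2 + t) else (1 + t) ^ (-q)

/-- The model for the decay of source terms. -/
def beta (q s : ℝ) : ℝ := s ^ (-(1 / 2) : ℝ) * (1 + s) ^ (-(1 / 2) - q)

lemma beta_nonneg (q : ℝ) {s : ℝ} (hs : 0 < s) : 0 ≤ beta q s := by unfold beta; positivity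

lemma growth_of_pos {q : ℝ} (hq : 0 < q) (t : ℝ) : growth q t = 1 := by rw [growth, if_pos hq]

/-- The `1/2` is a lower bound of `log 2`; it lets bounded terms be absorbed into `growth`. -/
lemma half_le_growth (q : ℝ) {t : ℝ} (ht : 0 < t) : 1 / 2 ≤ growth q t := by
  unfold growth
  split_ifs with h1 h2
  · norm_num
  · exact le_trans (by linarith [Real.log_two_gt_d9]) (Real.log_le_log two_pos (by linarith : 2 ≤ 2 + t))
  · exact le_trans (by norm_num) (Real.one_le_rpow (by linarith) (by push Not at h1; linarith))

lemma rpow_neg_le_growth (q : ℝ) {t : ℝ} (ht : 0 < t) : (1 + t) ^ (-q) ≤ 2 * growth q t := by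
  by_cases h1 : 0 < q
  · have : (1 + t) ^ (-q) ≤ 1 := Real.rpow_le_one_of_one_le_of_nonpos (by linarith) (by linarith)
    rw [growth_of_pos h1]
    linarith
  · by_cases h2 : q = 0
    · have := half_le_growth q ht
      rw [h2, neg_zero, Real.rpow_zero]
      rw [h2] at this
      linarith
    · rw [growth, if_neg h1, if_neg h2]
      have : 0 ≤ (1 + t) ^ (-q) := by positivity
      linarith

/-- Separates the integrable singularity at `0` from the tail `(1 + s)^{-1-q}`. -/
lemma beta_le (q : ℝ) {s : ℝ} (hs : 0 < s) :
    beta q s ≤ 2 ^ |q| * (Ioo (0 : ℝ) 1).indicator (fun s => s ^ (-(1 / 2) : ℝ)) s +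
      2 * (1 + s) ^ (-1 - q) := by
  unfold beta
  have h1s : (0 : ℝ) < 1 + s := by linarith
  have e1 : 0 ≤ 2 * (1 + s) ^ (-1 - q) := by positivity
  by_cases h : s < 1
  · rw [indicator_of_mem (show s ∈ Ioo (0 : ℝ) 1 from ⟨hs, h⟩)]
    have h2 : (1 + s) ^ (-(1 / 2) - q) ≤ 2 ^ |q| := by
      calc (1 + s) ^ (-(1 / 2) - q) ≤ (1 + s) ^ |q| :=
            Real.rpow_le_rpow_of_exponent_le (by linarith) (by linarith [neg_le_abs q])
        _ ≤ 2 ^ |q| := Real.rpow_le_rpow h1s.le (by linarith) (abs_nonneg q)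
    have h3 : 0 ≤ s ^ (-(1 / 2) : ℝ) := by positivity
    nlinarith [mul_le_mul_of_nonneg_left h2 h3]
  · rw [indicator_of_notMem (fun h' => h h'.2), mul_zero, zero_add]
    push Not at h
    have h2 : s ^ (-(1 / 2) : ℝ) ≤ 2 * (1 + s) ^ (-(1 / 2) : ℝ) := by
      calc s ^ (-(1 / 2) : ℝ) ≤ ((1 + s) / 2) ^ (-(1 / 2) : ℝ) :=
            Real.rpow_le_rpow_of_nonpos (by linarith) (by linarith) (by norm_num)
        _ = 2 ^ (1 / 2 : ℝ) * (1 + s) ^ (-(1 / 2) : ℝ) := by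
            rw [Real.div_rpow h1s.le zero_le_two, Real.rpow_neg zero_le_two, div_inv_eq_mul, mul_comm]
        _ ≤ 2 * (1 + s) ^ (-(1 / 2) : ℝ) := by
            gcongr
            exact (Real.rpow_le_rpow_of_exponent_le one_le_two (by norm_num)).trans
              (Real.rpow_one 2).le
    calc s ^ (-(1 / 2) : ℝ) * (1 + s) ^ (-(1 / 2) - q)
        ≤ 2 * (1 + s) ^ (-(1 / 2) : ℝ) * (1 + s) ^ (-(1 / 2) - q) := by gcongr
      _ = 2 * (1 + s) ^ (-1 - q) := by
          rw [mul_assoc, ← Real.rpow_add h1s]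
          ring_nf

lemma integral_one_add_rpow_le (q : ℝ) :
    ∃ C : ℝ, 0 ≤ C ∧ ∀ t : ℝ, 0 < t →
      ∫⁻ s in Ioo 0 t, ENNReal.ofReal ((1 + s) ^ (-1 - q)) ≤ ENNReal.ofReal (C * growth q t) := by
  have key : ∀ t : ℝ, 0 < t → ∫⁻ s in Ioo 0 t, ENNReal.ofReal ((1 + s) ^ (-1 - q)) =
      ENNReal.ofReal (∫ s in (1 : ℝ)..(1 + t), s ^ (-1 - q)) := by
    intro t ht
    have hc : ContinuousOn (fun s : ℝ => (1 + s) ^ (-1 - q)) (Icc 0 t) := fun s hs =>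
      ((continuousAt_const.add continuousAt_id).rpow_const
        (Or.inl (add_pos_of_pos_of_nonneg one_pos hs.1).ne')).continuousWithinAt
    rw [← ofReal_integral_eq_lintegral_ofReal]
    · congr 1
      rw [← integral_Ioc_eq_integral_Ioo, ← intervalIntegral.integral_of_le ht.le,
        intervalIntegral.integral_comp_add_left (fun s => s ^ (-1 - q)), add_zero]
    · exact (hc.integrableOn_compact isCompact_Icc).mono_set Ioo_subset_Icc_self
    · filter_upwards [ae_restrict_mem measurableSet_Ioo] with s hs
      have : (0 : ℝ) < 1 + s := by linarith [hs.1]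
      simp only [Pi.zero_apply]
      positivity
  have h0 : ∀ t : ℝ, 0 < t → (0 : ℝ) ∉ uIcc 1 (1 + t) := fun t ht h => by
    rw [uIcc_of_le (by linarith)] at h
    linarith [h.1]
  rcases lt_trichotomy q 0 with hq | hq | hq
  · refine ⟨(-q)⁻¹, by rw [inv_nonneg]; linarith, fun t ht => ?_⟩
    rw [key t ht, growth, if_neg (by linarith), if_neg hq.ne]
    refine ENNReal.ofReal_le_ofReal ?_
    rw [integral_rpow (Or.inl (by linarith)), Real.one_rpow, inv_mul_eq_div]
    have e : -1 - q + 1 = -q := by ring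
    rw [e]
    exact div_le_div_of_nonneg_right (by linarith) (by linarith)
  · refine ⟨1, zero_le_one, fun t ht => ?_⟩
    rw [key t ht, growth, if_neg (by linarith), if_pos hq, one_mul, hq]
    refine ENNReal.ofReal_le_ofReal ?_
    have e : ∀ s : ℝ, s ^ (-1 - 0 : ℝ) = s⁻¹ := fun s => by rw [sub_zero, Real.rpow_neg_one]
    simp only [e]
    rw [integral_inv (h0 t ht), div_one]
    exact Real.log_le_log (by linarith) (by linarith)
  · refine ⟨q⁻¹, by positivity, fun t ht => ?_⟩
    rw [key t ht, growth_of_pos hq, mul_one]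
    refine ENNReal.ofReal_le_ofReal ?_
    rw [integral_rpow (Or.inr ⟨by linarith, h0 t ht⟩), Real.one_rpow]
    have e : -1 - q + 1 = -q := by ring
    rw [e, div_neg, ← neg_div, neg_sub, ← one_div]
    have : 0 ≤ (1 + t) ^ (-q) := by positivity
    exact div_le_div_of_nonneg_right (by linarith) hq.le

lemma lintegral_beta_le (q : ℝ) :
    ∃ C : ℝ, 0 ≤ C ∧ ∀ t : ℝ, 0 < t →
      ∫⁻ s in Ioo 0 t, ENNReal.ofReal (beta q s) ≤ ENNReal.ofReal (C * growth q t) := by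
  obtain ⟨C, hC, hb⟩ := integral_one_add_rpow_le q
  have hI := integrableOn_rpow_neg_half 1
  set I := ∫ s in Ioo (0 : ℝ) 1, s ^ (-(1 / 2) : ℝ)
  have hI0 : 0 ≤ I := setIntegral_nonneg measurableSet_Ioo fun s hs =>
    Real.rpow_nonneg hs.1.le _
  refine ⟨2 * (2 ^ |q| * I) + 2 * C, by positivity, fun t ht => ?_⟩
  have hg := half_le_growth q ht
  set ι := (Ioo (0 : ℝ) 1).indicator fun s : ℝ => s ^ (-(1 / 2) : ℝ)
  have hι : Measurable ι := (measurable_id.pow_const _).indicator measurableSet_Ioo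
  calc ∫⁻ s in Ioo 0 t, ENNReal.ofReal (beta q s)
      ≤ ∫⁻ s in Ioo 0 t, (ENNReal.ofReal (2 ^ |q|) * ENNReal.ofReal (ι s) +
          ENNReal.ofReal 2 * ENNReal.ofReal ((1 + s) ^ (-1 - q))) := by
        refine setLIntegral_mono' measurableSet_Ioo fun s hs => ?_
        have h1 : (0 : ℝ) ≤ ι s := indicator_nonneg (fun s hs => Real.rpow_nonneg hs.1.le _) s
        have h2 : (0 : ℝ) < 1 + s := by linarith [hs.1]
        rw [← ENNReal.ofReal_mul (by positivity), ← ENNReal.ofReal_mul zero_le_two,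
          ← ENNReal.ofReal_add (by positivity) (by positivity)]
        exact ENNReal.ofReal_le_ofReal (beta_le q hs.1)
    _ = ENNReal.ofReal (2 ^ |q|) * (∫⁻ s in Ioo 0 t, ENNReal.ofReal (ι s)) +
          ENNReal.ofReal 2 * ∫⁻ s in Ioo 0 t, ENNReal.ofReal ((1 + s) ^ (-1 - q)) := by
        rw [lintegral_add_left (hι.ennreal_ofReal.const_mul _),
          lintegral_const_mul' _ _ ENNReal.ofReal_ne_top,
          lintegral_const_mul' _ _ ENNReal.ofReal_ne_top]
    _ ≤ ENNReal.ofReal (2 ^ |q|) * ENNReal.ofReal I +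
          ENNReal.ofReal 2 * ENNReal.ofReal (C * growth q t) := by
        gcongr
        · refine (setLIntegral_le_lintegral _ _).trans ?_
          rw [show (fun s => ENNReal.ofReal (ι s)) = (Ioo (0 : ℝ) 1).indicator
            (fun s => ENNReal.ofReal (s ^ (-(1 / 2) : ℝ))) from
            (indicator_comp_of_zero ENNReal.ofReal_zero).symm, lintegral_indicator measurableSet_Ioo,
            ofReal_integral_eq_lintegral_ofReal hI]
          filter_upwards [ae_restrict_mem measurableSet_Ioo] with s hs
          exact Real.rpow_nonneg hs.1.le _
        · exact hb t ht
    _ ≤ _ := by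
        rw [← ENNReal.ofReal_mul (by positivity), ← ENNReal.ofReal_mul zero_le_two,
          ← ENNReal.ofReal_add (by positivity) (by positivity)]
        refine ENNReal.ofReal_le_ofReal ?_
        have : 0 ≤ 2 ^ |q| * I := by positivity
        nlinarith

lemma lintegral_beta_Ioi_lt_top {q : ℝ} (hq : 0 < q) :
    ∫⁻ s in Ioi (0 : ℝ), ENNReal.ofReal (beta q s) < ⊤ := by
  obtain ⟨C, hC, hb⟩ := lintegral_beta_le q
  have hU : Ioi (0 : ℝ) = ⋃ n : ℕ, Ioo (0 : ℝ) (n + 1) := by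
    ext s
    simp only [mem_Ioi, mem_iUnion, mem_Ioo]
    refine ⟨fun h => ?_, fun ⟨n, h⟩ => h.1⟩
    obtain ⟨n, hn⟩ := exists_nat_gt s
    exact ⟨n, h, by linarith⟩
  refine lt_of_le_of_lt (b := ENNReal.ofReal C) ?_ ENNReal.ofReal_lt_top
  rw [hU, setLIntegral_iUnion_of_directed]
  · refine iSup_le fun n => (hb _ (by positivity)).trans ?_
    rw [growth_of_pos hq, mul_one]
  · exact Monotone.directed_le fun m n h => Ioo_subset_Ioo_right (by simpa using h)

lemma tw_le {s t : ℝ} (ht : 0 < t) (h : s ≤ t / 2) : tw s t ≤ 3 := by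
  unfold tw
  have h1 : Real.sqrt t ≤ 2 * Real.sqrt (t - s) := by
    rw [show (2 : ℝ) = Real.sqrt 4 by rw [show (4 : ℝ) = 2 ^ 2 by norm_num, Real.sqrt_sq zero_le_two],
      ← Real.sqrt_mul (by norm_num)]
    exact Real.sqrt_le_sqrt (by linarith)
  have h2 : 0 < Real.sqrt (t - s) := Real.sqrt_pos.2 (by linarith)
  have := (div_le_iff₀ h2).2 h1
  linarith

lemma beta_le_of_half_le (q : ℝ) {s t : ℝ} (ht : 0 < t) (h : t / 2 ≤ s) (hs : s ≤ t) :
    beta q s ≤ 2 * 2 ^ |(-(1 / 2) - q)| * (t ^ (-(1 / 2) : ℝ) * (1 + t) ^ (-(1 / 2) - q)) := by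
  unfold beta
  have h0 : 0 < s := by linarith
  have h1 : s ^ (-(1 / 2) : ℝ) ≤ 2 * t ^ (-(1 / 2) : ℝ) := by
    calc s ^ (-(1 / 2) : ℝ) ≤ (t / 2) ^ (-(1 / 2) : ℝ) :=
          Real.rpow_le_rpow_of_nonpos (by linarith) h (by norm_num)
      _ = 2 ^ (1 / 2 : ℝ) * t ^ (-(1 / 2) : ℝ) := by
          rw [Real.div_rpow ht.le zero_le_two, Real.rpow_neg zero_le_two, div_inv_eq_mul, mul_comm]
      _ ≤ _ := by
          gcongr
          exact (Real.rpow_le_rpow_of_exponent_le one_le_two (by norm_num)).trans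
            (Real.rpow_one 2).le
  have h2 : ∀ p : ℝ, (1 + s) ^ p ≤ 2 ^ |p| * (1 + t) ^ p := by
    intro p
    rcases le_total 0 p with hp | hp
    · rw [← one_mul ((1 + s) ^ p)]
      refine mul_le_mul (Real.one_le_rpow one_le_two (abs_nonneg p))
        (Real.rpow_le_rpow (by linarith) (by linarith) hp) (by positivity) (by positivity)
    · calc (1 + s) ^ p ≤ ((1 + t) / 2) ^ p :=
            Real.rpow_le_rpow_of_nonpos (by linarith) (by linarith) hp
        _ = 2 ^ |p| * (1 + t) ^ p := by
            rw [Real.div_rpow (by linarith) zero_le_two, abs_of_nonpos hp,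
              Real.rpow_neg zero_le_two, div_eq_inv_mul]
  calc _ ≤ 2 * t ^ (-(1 / 2) : ℝ) * (2 ^ |(-(1 / 2) - q)| * (1 + t) ^ (-(1 / 2) - q)) :=
        mul_le_mul h1 (h2 _) (by positivity) (by positivity)
    _ = _ := by ring

lemma lintegral_tw_le {t : ℝ} (ht : 0 < t) :
    ∫⁻ s in Ioo 0 t, ENNReal.ofReal (tw s t) ≤ ENNReal.ofReal (3 * t) := by
  have hi : IntegrableOn (fun s : ℝ => (t - s) ^ (-(1 / 2) : ℝ)) (Ioo 0 t) :=
    integrableOn_sub_rpow_neg_half t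
  have e : ∀ s ∈ Ioo (0 : ℝ) t, tw s t = 1 + Real.sqrt t * (t - s) ^ (-(1 / 2) : ℝ) := by
    intro s hs
    rw [tw, Real.rpow_neg (by linarith [hs.2]), ← Real.sqrt_eq_rpow, div_eq_mul_inv]
  have hi1 : IntegrableOn (fun _ : ℝ => (1 : ℝ)) (Ioo 0 t) := integrableOn_const (by simp)
  have hi2 : IntegrableOn (fun s : ℝ => 1 + Real.sqrt t * (t - s) ^ (-(1 / 2) : ℝ)) (Ioo 0 t) :=
    hi1.add (hi.const_mul _)
  rw [setLIntegral_congr_fun measurableSet_Ioo (g := fun s => ENNReal.ofReal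
    (1 + Real.sqrt t * (t - s) ^ (-(1 / 2) : ℝ))) fun s hs => by simp only [e s hs],
    ← ofReal_integral_eq_lintegral_ofReal hi2]
  · refine ENNReal.ofReal_le_ofReal (le_of_eq ?_)
    rw [integral_add hi1 (hi.const_mul _), integral_const_mul,
      ← integral_Ioc_eq_integral_Ioo (f := fun s : ℝ => (t - s) ^ (-(1 / 2) : ℝ)),
      ← intervalIntegral.integral_of_le ht.le,
      intervalIntegral.integral_comp_sub_left (fun s => s ^ (-(1 / 2) : ℝ)), sub_self, sub_zero,
      integral_rpow (Or.inl (by norm_num))]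
    have : Real.sqrt t * Real.sqrt t = t := Real.mul_self_sqrt ht.le
    have e2 : t ^ (-(1 / 2) + 1 : ℝ) = Real.sqrt t := by rw [Real.sqrt_eq_rpow]; norm_num
    rw [e2, Real.zero_rpow (by norm_num)]
    simp only [integral_const, measureReal_restrict_apply_univ, Real.volume_real_Ioo, smul_eq_mul]
    rw [sub_zero, max_eq_left ht.le]
    -- `∫₀ᵗ (1 + √t (t - s)^{-1/2}) ds = t + 2 √t √t = 3 t`.
    linear_combination 2 * this
  · filter_upwards [ae_restrict_mem measurableSet_Ioo] with s hs
    simp only [Pi.zero_apply]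
    have := hs.2
    have : 0 ≤ (t - s) ^ (-(1 / 2) : ℝ) := Real.rpow_nonneg (by linarith) _
    positivity

/-- On `[t/2, t)` the function `beta q` is at most a constant times its value at `t`, and `tw` has
integral at most `3 t`; the singularity at `s = t` is thus harmless. -/
lemma lintegral_tw_beta_half_le (q : ℝ) :
    ∃ C : ℝ, 0 ≤ C ∧ ∀ t : ℝ, 0 < t →
      ∫⁻ s in Ico (t / 2) t, ENNReal.ofReal (tw s t) * ENNReal.ofReal (beta q s) ≤
        ENNReal.ofReal (C * (1 + t) ^ (-q)) := by
  set D : ℝ := 2 * 2 ^ |(-(1 / 2) - q)|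
  have hD : 0 ≤ D := by positivity
  refine ⟨D * 3, by positivity, fun t ht => ?_⟩
  set R := D * (t ^ (-(1 / 2) : ℝ) * (1 + t) ^ (-(1 / 2) - q))
  calc _ ≤ ∫⁻ s in Ico (t / 2) t, ENNReal.ofReal R * ENNReal.ofReal (tw s t) := by
        refine setLIntegral_mono' measurableSet_Ico fun s hs => ?_
        rw [mul_comm]
        gcongr
        exact beta_le_of_half_le q ht hs.1 hs.2.le
    _ ≤ ENNReal.ofReal R * ENNReal.ofReal (3 * t) := by
        rw [lintegral_const_mul' _ _ ENNReal.ofReal_ne_top]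
        gcongr
        exact (lintegral_mono_set (Ico_subset_Ioo_left (half_pos ht))).trans (lintegral_tw_le ht)
    _ ≤ _ := by
        rw [← ENNReal.ofReal_mul (by positivity)]
        refine ENNReal.ofReal_le_ofReal ?_
        have e1 : t ^ (-(1 / 2) : ℝ) * t = t ^ (1 / 2 : ℝ) := by
          nth_rewrite 2 [← Real.rpow_one t]
          rw [← Real.rpow_add ht]; norm_num
        have e2 : t ^ (1 / 2 : ℝ) * (1 + t) ^ (-(1 / 2) - q) ≤ (1 + t) ^ (-q) := by
          calc _ ≤ (1 + t) ^ (1 / 2 : ℝ) * (1 + t) ^ (-(1 / 2) - q) := by gcongr; linarith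
            _ = (1 + t) ^ (-q) := by rw [← Real.rpow_add (by linarith)]; ring_nf
        calc R * (3 * t) = D * 3 * ((t ^ (-(1 / 2) : ℝ) * t) * (1 + t) ^ (-(1 / 2) - q)) := by
              simp only [R]; ring
          _ ≤ _ := by rw [e1]; gcongr

lemma lintegral_tw_beta_le (q : ℝ) :
    ∃ C : ℝ, 0 ≤ C ∧ ∀ t : ℝ, 0 < t →
      ∫⁻ s in Ioo 0 t, ENNReal.ofReal (tw s t) * ENNReal.ofReal (beta q s) ≤
        ENNReal.ofReal (C * growth q t) := by
  obtain ⟨C, hC, hc⟩ := lintegral_beta_le q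
  obtain ⟨D, hD, hd⟩ := lintegral_tw_beta_half_le q
  refine ⟨3 * C + 2 * D, by positivity, fun t ht => ?_⟩
  have hg := half_le_growth q ht
  have hU : Ioo 0 t = Ioo 0 (t / 2) ∪ Ico (t / 2) t :=
    (Ioo_union_Ico_eq_Ioo (by linarith) (by linarith)).symm
  rw [hU]
  refine (lintegral_union_le _ _ _).trans ((add_le_add (b := ENNReal.ofReal (3 * (C * growth q t)))
    ?_ (hd t ht)).trans ?_)
  · rw [ENNReal.ofReal_mul (by norm_num : (0 : ℝ) ≤ 3)]
    calc _ ≤ ∫⁻ s in Ioo 0 (t / 2), ENNReal.ofReal 3 * ENNReal.ofReal (beta q s) := by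
          refine setLIntegral_mono' measurableSet_Ioo fun s hs => ?_
          gcongr
          exact tw_le ht hs.2.le
      _ ≤ _ := by
          rw [lintegral_const_mul' _ _ ENNReal.ofReal_ne_top]
          gcongr
          exact (lintegral_mono_set (Ioo_subset_Ioo_right (by linarith))).trans (hc t ht)
  · have := rpow_neg_le_growth q ht
    rw [← ENNReal.ofReal_add (by positivity) (by positivity)]
    refine ENNReal.ofReal_le_ofReal ?_
    nlinarith

/-! ### Decay rates of source terms. -/

/-- The source term `h` decays like `beta p` in the weighted norm. -/
def HasRate (K p : ℝ) (h : ℝ → E N → ℝ) : Prop :=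
  ∃ c : ℝ, 0 ≤ c ∧ ∀ᵐ s ∂(volume.restrict (Ioi (0 : ℝ))),
    star K s (h s) ≤ ENNReal.ofReal (c * beta p s)

lemma HasRate.source {K p : ℝ} (hp : 0 < p) {h : ℝ → E N → ℝ} (hh : HasRate K p h)
    (hm : JointMeas h) : Source K h := by
  obtain ⟨c, hc, hb⟩ := hh
  refine ⟨hm, c, ?_⟩
  filter_upwards [hb, ae_restrict_mem measurableSet_Ioi] with s h1 h2
  refine h1.trans (ENNReal.ofReal_le_ofReal (mul_le_mul_of_nonneg_left ?_ hc))
  have h3 : (0 : ℝ) < s := h2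
  exact mul_le_of_le_one_right (by positivity)
    (Real.rpow_le_one_of_one_le_of_nonpos (by linarith) (by linarith))

lemma HasRate.proj {K p : ℝ} {k : ℕ} (hkK : (k : ℝ) ≤ K) {h : ℝ → E N → ℝ} (hh : HasRate K p h)
    (hm : JointMeas h) : HasRate K p fun s => proj k s (h s) := by
  obtain ⟨c, hc, hb⟩ := hh
  obtain ⟨D, hD, hd⟩ := star_proj_le (N := N) hkK
  refine ⟨D.toReal * c, by positivity, ?_⟩
  filter_upwards [hb, hm.ae_aestronglyMeasurable, ae_restrict_mem measurableSet_Ioi] with s h1 h2 h3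
  refine (hd s _ (le_of_lt h3) h2).trans ((mul_le_mul_right h1 D).trans (le_of_eq ?_))
  rw [mul_assoc, ENNReal.ofReal_mul ENNReal.toReal_nonneg, ENNReal.ofReal_toReal hD]

lemma dnorm_sol_le_of_hasRate {K : ℝ} (hK : 0 ≤ K) {φ : E N → ℝ} (hφ : Integrable φ)
    (hφs : star K 0 φ < ⊤) {h : ℝ → E N → ℝ} (hm : JointMeas h) {p : ℝ} (hp : 0 < p)
    (hh : HasRate K p h) :
    ∃ C : ℝ, 0 ≤ C ∧ ∀ t : ℝ, 0 < t → dnorm K t (sol φ h t) ≤ ENNReal.ofReal C := by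
  obtain ⟨C, hC, hb⟩ := dnorm_sol_le_general (N := N) hK
  obtain ⟨D, hD, hd⟩ := lintegral_tw_beta_le p
  have hS := hh.source hp hm
  obtain ⟨c, hc, hr⟩ := hh
  refine ⟨(C * (star K 0 φ + ENNReal.ofReal (c * D))).toReal, ENNReal.toReal_nonneg,
    fun t ht => ?_⟩
  rw [ENNReal.ofReal_toReal (by finiteness)]
  refine (hb φ h t hφ hS ht).trans (mul_le_mul_right (add_le_add le_rfl ?_) C)
  calc _ ≤ ∫⁻ s in Ioo 0 t, ENNReal.ofReal c *
        (ENNReal.ofReal (tw s t) * ENNReal.ofReal (beta p s)) := by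
        refine lintegral_mono_ae ?_
        filter_upwards [ae_Ioo_of_ae_Ioi hr t] with s h1
        rw [mul_left_comm, ← ENNReal.ofReal_mul hc]
        gcongr
    _ ≤ _ := by
        rw [lintegral_const_mul' _ _ ENNReal.ofReal_ne_top, ENNReal.ofReal_mul hc]
        refine mul_le_mul_right ((hd t ht).trans (le_of_eq ?_)) _
        rw [growth_of_pos hp, mul_one]

/-- Vanishing moments trade `K / 2` of the source's rate for the factor `(1 + t)^{-K/2}`. Hence the
sign of `p - K / 2` decides the regime. -/
lemma ratio_mul_beta (K p : ℝ) {s t : ℝ} (hs : 0 < s) (ht : 0 < t) :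
    ratio K s t * beta p s = (1 + t) ^ (-K / 2) * beta (p - K / 2) s := by
  have h1 : (0 : ℝ) < 1 + s := by linarith
  have h2 : (0 : ℝ) < 1 + t := by linarith
  unfold ratio beta
  rw [Real.div_rpow h1.le h2.le, neg_div, Real.rpow_neg h2.le,
    show -(1 / 2) - (p - K / 2) = K / 2 + (-(1 / 2) - p) by ring, Real.rpow_add h1]
  field_simp

lemma ratio_nonneg (K : ℝ) {s t : ℝ} (hs : 0 ≤ s) (ht : 0 ≤ t) : 0 ≤ ratio K s t := by
  unfold ratio; positivity

lemma ratio_mul_star_le {K p c : ℝ} {s t : ℝ} (hs : 0 < s) (ht : 0 < t)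
    {f : E N → ℝ} (hc : 0 ≤ c) (hf : star K s f ≤ ENNReal.ofReal (c * beta p s)) :
    ENNReal.ofReal (ratio K s t) * star K s f ≤
      ENNReal.ofReal (c * (1 + t) ^ (-K / 2)) * ENNReal.ofReal (beta (p - K / 2) s) := by
  refine (mul_le_mul_right hf _).trans (le_of_eq ?_)
  rw [← ENNReal.ofReal_mul (ratio_nonneg K hs.le ht.le), ← ENNReal.ofReal_mul (by positivity),
    mul_left_comm, ratio_mul_beta K p hs ht]
  ring_nf

lemma dnorm_sol_le_of_zeroMoments_of_hasRate {K : ℝ} (hK : 0 ≤ K) {k : ℕ} (hkK : (k : ℝ) ≤ K)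
    (hK1 : K ≤ k + 1) {φ : E N → ℝ} (hφ : HasMoments k φ) (hφ0 : ZeroMoments k φ)
    (hφs : star K 0 φ < ⊤) {h : ℝ → E N → ℝ} (hm : JointMeas h)
    (h0 : ∀ᵐ s ∂(volume.restrict (Ioi (0 : ℝ))), ZeroMoments k (h s)) {p : ℝ} (hp : 0 < p)
    (hh : HasRate K p h) :
    ∃ C : ℝ, 0 ≤ C ∧ ∀ t : ℝ, 0 < t → dnorm K t (sol φ h t) ≤
      ENNReal.ofReal (C * ((1 + t) ^ (-K / 2) * growth (p - K / 2) t)) := by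
  obtain ⟨C, hC, hb⟩ := dnorm_sol_le_of_zeroMoments (N := N) hK hkK hK1
  obtain ⟨D, hD, hd⟩ := lintegral_tw_beta_le (p - K / 2)
  have hS := hh.source hp hm
  obtain ⟨c, hc, hr⟩ := hh
  set S := (star K 0 φ).toReal
  have hS0 : 0 ≤ S := ENNReal.toReal_nonneg
  refine ⟨C.toReal * (2 * S + c * D), by positivity, fun t ht => ?_⟩
  have hg := half_le_growth (p - K / 2) ht
  have h1t : (0 : ℝ) < 1 + t := by linarith
  have hr0 : ratio K 0 t = (1 + t) ^ (-K / 2) := by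
    rw [ratio, Real.div_rpow (by norm_num) h1t.le, add_zero, Real.one_rpow, neg_div,
      Real.rpow_neg h1t.le, one_div]
  have e1 : ∫⁻ s in Ioo 0 t, ENNReal.ofReal (tw s t) * (ENNReal.ofReal (ratio K s t) *
      star K s (h s)) ≤ ENNReal.ofReal (c * (1 + t) ^ (-K / 2)) *
        ENNReal.ofReal (D * growth (p - K / 2) t) := by
    calc _ ≤ ∫⁻ s in Ioo 0 t, ENNReal.ofReal (c * (1 + t) ^ (-K / 2)) *
          (ENNReal.ofReal (tw s t) * ENNReal.ofReal (beta (p - K / 2) s)) := by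
          refine lintegral_mono_ae ?_
          filter_upwards [ae_Ioo_of_ae_Ioi hr t, ae_restrict_mem measurableSet_Ioo] with s h1 h2
          exact (mul_le_mul_right (ratio_mul_star_le h2.1 ht hc h1) _).trans_eq
            (mul_left_comm _ _ _)
      _ ≤ _ := by
          rw [lintegral_const_mul' _ _ ENNReal.ofReal_ne_top]
          exact mul_le_mul_right (hd t ht) _
  refine (hb φ h t hφ hφ0 hS h0 ht).trans ((mul_le_mul_right (add_le_add le_rfl e1) C).trans ?_)
  conv_lhs => rw [hr0, ← ENNReal.ofReal_toReal hC, ← ENNReal.ofReal_toReal hφs.ne]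
  rw [← ENNReal.ofReal_mul (by positivity), ← ENNReal.ofReal_mul (by positivity),
    ← ENNReal.ofReal_add (by positivity) (by positivity), ← ENNReal.ofReal_mul (by positivity)]
  refine ENNReal.ofReal_le_ofReal ?_
  rw [mul_assoc C.toReal]
  refine mul_le_mul_of_nonneg_left ?_ ENNReal.toReal_nonneg
  have h3 : 0 ≤ (1 + t) ^ (-K / 2) := by positivity
  -- `growth ≥ 1/2` absorbs the contribution of the initial function.
  have h4 : (1 + t) ^ (-K / 2) * S ≤ (1 + t) ^ (-K / 2) * S * (2 * growth (p - K / 2) t) :=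
    le_mul_of_one_le_right (by positivity) (by linarith)
  linarith

/-! ### Long-time asymptotics -/

lemma rpow_half_mul_lam (K : ℝ) (k : ℕ) {r t : ℝ} (hr : 0 ≤ r) (ht : 0 < t) :
    t ^ (K / 2) * lam K k (r / Real.sqrt t) =
      r ^ K * (min 1 (r / Real.sqrt t)) ^ ((k : ℝ) + 1 - K) := by
  have : t ^ (K / 2) = Real.sqrt t ^ K := by
    rw [Real.sqrt_eq_rpow, ← Real.rpow_mul ht.le]
    ring_nf
  rw [lam, this, Real.div_rpow hr (Real.sqrt_nonneg _)]
  have h2 : 0 < Real.sqrt t ^ K := Real.rpow_pos_of_pos (Real.sqrt_pos.2 ht) K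
  field_simp

/-- After scaling there remains `min(1, r/√t)^{k+1-K}`, with a positive exponent. This surplus of
the Taylor order over `K` is the origin of the little-o. -/
lemma tendsto_rpow_half_mul_lam {K : ℝ} {k : ℕ} (hK1 : K < k + 1) {r : ℝ} (hr : 0 ≤ r) :
    Tendsto (fun t : ℝ => t ^ (K / 2) * lam K k (r / Real.sqrt t)) atTop (𝓝 0) := by
  have h1 : Tendsto (fun t : ℝ => r / Real.sqrt t) atTop (𝓝 0) :=
    tendsto_const_nhds.div_atTop Real.tendsto_sqrt_atTop
  have h2 : Tendsto (fun t : ℝ => min 1 (r / Real.sqrt t)) atTop (𝓝 0) := by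
    have := (tendsto_const_nhds (x := (1 : ℝ))).min h1
    rwa [min_eq_right zero_le_one] at this
  have h3 := (h2.rpow_const (p := (k : ℝ) + 1 - K) (Or.inr (by linarith))).const_mul (r ^ K)
  rw [Real.zero_rpow (by linarith), mul_zero] at h3
  refine h3.congr' ?_
  filter_upwards [eventually_gt_atTop 0] with t ht
  exact (rpow_half_mul_lam K k hr ht).symm

lemma rpow_half_mul_lam_le {K : ℝ} {k : ℕ} (hK1 : K ≤ k + 1) {r t : ℝ} (hr : 0 ≤ r) (ht : 0 < t) :
    t ^ (K / 2) * lam K k (r / Real.sqrt t) ≤ r ^ K := by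
  rw [rpow_half_mul_lam K k hr ht]
  refine mul_le_of_le_one_right (by positivity) (Real.rpow_le_one ?_ (min_le_left _ _)
    (by linarith))
  exact le_min zero_le_one (by positivity)

lemma ofReal_mul_lamMass (K : ℝ) (k : ℕ) (t : ℝ) (ht : 0 < t) (f : E N → ℝ) :
    ENNReal.ofReal (t ^ (K / 2)) * lamMass K k t f =
      ∫⁻ ξ, ENNReal.ofReal (t ^ (K / 2) * lam K k (Real.sqrt 2 * ‖ξ‖ / Real.sqrt t)) * ‖f ξ‖ₑ := by
  rw [lamMass, ← lintegral_const_mul' _ _ ENNReal.ofReal_ne_top]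
  refine lintegral_congr fun ξ => ?_
  rw [← mul_assoc, ← ENNReal.ofReal_mul (by positivity)]

lemma rpow_le_mul_omega {K : ℝ} (hK : 0 ≤ K) {s : ℝ} (hs : 0 ≤ s) (x : E N) :
    (Real.sqrt 2 * ‖x‖) ^ K ≤ Real.sqrt 2 ^ K * (1 + s) ^ (K / 2) * omega K s x := by
  have h1 : (1 + s) ^ (K / 2) = Real.sqrt (1 + s) ^ K := by
    rw [Real.sqrt_eq_rpow, ← Real.rpow_mul (by linarith)]
    ring_nf
  have h2 : 0 < Real.sqrt (1 + s) := Real.sqrt_pos.2 (by linarith)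
  rw [h1, omega, ← Real.mul_rpow (by positivity) (by positivity),
    ← Real.mul_rpow (by positivity) (by positivity)]
  refine Real.rpow_le_rpow (by positivity) ?_ hK
  rw [mul_assoc]
  refine mul_le_mul_of_nonneg_left ?_ (Real.sqrt_nonneg _)
  rw [mul_add, mul_div_cancel₀ _ h2.ne']
  linarith

lemma lintegral_rpow_le_wnorm {K : ℝ} (hK : 0 ≤ K) {s : ℝ} (hs : 0 ≤ s) (f : E N → ℝ) :
    ∫⁻ ξ, ENNReal.ofReal ((Real.sqrt 2 * ‖ξ‖) ^ K) * ‖f ξ‖ₑ ≤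
      ENNReal.ofReal (Real.sqrt 2 ^ K * (1 + s) ^ (K / 2)) * wnorm K s f := by
  rw [wnorm, ← lintegral_const_mul' _ _ ENNReal.ofReal_ne_top]
  refine lintegral_mono fun ξ => ?_
  simp only
  rw [← mul_assoc, ← ENNReal.ofReal_mul (by positivity)]
  gcongr
  exact rpow_le_mul_omega hK hs ξ

lemma ofReal_mul_lamMass_le {K : ℝ} {k : ℕ} (hK1 : K ≤ k + 1) {t : ℝ} (ht : 0 < t) (f : E N → ℝ) :
    ENNReal.ofReal (t ^ (K / 2)) * lamMass K k t f ≤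
      ∫⁻ ξ, ENNReal.ofReal ((Real.sqrt 2 * ‖ξ‖) ^ K) * ‖f ξ‖ₑ := by
  rw [ofReal_mul_lamMass K k t ht]
  refine lintegral_mono fun ξ => ?_
  gcongr
  exact rpow_half_mul_lam_le hK1 (by positivity) ht

lemma measurable_lam_sqrt (K : ℝ) (k : ℕ) (t : ℝ) :
    Measurable fun ξ : E N => lam K k (Real.sqrt 2 * ‖ξ‖ / Real.sqrt t) :=
  (measurable_lam K k).comp ((measurable_norm.const_mul _).div_const _)

/-- Dominated convergence; the majorant `(√2 ‖ξ‖)^K |f|` is integrable because `f` has a finite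
moment of order `K`. -/
lemma tendsto_lamMass {K : ℝ} (hK : 0 ≤ K) {k : ℕ} (hK1 : K < k + 1) {f : E N → ℝ}
    (hf : AEStronglyMeasurable f) {s : ℝ} (hs : 0 ≤ s) (hfs : star K s f < ⊤) :
    Tendsto (fun t : ℝ => ENNReal.ofReal (t ^ (K / 2)) * lamMass K k t f) atTop (𝓝 0) := by
  have h1 : Tendsto (fun t : ℝ => ∫⁻ ξ, ENNReal.ofReal (t ^ (K / 2) *
      lam K k (Real.sqrt 2 * ‖ξ‖ / Real.sqrt t)) * ‖f ξ‖ₑ) atTop (𝓝 (∫⁻ _ : E N, 0)) := by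
    refine tendsto_lintegral_filter_of_dominated_convergence'
      (fun ξ => ENNReal.ofReal ((Real.sqrt 2 * ‖ξ‖) ^ K) * ‖f ξ‖ₑ) ?_ ?_ ?_ ?_
    · exact Eventually.of_forall fun t =>
        ((measurable_lam_sqrt K k t).const_mul _).ennreal_ofReal.aemeasurable.mul hf.enorm
    · filter_upwards [eventually_gt_atTop 0] with t ht
      refine Eventually.of_forall fun ξ => ?_
      gcongr
      exact rpow_half_mul_lam_le hK1.le (by positivity) ht
    · refine ((lintegral_rpow_le_wnorm hK hs f).trans_lt (ENNReal.mul_lt_top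
        ENNReal.ofReal_lt_top ((wnorm_le_star K s f).trans_lt hfs))).ne
    · refine Eventually.of_forall fun ξ => ?_
      have := ENNReal.tendsto_ofReal (tendsto_rpow_half_mul_lam hK1 (r := Real.sqrt 2 * ‖ξ‖)
        (by positivity))
      have h2 := ENNReal.Tendsto.mul_const this (b := ‖f ξ‖ₑ) (Or.inr enorm_ne_top)
      rwa [ENNReal.ofReal_zero, zero_mul] at h2
  rw [lintegral_zero] at h1
  refine h1.congr' ?_
  filter_upwards [eventually_gt_atTop 0] with t ht
  rw [ofReal_mul_lamMass K k t ht]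

lemma JointMeas.aemeasurable_lamMass {h : ℝ → E N → ℝ} (hh : JointMeas h) (K : ℝ) (k : ℕ) (t : ℝ) :
    AEMeasurable (fun s => lamMass K k t (h s)) (volume.restrict (Ioi (0 : ℝ))) := by
  have h1 : AEMeasurable (fun p : ℝ × E N => ENNReal.ofReal
      (lam K k (Real.sqrt 2 * ‖p.2‖ / Real.sqrt t)) * ‖h p.1 p.2‖ₑ) (spaceTime N) :=
    (((measurable_lam_sqrt K k t).comp measurable_snd).ennreal_ofReal.aemeasurable).mul hh.enorm
  exact h1.lintegral_prod_right'

/-- Dominated convergence in `s`; the majorant, a multiple of `beta (p - K / 2)`, is integrable on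
`(0, ∞)` because `p > K / 2`. -/
lemma tendsto_lintegral_lamMass {K : ℝ} (hK : 0 ≤ K) {k : ℕ} (hK1 : K < k + 1)
    {h : ℝ → E N → ℝ} (hm : JointMeas h) {p : ℝ} (hp : K / 2 < p) (hh : HasRate K p h) :
    Tendsto (fun t : ℝ => ∫⁻ s in Ioi (0 : ℝ), ENNReal.ofReal (t ^ (K / 2)) * lamMass K k t (h s))
      atTop (𝓝 0) := by
  have hfin := (hh.source (by linarith) hm).ae_star_lt_top
  obtain ⟨c, hc, hr⟩ := hh
  have h1 : Tendsto (fun t : ℝ => ∫⁻ s in Ioi (0 : ℝ), ENNReal.ofReal (t ^ (K / 2)) *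
      lamMass K k t (h s)) atTop (𝓝 (∫⁻ _ in Ioi (0 : ℝ), 0)) := by
    refine tendsto_lintegral_filter_of_dominated_convergence'
      (fun s => ENNReal.ofReal (Real.sqrt 2 ^ K * c) * ENNReal.ofReal (beta (p - K / 2) s))
      ?_ ?_ ?_ ?_
    · exact Eventually.of_forall fun t => (hm.aemeasurable_lamMass K k t).const_mul _
    · filter_upwards [eventually_gt_atTop 0] with t ht
      filter_upwards [hr, ae_restrict_mem measurableSet_Ioi] with s h2 h3
      have h4 : (0 : ℝ) < s := h3
      have h5 : (0 : ℝ) < 1 + s := by linarith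
      refine (ofReal_mul_lamMass_le hK1.le ht (h s)).trans
        ((lintegral_rpow_le_wnorm hK h4.le (h s)).trans
        ((mul_le_mul_right ((wnorm_le_star K s _).trans h2) _).trans (le_of_eq ?_)))
      rw [← ENNReal.ofReal_mul (by positivity), ← ENNReal.ofReal_mul (by positivity)]
      congr 1
      unfold beta
      rw [show -(1 / 2) - (p - K / 2) = K / 2 + (-(1 / 2) - p) by ring, Real.rpow_add h5]
      ring
    · rw [lintegral_const_mul' _ _ ENNReal.ofReal_ne_top]
      exact (ENNReal.mul_lt_top ENNReal.ofReal_lt_top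
        (lintegral_beta_Ioi_lt_top (by linarith))).ne
    · filter_upwards [hfin, hm.ae_aestronglyMeasurable, ae_restrict_mem measurableSet_Ioi]
        with s h2 h3 h4
      exact tendsto_lamMass hK hK1 h3 (le_of_lt h4) h2
  rwa [lintegral_zero] at h1

/-- The initial function and the sources before `t / 2` tend to zero by dominated convergence. The
sources after `t / 2` contribute `O((1 + t)^{-(p - K/2)})`. -/
lemma tendsto_dnorm_sol {K : ℝ} (hK : 0 ≤ K) {k : ℕ} (hkK : (k : ℝ) ≤ K)
    (hK1 : K < k + 1) {φ : E N → ℝ} (hφ : HasMoments k φ) (hφ0 : ZeroMoments k φ)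
    (hφm : AEStronglyMeasurable φ)
    (hφs : star K 0 φ < ⊤) {h : ℝ → E N → ℝ} (hm : JointMeas h)
    (h0 : ∀ᵐ s ∂(volume.restrict (Ioi (0 : ℝ))), ZeroMoments k (h s)) {p : ℝ} (hp : K / 2 < p)
    (hh : HasRate K p h) :
    Tendsto (fun t : ℝ => ENNReal.ofReal (t ^ (K / 2)) * dnorm K t (sol φ h t)) atTop (𝓝 0) := by
  obtain ⟨C, hC, hb⟩ := dnorm_sol_le_split (N := N) hK hkK hK1.le
  obtain ⟨D, hD, hd⟩ := lintegral_tw_beta_half_le (p - K / 2)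
  have hS := hh.source (by linarith) hm
  have l1 := tendsto_lamMass hK hK1 hφm le_rfl hφs
  have l2 := tendsto_lintegral_lamMass hK hK1 hm hp hh
  obtain ⟨c, hc, hr⟩ := hh
  have l3 : Tendsto (fun t : ℝ => ENNReal.ofReal (c * D * (1 + t) ^ (-(p - K / 2)))) atTop (𝓝 0) := by
    have := ((tendsto_rpow_neg_atTop (y := p - K / 2) (by linarith)).comp
      (tendsto_atTop_add_const_left atTop (1 : ℝ) tendsto_id)).const_mul (c * D)
    rw [mul_zero] at this
    simpa using ENNReal.tendsto_ofReal this
  have l4 := ENNReal.Tendsto.const_mul (a := C)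
    (l1.add ((ENNReal.Tendsto.const_mul (a := ENNReal.ofReal 3) l2
      (Or.inr ENNReal.ofReal_ne_top)).add l3)) (Or.inr hC)
  simp only [mul_zero, add_zero] at l4
  refine tendsto_of_tendsto_of_tendsto_of_le_of_le' tendsto_const_nhds l4
    (Eventually.of_forall fun _ => zero_le) ?_
  filter_upwards [eventually_gt_atTop 0] with t ht
  have h1t : (0 : ℝ) < 1 + t := by linarith
  refine (mul_le_mul_right (hb φ h t hφ hφ0 hS h0 ht) _).trans ?_
  rw [mul_left_comm, mul_add]
  refine mul_le_mul_right (add_le_add le_rfl ?_) C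
  have hU : Ioo 0 t = Ioo 0 (t / 2) ∪ Ico (t / 2) t :=
    (Ioo_union_Ico_eq_Ioo (by linarith) (by linarith)).symm
  rw [hU]
  refine (mul_le_mul_right (lintegral_union_le _ _ _) _).trans ?_
  rw [mul_add]
  refine add_le_add ?_ ?_
  · rw [← lintegral_const_mul' _ _ ENNReal.ofReal_ne_top,
      ← lintegral_const_mul' _ _ ENNReal.ofReal_ne_top]
    refine (setLIntegral_mono' measurableSet_Ioo fun s hs => ?_).trans
      (lintegral_mono_set Ioo_subset_Ioi_self)
    rw [if_pos hs.2, mul_left_comm]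
    gcongr
    exact tw_le ht hs.2.le
  · calc _ ≤ ENNReal.ofReal (t ^ (K / 2)) * ∫⁻ s in Ico (t / 2) t,
          ENNReal.ofReal (c * (1 + t) ^ (-K / 2)) *
          (ENNReal.ofReal (tw s t) * ENNReal.ofReal (beta (p - K / 2) s)) := by
          refine mul_le_mul_right (lintegral_mono_ae ?_) _
          have hr' : ∀ᵐ s ∂(volume.restrict (Ico (t / 2) t)),
              star K s (h s) ≤ ENNReal.ofReal (c * beta p s) :=
            ae_restrict_of_ae_restrict_of_subset (fun s hs => lt_of_lt_of_le (half_pos ht) hs.1) hr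
          filter_upwards [hr', ae_restrict_mem measurableSet_Ico] with s h1 h2
          rw [if_neg (not_lt.2 h2.1)]
          exact (mul_le_mul_right (ratio_mul_star_le ((half_pos ht).trans_le h2.1) ht hc h1) _).trans_eq
            (mul_left_comm _ _ _)
      _ ≤ ENNReal.ofReal (t ^ (K / 2)) * (ENNReal.ofReal (c * (1 + t) ^ (-K / 2)) *
          ENNReal.ofReal (D * (1 + t) ^ (-(p - K / 2)))) := by
          rw [lintegral_const_mul' _ _ ENNReal.ofReal_ne_top]
          gcongr
          exact hd t ht
      _ ≤ _ := by
          rw [← ENNReal.ofReal_mul (by positivity), ← ENNReal.ofReal_mul (by positivity)]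
          refine ENNReal.ofReal_le_ofReal ?_
          have h3 : t ^ (K / 2) * (1 + t) ^ (-K / 2) ≤ 1 := by
            rw [neg_div, Real.rpow_neg h1t.le, ← div_eq_mul_inv, div_le_one (by positivity)]
            gcongr
            linarith
          have h4 : 0 ≤ c * D * (1 + t) ^ (-(p - K / 2)) := by positivity
          nlinarith [mul_le_mul_of_nonneg_right h3 h4]

/-! ### Absolute convergence of the Duhamel integral -/

lemma measurable_gaussKernel :
    Measurable fun p : E N × ℝ => gaussKernel p.1 p.2 := by
  unfold gaussKernel
  fun_prop

lemma Source.abs {K : ℝ} {h : ℝ → E N → ℝ} (hh : Source K h) : Source K fun s x => |h s x| := by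
  refine hh.of_le hh.meas.norm 1 ENNReal.one_ne_top (Eventually.of_forall fun s => ?_)
  rw [one_mul]
  exact star_mono_enorm (Eventually.of_forall fun x => by simp)

/-- The kernel is positive, so the inner integral of absolute values is the Duhamel integrand of
`|h|`, already known to be integrable in time. -/
lemma Source.integrableOn_kernel {K : ℝ} (hK : 0 ≤ K) {h : ℝ → E N → ℝ} (hh : Source K h)
    {t : ℝ} (x : E N) :
    IntegrableOn (fun p : ℝ × E N => gaussKernel (x - p.2) (t - p.1) * h p.1 p.2)
      (Ioo 0 t ×ˢ univ) := by
  rw [IntegrableOn, Measure.volume_eq_prod, ← Measure.prod_restrict, Measure.restrict_univ]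
  have hle : (volume.restrict (Ioo 0 t)).prod (volume : Measure (E N)) ≤ spaceTime N :=
    Measure.prod_mono (Measure.restrict_mono Ioo_subset_Ioi_self le_rfl) le_rfl
  have hm : AEStronglyMeasurable (fun p : ℝ × E N => gaussKernel (x - p.2) (t - p.1) * h p.1 p.2)
      ((volume.restrict (Ioo 0 t)).prod volume) :=
    (measurable_gaussKernel.comp (by fun_prop :
      Measurable fun p : ℝ × E N => (x - p.2, t - p.1))).aestronglyMeasurable.mul
      (hh.meas.mono_measure hle)
  have hint : ∀ᵐ s ∂(volume.restrict (Ioo 0 t)), Integrable fun ξ : E N =>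
      gaussKernel (x - ξ) (t - s) * h s ξ := by
    filter_upwards [ae_Ioo_of_ae_Ioi (hh.ae_integrable hK) t, ae_restrict_mem measurableSet_Ioo]
      with s h1 h2
    have h3 : 0 < t - s := by linarith [h2.2]
    exact ((polyGauss_gaussKernel (t - s)).boundedC1 (by positivity)).integrable_mul h1 x
  rw [integrable_prod_iff hm]
  refine ⟨hint, ?_⟩
  refine (hh.abs.integrableOn_duh hK polyGauss_gauss.continuous (polyGauss_gauss.rapid quarter_pos)
    timeWeight_one t x).congr ?_
  filter_upwards [ae_restrict_mem measurableSet_Ioo] with s hs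
  have h3 : 0 < t - s := by linarith [hs.2]
  rw [one_mul, ← heat_eq_conv h3, heat]
  refine integral_congr_ae (Eventually.of_forall fun ξ => ?_)
  simp only [norm_mul, Real.norm_eq_abs, abs_of_pos (gaussKernel_pos _ h3)]

/-! ### Weak and classical gradients -/

lemma continuous_partialDeriv {f : E N → ℝ} (hf : ContDiff ℝ 1 f) (i : Fin N) :
    Continuous (partialDeriv i f) :=
  (hf.continuous_fderiv one_ne_zero).clm_apply continuous_const

lemma continuous_gradient {f : E N → ℝ} (hf : ContDiff ℝ 1 f) : Continuous (gradient f) :=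
  (InnerProductSpace.toDual ℝ (E N)).symm.continuous.comp (hf.continuous_fderiv one_ne_zero)

lemma HasCompactSupport.partialDeriv {ψ : E N → ℝ} (hψ : HasCompactSupport ψ) (i : Fin N) :
    HasCompactSupport (ParabolicExpansion.partialDeriv i ψ) := hψ.fderiv_apply ℝ _

lemma hasWeakGradient_gradient {f : E N → ℝ} (hf : ContDiff ℝ 1 f) :
    HasWeakGradient f (gradient f) := by
  refine ⟨hf.continuous.locallyIntegrable, (continuous_gradient hf).locallyIntegrable,
    fun ψ hψ hs i => ?_⟩
  have hψ1 : ContDiff ℝ 1 ψ := hψ.of_le (by simp)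
  simp only [gradient_apply]
  refine integral_mul_fderiv_eq_neg_fderiv_mul_of_integrable ?_ ?_ ?_
    (fun x _ => hf.differentiable one_ne_zero x) (fun x _ => hψ1.differentiable one_ne_zero x)
  · exact ((continuous_partialDeriv hf i).mul hψ1.continuous).integrable_of_hasCompactSupport
      hs.mul_left
  · exact (hf.continuous.mul (continuous_partialDeriv hψ1 i)).integrable_of_hasCompactSupport
      (HasCompactSupport.partialDeriv hs i).mul_left
  · exact (hf.continuous.mul hψ1.continuous).integrable_of_hasCompactSupport hs.mul_left

lemma LocallyIntegrable.coord {df : E N → E N} (h : LocallyIntegrable df) (i : Fin N) :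
    LocallyIntegrable fun x => df x i := by
  intro x
  obtain ⟨s, hs, hi⟩ := h x
  exact ⟨s, hs, (EuclideanSpace.proj (𝕜 := ℝ) i).integrable_comp hi⟩

/-- Uniqueness of weak gradients: `df` is determined by any `C¹` representative of `f`. -/
lemma HasWeakGradient.ae_eq_gradient {f V : E N → ℝ} {df : E N → E N} (h : HasWeakGradient f df)
    (hV : ContDiff ℝ 1 V) (hfV : f =ᵐ[volume] V) : df =ᵐ[volume] gradient V := by
  obtain ⟨-, h2, h3⟩ := h
  obtain ⟨-, g2, g3⟩ := hasWeakGradient_gradient hV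
  have key : ∀ i, ∀ᵐ x, df x i - gradient V x i = 0 := by
    intro i
    have l1 := LocallyIntegrable.coord h2 i
    have l2 := LocallyIntegrable.coord g2 i
    refine ae_eq_zero_of_integral_contDiff_smul_eq_zero (l1.sub l2) fun ψ hψ hs => ?_
    have e1 := h3 ψ hψ hs i
    have e2 := g3 ψ hψ hs i
    have e3 : ∫ x, f x * partialDeriv i ψ x = ∫ x, V x * partialDeriv i ψ x :=
      integral_congr_ae (hfV.mono fun x hx => by simp only [hx])
    have i1 : Integrable fun x => ψ x * df x i :=
      l1.integrable_smul_left_of_hasCompactSupport hψ.continuous hs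
    have i2 : Integrable fun x => ψ x * gradient V x i :=
      l2.integrable_smul_left_of_hasCompactSupport hψ.continuous hs
    simp only [smul_eq_mul, mul_sub]
    rw [integral_sub i1 i2]
    simp only [mul_comm (ψ _)]
    linarith
  filter_upwards [ae_all_iff.2 key] with x hx
  ext i
  linarith [hx i]

lemma HasWeakGradient.congr {f g : E N → ℝ} {df dg : E N → E N} (h : HasWeakGradient f df)
    (hf : f =ᵐ[volume] g) (hd : df =ᵐ[volume] dg) : HasWeakGradient g dg := by
  obtain ⟨h1, h2, h3⟩ := h
  refine ⟨h1.congr hf, h2.congr hd, fun ψ hψ hs i => ?_⟩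
  rw [← integral_congr_ae (hf.mono fun x hx => by simp only [hx] :
      (fun x => f x * ParabolicExpansion.partialDeriv i ψ x) =ᵐ[volume] _), h3 ψ hψ hs i,
    integral_congr_ae (hd.mono fun x hx => by simp only [hx] :
      (fun x => df x i * ψ x) =ᵐ[volume] fun x => dg x i * ψ x)]

/-- A limit of difference quotients; translations in `x` preserve the measure, so the quotients
remain almost everywhere measurable. -/
lemma JointMeas.partialDeriv {f : ℝ → E N → ℝ} (hf : JointMeas f)
    (hd : ∀ t, 0 < t → Differentiable ℝ (f t)) (i : Fin N) :
    JointMeas fun t => partialDeriv i (f t) := by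
  have hpos : ∀ᵐ p : ℝ × E N ∂(spaceTime N), p.1 ∈ Ioi (0 : ℝ) :=
    Measure.quasiMeasurePreserving_fst.ae (ae_restrict_mem measurableSet_Ioi)
  refine aestronglyMeasurable_of_tendsto_ae (u := atTop) (f := fun (n : ℕ) (p : ℝ × E N) =>
    (n : ℝ) • (f p.1 (p.2 + (n : ℝ)⁻¹ • EuclideanSpace.single i 1) - f p.1 p.2)) (fun n => ?_) ?_
  · have hmp : MeasurePreserving (fun p : ℝ × E N =>
        (p.1, p.2 + (n : ℝ)⁻¹ • EuclideanSpace.single i (1 : ℝ))) (spaceTime N) (spaceTime N) :=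
      (MeasurePreserving.id _).prod (measurePreserving_add_right volume _)
    exact ((hf.comp_measurePreserving hmp).sub hf).const_smul (n : ℝ)
  · filter_upwards [hpos] with p hp
    refine (hd p.1 hp p.2).hasFDerivAt.lim _ ?_
    simp only [Real.norm_natCast]
    exact tendsto_natCast_atTop_atTop

lemma JointMeas.gradient {f : ℝ → E N → ℝ} (hf : JointMeas f)
    (hd : ∀ t, 0 < t → Differentiable ℝ (f t)) :
    AEStronglyMeasurable (fun p : ℝ × E N => gradient (f p.1) p.2) (spaceTime N) := by
  have : (fun p : ℝ × E N => _root_.gradient (f p.1) p.2) = fun p =>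
      ∑ i, ParabolicExpansion.partialDeriv i (f p.1) p.2 • EuclideanSpace.single i (1 : ℝ) := by
    ext1 p
    rw [sum_coord_smul (_root_.gradient (f p.1) p.2)]
    simp only [gradient_apply]
  rw [this]
  exact Finset.aestronglyMeasurable_fun_sum _ fun i _ => (hf.partialDeriv hd i).smul_const _

lemma isWeaklyDiff_gradient {f : ℝ → E N → ℝ} (hf : JointMeas f)
    (hd : ∀ t, 0 < t → ContDiff ℝ 1 (f t)) : IsWeaklyDiff f fun t => gradient (f t) := by
  refine ⟨hf, hf.gradient fun t ht => (hd t ht).differentiable one_ne_zero, ?_⟩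
  filter_upwards [ae_restrict_mem measurableSet_Ioi] with t ht
  exact hasWeakGradient_gradient (hd t ht)

/-! ### Comparison of norms -/

variable {V : Type*} [NormedAddCommGroup V]

lemma lintegral_le_star {K : ℝ} (hK : 0 ≤ K) (t : ℝ) (g : E N → V) : ∫⁻ x, ‖g x‖ₑ ≤ star K t g :=
  (lintegral_le_wnorm hK t g).trans (wnorm_le_star K t g)

lemma ofReal_mul_eLpNorm_top_le_star (K t : ℝ) (g : E N → V) :
    ENNReal.ofReal (t ^ ((N : ℝ) / 2)) * eLpNorm g ∞ volume ≤ star K t g := le_add_self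

/-- Interpolation `‖g‖_q^q ≤ ‖g‖_∞^{q-1} ‖g‖_1`. The exponent `decayExp` is what the factor
`t^{N/2}` of `‖g‖_∞` leaves after taking the root. -/
lemma ofReal_mul_eLpNorm_le_star {K : ℝ} (hK : 0 ≤ K) {q : ℝ≥0∞} (hq : 1 ≤ q) {t : ℝ} (ht : 0 < t)
    (g : E N → V) :
    ENNReal.ofReal (t ^ decayExp N q) * eLpNorm g q volume ≤ star K t g := by
  have h1 := lintegral_le_star hK t g
  have h2 := ofReal_mul_eLpNorm_top_le_star K t g
  rcases eq_or_ne q ∞ with rfl | hq'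
  · simpa [decayExp] using h2
  rcases eq_or_ne (star K t g) ⊤ with hT | hT
  · rw [hT]
    exact le_top
  have hr : 1 ≤ q.toReal := by simpa using ENNReal.toReal_mono hq' hq
  set r := q.toReal with hrdef
  have hr0 : 0 < r := by linarith
  have hq0 : q ≠ 0 := (zero_lt_one.trans_le hq).ne'
  rw [eLpNorm_eq_lintegral_rpow_enorm_toReal hq0 hq', ← hrdef]
  set S := eLpNorm g ∞ volume
  set T := ENNReal.ofReal (t ^ ((N : ℝ) / 2)) with hTdef
  have hS : ∀ᵐ x, ‖g x‖ₑ ≤ S := by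
    have := enorm_ae_le_eLpNormEssSup g volume
    simpa [S, eLpNorm_exponent_top] using this
  have hST : S ≠ ⊤ := by
    rintro hST
    have hT0 : T ≠ 0 := (ENNReal.ofReal_pos.2 (by positivity)).ne'
    rw [hST, ENNReal.mul_top hT0] at h2
    exact hT (top_le_iff.1 h2)
  have hST' : S ^ (r - 1) ≠ ⊤ := ENNReal.rpow_ne_top_of_nonneg (by linarith) hST
  have h3 : ∫⁻ x, ‖g x‖ₑ ^ r ≤ S ^ (r - 1) * star K t g := by
    refine le_trans ?_ (mul_le_mul_right h1 _)
    rw [← lintegral_const_mul' _ _ hST']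
    refine lintegral_mono_ae (hS.mono fun x hx => ?_)
    calc ‖g x‖ₑ ^ r = ‖g x‖ₑ ^ ((r - 1) + 1) := by ring_nf
      _ = ‖g x‖ₑ ^ (r - 1) * ‖g x‖ₑ := by
          rw [ENNReal.rpow_add_of_nonneg _ _ (by linarith) zero_le_one, ENNReal.rpow_one]
      _ ≤ _ := mul_le_mul_left (ENNReal.rpow_le_rpow hx (by linarith)) _
  have h4 : ENNReal.ofReal (t ^ decayExp N q) = (T ^ (r - 1)) ^ (1 / r) := by
    rw [← ENNReal.rpow_mul, hTdef, ENNReal.ofReal_rpow_of_pos (by positivity), ← Real.rpow_mul ht.le,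
      decayExp, ENNReal.toReal_inv, ← hrdef]
    congr 2
    field_simp
  rw [h4, ← ENNReal.mul_rpow_of_nonneg _ _ (by positivity)]
  calc (T ^ (r - 1) * ∫⁻ x, ‖g x‖ₑ ^ r) ^ (1 / r)
      ≤ (star K t g ^ (r - 1) * star K t g) ^ (1 / r) := by
        refine ENNReal.rpow_le_rpow ((mul_le_mul_right h3 _).trans ?_) (by positivity)
        rw [← mul_assoc, ← ENNReal.mul_rpow_of_nonneg _ _ (by linarith)]
        exact mul_le_mul_left (ENNReal.rpow_le_rpow h2 (by linarith)) _
    _ = star K t g := by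
        nth_rewrite 2 [← ENNReal.rpow_one (star K t g)]
        rw [← ENNReal.rpow_add_of_nonneg _ _ (by linarith) zero_le_one, ← ENNReal.rpow_mul]
        rw [show (r - 1 + 1) * (1 / r) = 1 by field_simp; ring, ENNReal.rpow_one]

/-- `√(1 + t) ≥ 1` gives `(1 + ‖x‖)/√(1 + t) ≤ 1 + ‖x‖/√(1 + t)`; the right side is at least one, so
its exponent may be raised from `l` to `K`. -/
lemma ofReal_mul_weightedNorm_le_star {K : ℝ} {l : ℝ} (hl : 0 ≤ l) (hlK : l ≤ K) {t : ℝ}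
    (ht : 0 ≤ t) (g : E N → V) :
    ENNReal.ofReal ((1 + t) ^ (-l / 2)) * weightedNorm l g ≤ star K t g := by
  refine le_trans ?_ (wnorm_le_star K t g)
  rw [weightedNorm, wnorm, ← lintegral_const_mul' _ _ ENNReal.ofReal_ne_top]
  refine lintegral_mono fun x => ?_
  simp only
  rw [← mul_assoc, ← ENNReal.ofReal_mul (by positivity)]
  refine mul_le_mul_left (ENNReal.ofReal_le_ofReal ?_) _
  have h1 : (1 + t) ^ (-l / 2) = (Real.sqrt (1 + t) ^ l)⁻¹ := by
    rw [Real.sqrt_eq_rpow, ← Real.rpow_mul (by linarith), neg_div, Real.rpow_neg (by linarith)]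
    ring_nf
  have h2 : 1 ≤ Real.sqrt (1 + t) := Real.one_le_sqrt.2 (by linarith)
  have h3 : 0 ≤ ‖x‖ / Real.sqrt (1 + t) := by positivity
  rw [h1, inv_mul_eq_div, ← Real.div_rpow (by positivity) (by positivity), omega]
  calc ((1 + ‖x‖) / Real.sqrt (1 + t)) ^ l ≤ (1 + ‖x‖ / Real.sqrt (1 + t)) ^ l := by
        refine Real.rpow_le_rpow (by positivity) ?_ hl
        rw [add_div]
        gcongr
        exact (div_le_one (by linarith)).2 h2
    _ ≤ _ := Real.rpow_le_rpow_of_exponent_le (by linarith) hlK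

/-- For `‖x‖ ≤ √(1 + s)` the weight is at most `2^K`; beyond, it is at most `2^K (1 + s)^{-K/2} (1 +
‖x‖)^K`. -/
lemma wnorm_le_weightedNorm {K : ℝ} (hK : 0 ≤ K) {s : ℝ} (hs : 0 ≤ s) {f : E N → V}
    (hf : AEStronglyMeasurable f) :
    wnorm K s f ≤ ENNReal.ofReal (2 ^ K) *
      (weightedNorm 0 f + ENNReal.ofReal ((1 + s) ^ (-K / 2)) * weightedNorm K f) := by
  rw [weightedNorm, weightedNorm, ← lintegral_const_mul' _ _ ENNReal.ofReal_ne_top]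
  have hm : AEMeasurable fun x : E N => ENNReal.ofReal ((1 + ‖x‖) ^ (0 : ℝ)) * ‖f x‖ₑ :=
    (by fun_prop : Measurable fun x : E N =>
      ENNReal.ofReal ((1 + ‖x‖) ^ (0 : ℝ))).aemeasurable.mul hf.enorm
  rw [← lintegral_add_left' hm, wnorm, ← lintegral_const_mul' _ _ ENNReal.ofReal_ne_top]
  refine lintegral_mono fun x => ?_
  simp only
  rw [← mul_assoc, ← add_mul, ← mul_assoc, ← ENNReal.ofReal_mul (by positivity),
    ← ENNReal.ofReal_add (by positivity) (by positivity), ← ENNReal.ofReal_mul (by positivity)]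
  refine mul_le_mul_left (ENNReal.ofReal_le_ofReal ?_) _
  rw [Real.rpow_zero]
  have h2 : 0 < Real.sqrt (1 + s) := Real.sqrt_pos.2 (by linarith)
  have h1 : (1 + s) ^ (-K / 2) = (Real.sqrt (1 + s) ^ K)⁻¹ := by
    rw [Real.sqrt_eq_rpow, ← Real.rpow_mul (by linarith), neg_div, Real.rpow_neg (by linarith)]
    ring_nf
  rw [h1, inv_mul_eq_div, ← Real.div_rpow (by positivity) (by positivity), mul_add, mul_one,
    ← Real.mul_rpow zero_le_two (by positivity), omega]
  have h3 : 0 ≤ ‖x‖ / Real.sqrt (1 + s) := by positivity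
  have h4 : 0 ≤ (2 * ((1 + ‖x‖) / Real.sqrt (1 + s))) ^ K := by positivity
  have h5 : (0 : ℝ) ≤ 2 ^ K := by positivity
  rcases le_total (‖x‖ / Real.sqrt (1 + s)) 1 with h | h
  · have : (1 + ‖x‖ / Real.sqrt (1 + s)) ^ K ≤ 2 ^ K :=
      Real.rpow_le_rpow (by positivity) (by linarith) hK
    linarith
  · have : (1 + ‖x‖ / Real.sqrt (1 + s)) ^ K ≤ (2 * ((1 + ‖x‖) / Real.sqrt (1 + s))) ^ K := by
      refine Real.rpow_le_rpow (by positivity) ?_ hK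
      rw [add_div]
      have : 0 ≤ 1 / Real.sqrt (1 + s) := by positivity
      linarith
    linarith

/-- At time `0` the factor `0^{N/2}` removes the possibly infinite supremum of `φ`. This needs `N ≥
1`, since `0^0 = 1`. -/
lemma star_zero_lt_top (hN : 1 ≤ N) {K : ℝ} {φ : E N → ℝ} (hφ : MemL1K K φ) :
    star K 0 φ < ⊤ := by
  have hN' : (N : ℝ) / 2 ≠ 0 := by
    have : (1 : ℝ) ≤ N := by exact_mod_cast hN
    positivity
  rw [star, Real.zero_rpow hN', ENNReal.ofReal_zero, zero_mul, add_zero]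
  refine lt_of_le_of_lt (lintegral_mono fun x => ?_) hφ.2.2
  rw [enorm_mul, Real.enorm_of_nonneg (by positivity : 0 ≤ (1 + ‖x‖) ^ K), omega, add_zero,
    Real.sqrt_one, div_one]

lemma memL1K_of_star_lt_top {K : ℝ} (hK : 0 ≤ K) {s : ℝ} (hs : 0 ≤ s) {f : E N → ℝ}
    (hf : AEStronglyMeasurable f) (h : star K s f < ⊤) : MemL1K K f := by
  refine ⟨⟨hf, (lintegral_le_star hK s f).trans_lt h⟩, ?_, ?_⟩
  · exact (by fun_prop : Measurable fun x : E N => (1 + ‖x‖) ^ K).aestronglyMeasurable.mul hf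
  · have h1 := ofReal_mul_weightedNorm_le_star hK le_rfl hs f
    have h2 : weightedNorm K f < ⊤ := by
      refine ENNReal.lt_top_of_mul_ne_top_right (h1.trans_lt h).ne ?_
      exact (ENNReal.ofReal_pos.2 (by positivity)).ne'
    refine lt_of_le_of_lt (lintegral_mono fun x => le_of_eq ?_) h2
    rw [enorm_mul, Real.enorm_of_nonneg (by positivity : 0 ≤ (1 + ‖x‖) ^ K)]

/-! ### A function together with its gradient -/

/-- The norm of a function and its weak gradient at the time `t`. -/
def pnorm (K t : ℝ) (f : E N → ℝ) (df : E N → E N) : ℝ≥0∞ :=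
  star K t f + ENNReal.ofReal (Real.sqrt t) * star K t df

lemma pnorm_congr {K t : ℝ} {f g : E N → ℝ} {df dg : E N → E N} (h : f =ᵐ[volume] g)
    (hd : df =ᵐ[volume] dg) : pnorm K t f df = pnorm K t g dg := by
  rw [pnorm, pnorm, star_congr h, star_congr hd]

lemma pnorm_gradient_le_dnorm (K t : ℝ) {f : E N → ℝ} (hf : ContDiff ℝ 1 f) :
    pnorm K t f (gradient f) ≤ dnorm K t f := by
  refine add_le_add (star_le_ostar K t f) (mul_le_mul_right ?_ _)
  refine (star_le_sum_coord (continuous_gradient hf).aestronglyMeasurable).trans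
    (Finset.sum_le_sum fun i _ => ?_)
  simp only [gradient_apply]
  exact star_le_ostar K t _

lemma ofReal_mul_nablaLq_le {K : ℝ} (hK : 0 ≤ K) {q : ℝ≥0∞} (hq : 1 ≤ q) (j : Fin 2) {t : ℝ}
    (ht : 0 < t) (f : E N → ℝ) (df : E N → E N) :
    ENNReal.ofReal (t ^ (decayExp N q + (j : ℝ) / 2)) * nablaLq j q f df ≤ pnorm K t f df := by
  fin_cases j
  · simp only [nablaLq, Fin.zero_eta, Nat.cast_zero, zero_div,
      add_zero, if_true]
    exact (ofReal_mul_eLpNorm_le_star hK hq ht f).trans le_self_add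
  · simp only [nablaLq, Fin.mk_one, Nat.cast_one, one_ne_zero,
      if_false]
    rw [Real.rpow_add ht, ← Real.sqrt_eq_rpow, mul_comm, ENNReal.ofReal_mul' (by positivity),
      mul_comm, mul_comm (ENNReal.ofReal _), mul_assoc]
    exact (mul_le_mul_right (ofReal_mul_eLpNorm_le_star hK hq ht df) _).trans le_add_self

lemma ofReal_mul_nablaWeighted_le {K : ℝ} {l : ℝ} (hl : 0 ≤ l) (hlK : l ≤ K) (j : Fin 2) {t : ℝ}
    (ht : 0 < t) (f : E N → ℝ) (df : E N → E N) :
    ENNReal.ofReal (t ^ ((j : ℝ) / 2) * (1 + t) ^ (-l / 2)) * nablaWeighted j l f df ≤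
      pnorm K t f df := by
  fin_cases j
  · simp only [nablaWeighted, Fin.zero_eta, Nat.cast_zero,
      zero_div, Real.rpow_zero, one_mul, if_true]
    exact (ofReal_mul_weightedNorm_le_star hl hlK ht.le f).trans le_self_add
  · simp only [nablaWeighted, Fin.mk_one, Nat.cast_one,
      one_ne_zero, if_false]
    rw [← Real.sqrt_eq_rpow, ENNReal.ofReal_mul (by positivity), mul_assoc]
    exact (mul_le_mul_right (ofReal_mul_weightedNorm_le_star hl hlK ht.le df) _).trans le_add_self

lemma ofReal_mul_add_eLpNorm_le {K : ℝ} (hK : 0 ≤ K) {q : ℝ≥0∞} (hq : 1 ≤ q) {t : ℝ}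
    (ht : 0 < t) (f : E N → ℝ) (df : E N → E N) :
    ENNReal.ofReal (t ^ decayExp N q) * (eLpNorm f q volume +
      ENNReal.ofReal (t ^ (1 / 2 : ℝ)) * eLpNorm df q volume) ≤ pnorm K t f df := by
  rw [mul_add, mul_left_comm, ← Real.sqrt_eq_rpow]
  exact add_le_add (ofReal_mul_eLpNorm_le_star hK hq ht f)
    (mul_le_mul_right (ofReal_mul_eLpNorm_le_star hK hq ht df) _)

lemma ofReal_mul_add_weightedNorm_le {K : ℝ} {l : ℝ} (hl : 0 ≤ l) (hlK : l ≤ K) {t : ℝ}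
    (ht : 0 < t) (f : E N → ℝ) (df : E N → E N) :
    ENNReal.ofReal ((1 + t) ^ (-l / 2)) * (weightedNorm l f +
      ENNReal.ofReal (t ^ (1 / 2 : ℝ)) * weightedNorm l df) ≤ pnorm K t f df := by
  rw [mul_add, mul_left_comm, ← Real.sqrt_eq_rpow]
  exact add_le_add (ofReal_mul_weightedNorm_le_star hl hlK ht.le f)
    (mul_le_mul_right (ofReal_mul_weightedNorm_le_star hl hlK ht.le df) _)

/-- The cases `q = ∞`, `l = 0` and `l = K` of the hypotheses already control the time-dependent
norm. -/
lemma pnorm_bounded {K : ℝ} (hK : 0 ≤ K) {u : ℝ → E N → ℝ} {du : ℝ → E N → E N}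
    (hu : IsWeaklyDiff u du) (hLq : LqBounds u du) (hW : WeightedBounds K u du) :
    ∃ C : ℝ, 0 ≤ C ∧ ∀ᵐ t ∂(volume.restrict (Ioi (0 : ℝ))),
      pnorm K t (u t) (du t) ≤ ENNReal.ofReal C := by
  obtain ⟨C₁, h₁⟩ := hLq ∞ le_top
  obtain ⟨C₂, h₂⟩ := hW 0 le_rfl hK
  obtain ⟨C₃, h₃⟩ := hW K hK le_rfl
  refine ⟨(ENNReal.ofReal (2 ^ K) * (ENNReal.ofReal C₂ + ENNReal.ofReal C₃) +
    ENNReal.ofReal C₁).toReal, ENNReal.toReal_nonneg, ?_⟩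
  filter_upwards [h₁, h₂, h₃, ae_restrict_mem measurableSet_Ioi, hu.2.2] with t k₁ k₂ k₃ k₄ k₅
  have ht : (0 : ℝ) < t := k₄
  rw [ENNReal.ofReal_toReal (by finiteness)]
  have e : decayExp N ∞ = (N : ℝ) / 2 := by simp [decayExp]
  rw [e, ← Real.sqrt_eq_rpow] at k₁
  rw [neg_zero, zero_div, Real.rpow_zero, ENNReal.ofReal_one, one_mul, ← Real.sqrt_eq_rpow] at k₂
  rw [← Real.sqrt_eq_rpow] at k₃
  have w₁ := wnorm_le_weightedNorm hK ht.le k₅.1.aestronglyMeasurable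
  have w₂ := wnorm_le_weightedNorm hK ht.le k₅.2.1.aestronglyMeasurable
  calc pnorm K t (u t) (du t)
      ≤ ENNReal.ofReal (2 ^ K) * (weightedNorm 0 (u t) + ENNReal.ofReal ((1 + t) ^ (-K / 2)) *
          weightedNorm K (u t)) + ENNReal.ofReal (t ^ ((N : ℝ) / 2)) * eLpNorm (u t) ∞ volume +
        ENNReal.ofReal (Real.sqrt t) * (ENNReal.ofReal (2 ^ K) * (weightedNorm 0 (du t) +
          ENNReal.ofReal ((1 + t) ^ (-K / 2)) * weightedNorm K (du t)) +
          ENNReal.ofReal (t ^ ((N : ℝ) / 2)) * eLpNorm (du t) ∞ volume) :=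
        add_le_add (add_le_add w₁ le_rfl) (mul_le_mul_right (add_le_add w₂ le_rfl) _)
    _ = ENNReal.ofReal (2 ^ K) * ((weightedNorm 0 (u t) + ENNReal.ofReal (Real.sqrt t) *
          weightedNorm 0 (du t)) + ENNReal.ofReal ((1 + t) ^ (-K / 2)) *
          (weightedNorm K (u t) + ENNReal.ofReal (Real.sqrt t) * weightedNorm K (du t))) +
        ENNReal.ofReal (t ^ ((N : ℝ) / 2)) * (eLpNorm (u t) ∞ volume +
          ENNReal.ofReal (Real.sqrt t) * eLpNorm (du t) ∞ volume) := by ring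
    _ ≤ _ := add_le_add (mul_le_mul_right (add_le_add k₂ k₃) _) k₁

/-- The hypothesis weighs the gradient by `(1 + s)^{1/2}`, whereas `pnorm` weighs it by `√s`. The
quotient of the two turns `(1 + s)^{-A}` into `beta (A - 1) s` and is the origin of the singularity
at `s = 0`. -/
lemma star_le_beta_mul_pnorm {K A C : ℝ} (hC : 0 ≤ C) {s : ℝ} (hs : 0 < s) {g f : E N → ℝ}
    {df : E N → E N} (hf : AEStronglyMeasurable f) (hdf : AEStronglyMeasurable df)
    (h : ∀ᵐ x, |g x| ≤ C * (1 + s) ^ (-A) * (|f x| + (1 + s) ^ (1 / 2 : ℝ) * ‖df x‖)) :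
    star K s g ≤ ENNReal.ofReal (C * beta (A - 1) s) * pnorm K s f df := by
  have h1s : (0 : ℝ) < 1 + s := by linarith
  set a := C * (1 + s) ^ (-A)
  set b := (1 + s) ^ (1 / 2 : ℝ)
  have ha : 0 ≤ a := by positivity
  have hb : 0 ≤ b := by positivity
  have e1 : star K s g ≤ star K s fun x => a * (|f x| + b * ‖df x‖) :=
    star_mono_enorm (h.mono fun x hx => by
      rw [← ofReal_norm, ← ofReal_norm]
      exact ENNReal.ofReal_le_ofReal (hx.trans (le_abs_self _)))
  have e2 : star K s (fun x => |f x|) = star K s f :=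
    le_antisymm (star_mono_enorm (Eventually.of_forall fun x => by simp))
      (star_mono_enorm (Eventually.of_forall fun x => by simp))
  have e3 : star K s (fun x => ‖df x‖) = star K s df :=
    le_antisymm (star_mono_enorm (Eventually.of_forall fun x => by simp))
      (star_mono_enorm (Eventually.of_forall fun x => by simp))
  refine e1.trans ?_
  rw [star_const_mul, Real.enorm_of_nonneg ha]
  refine (mul_le_mul_right (star_add_le hf.norm (hdf.norm.const_mul b)) _).trans ?_
  rw [star_const_mul, Real.enorm_of_nonneg hb]
  simp only [Real.norm_eq_abs]
  rw [e2, e3, pnorm, mul_add, mul_add]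
  have hss : s ^ (-(1 / 2) : ℝ) * Real.sqrt s = 1 := by
    rw [Real.sqrt_eq_rpow, ← Real.rpow_add hs]
    norm_num
  have hbe : C * beta (A - 1) s = a * (b * s ^ (-(1 / 2) : ℝ)) := by
    simp only [a, b, beta]
    rw [show -(1 / 2) - (A - 1) = -A + 1 / 2 by ring, Real.rpow_add h1s]
    ring
  have hb1 : 1 ≤ b * s ^ (-(1 / 2) : ℝ) := by
    rw [Real.rpow_neg hs.le, ← div_eq_mul_inv, one_le_div (by positivity)]
    exact Real.rpow_le_rpow hs.le (by linarith) (by norm_num)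
  rw [hbe]
  refine add_le_add (mul_le_mul_left (ENNReal.ofReal_le_ofReal
    (le_mul_of_one_le_right ha hb1)) _) ?_
  rw [← mul_assoc, ← mul_assoc, ← ENNReal.ofReal_mul ha, ← ENNReal.ofReal_mul (by positivity)]
  refine mul_le_mul_left (ENNReal.ofReal_le_ofReal (le_of_eq ?_)) _
  linear_combination -(a * b) * hss

/-! ### The source term and the defects -/

/-- `F` is continuous only at positive times; its extension by zero is Borel. -/
lemma jointMeas_reaction {F : E N → ℝ → ℝ → E N → ℝ} (hF : ContinuousReaction F)
    {v : ℝ → E N → ℝ} {dv : ℝ → E N → E N} (hv : IsWeaklyDiff v dv) :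
    JointMeas fun s x => F x s (v s x) (dv s x) := by
  set S : Set (E N × ℝ × ℝ × E N) := {z | 0 < z.2.1}
  have hS : MeasurableSet S := (isOpen_lt continuous_const (by fun_prop)).measurableSet
  have h1 : Measurable (S.piecewise (fun z : E N × ℝ × ℝ × E N => F z.1 z.2.1 z.2.2.1 z.2.2.2) 0) :=
    ContinuousOn.measurable_piecewise hF continuousOn_const hS
  have h2 : AEMeasurable (fun p : ℝ × E N => (p.2, p.1, v p.1 p.2, dv p.1 p.2)) (spaceTime N) :=
    measurable_snd.aemeasurable.prodMk (measurable_fst.aemeasurable.prodMk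
      (hv.1.aemeasurable.prodMk hv.2.1.aemeasurable))
  refine (h1.comp_aemeasurable h2).aestronglyMeasurable.congr ?_
  have hpos : ∀ᵐ p : ℝ × E N ∂(spaceTime N), p.1 ∈ Ioi (0 : ℝ) :=
    Measure.quasiMeasurePreserving_fst.ae (ae_restrict_mem measurableSet_Ioi)
  filter_upwards [hpos] with p hp
  exact piecewise_eq_of_mem _ _ _ (show (p.2, p.1, v p.1 p.2, dv p.1 p.2) ∈ S from hp)

/-- The difference of the reaction terms of the solution and of the approximation that enters
`U_n`. -/
def defect (F : E N → ℝ → ℝ → E N → ℝ) (k : ℕ) (u : ℝ → E N → ℝ) (du : ℝ → E N → E N) :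
    ℕ → ℝ → E N → ℝ
  | 0 => fun s x => F x s (u s x) (du s x)
  | n + 1 => fun s x => F x s (u s x) (du s x) - reaction F (approx F k u n) s x

/-- The representation of `u - U_n` at the regular times. -/
def remainder (F : E N → ℝ → ℝ → E N → ℝ) (φ : E N → ℝ) (k : ℕ) (u : ℝ → E N → ℝ)
    (du : ℝ → E N → E N) (n : ℕ) : ℝ → E N → ℝ :=
  sol (proj k 0 φ) fun s => proj k s (defect F k u du n s)

/-- `r` is the known decay of `f`. Together with the coefficient of order `A` it yields every rate
`p` that keeps `r(s)(1 + s)^{p-(A-1)}` bounded. -/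
lemma hasRate_of_forall_ae {K A C p : ℝ} (hC : 0 ≤ C) {g f : ℝ → E N → ℝ} {df : ℝ → E N → E N}
    (hf : IsWeaklyDiff f df)
    (h : ∀ᵐ p ∂(spaceTime N), |g p.1 p.2| ≤
      C * (1 + p.1) ^ (-A) * (|f p.1 p.2| + (1 + p.1) ^ (1 / 2 : ℝ) * ‖df p.1 p.2‖))
    {D : ℝ} (hD : 0 ≤ D) {r : ℝ → ℝ}
    (hr : ∀ᵐ s ∂(volume.restrict (Ioi (0 : ℝ))), pnorm K s (f s) (df s) ≤ ENNReal.ofReal (D * r s))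
    (hp : ∃ c, 0 ≤ c ∧ ∀ s, 0 < s → r s * (1 + s) ^ (p - (A - 1)) ≤ c) :
    HasRate K p g := by
  obtain ⟨c, hc, hcr⟩ := hp
  refine ⟨C * D * c, by positivity, ?_⟩
  filter_upwards [Measure.ae_ae_of_ae_prod h, hr, hf.2.2, ae_restrict_mem measurableSet_Ioi]
    with s h1 h2 h3 h4
  have hs : (0 : ℝ) < s := h4
  have h1s : (0 : ℝ) < 1 + s := by linarith
  have hb := beta_nonneg p hs
  refine (star_le_beta_mul_pnorm hC hs h3.1.aestronglyMeasurable h3.2.1.aestronglyMeasurable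
    h1).trans ((mul_le_mul_right h2 _).trans ?_)
  rw [← ENNReal.ofReal_mul (mul_nonneg hC (beta_nonneg _ hs))]
  refine ENNReal.ofReal_le_ofReal ?_
  have e : beta (A - 1) s = beta p s * (1 + s) ^ (p - (A - 1)) := by
    unfold beta
    rw [mul_assoc, ← Real.rpow_add h1s]
    ring_nf
  rw [e]
  have h5 := hcr s hs
  calc _ = C * D * beta p s * (r s * (1 + s) ^ (p - (A - 1))) := by ring
    _ ≤ C * D * beta p s * c := by gcongr
    _ = _ := by ring

variable {F : E N → ℝ → ℝ → E N → ℝ} {φ : E N → ℝ} {u : ℝ → E N → ℝ} {du : ℝ → E N → E N}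
  {K A : ℝ} {k : ℕ} {n : ℕ}

lemma ConditionC.hasRate (hC : ConditionC A F u du) (hK : 0 ≤ K) (hu : IsWeaklyDiff u du)
    (hLq : LqBounds u du) (hW : WeightedBounds K u du) :
    HasRate K (A - 1) (defect F k u du 0) := by
  obtain ⟨C, hC⟩ := hC
  obtain ⟨D, hD, hb⟩ := pnorm_bounded hK hu hLq hW
  refine hasRate_of_forall_ae (A := A) (r := fun _ => 1) (abs_nonneg C) hu ?_ hD ?_
    ⟨1, zero_le_one, fun s _ => by simp⟩
  · have hpos : ∀ᵐ p : ℝ × E N ∂(spaceTime N), p.1 ∈ Ioi (0 : ℝ) :=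
      Measure.quasiMeasurePreserving_fst.ae (ae_restrict_mem measurableSet_Ioi)
    filter_upwards [hC, hpos] with p h1 h2
    have h3 : (0 : ℝ) < p.1 := h2
    refine h1.trans ?_
    gcongr
    exact le_abs_self C
  · simpa using hb

lemma ae_isRegularTime (hu : IsSolution F φ u du) :
    ∀ᵐ t ∂(volume.restrict (Ioi (0 : ℝ))), IsRegularTime F φ u du t := by
  filter_upwards [hu.1.2.2, Measure.ae_ae_of_ae_prod hu.2.2, ae_restrict_mem measurableSet_Ioi]
    with t h1 h2 h3
  exact ⟨h3, h1, h2⟩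

lemma IsRegularTime.ae_eq_sol {t : ℝ} (ht : IsRegularTime F φ u du t) :
    u t =ᵐ[volume] sol φ (defect F k u du 0) t := ht.2.2.mono fun _ hx => hx.2

lemma sol_sub (hK : 0 ≤ K) {h g : ℝ → E N → ℝ} (hh : Source K h) (hg : Source K g) {t : ℝ}
    (ht : 0 < t) (x : E N) :
    sol φ (fun s x => h s x - g s x) t x =
      sol φ h t x - ∫ s in (0 : ℝ)..t, heat (t - s) (g s) x := by
  have e : duh (gauss N) (fun _ => 1) (fun s x => h s x - g s x) t x =
      duh (gauss N) (fun _ => 1) h t x - duh (gauss N) (fun _ => 1) g t x := by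
    have hr := polyGauss_gauss.rapid quarter_pos (N := N)
    rw [duh, duh, duh, ← integral_sub
      (hh.integrableOn_duh hK polyGauss_gauss.continuous hr timeWeight_one t x)
      (hg.integrableOn_duh hK polyGauss_gauss.continuous hr timeWeight_one t x)]
    refine integral_congr_ae ?_
    filter_upwards [ae_Ioo_of_ae_Ioi (hh.ae_integrable hK) t,
      ae_Ioo_of_ae_Ioi (hg.ae_integrable hK) t] with s h1 h2
    have hb := boundedC1_dil quarter_pos (polyGauss_gauss (N := N)) (t - s)
    simp only [one_mul, conv, mul_sub]
    exact integral_sub (hb.integrable_mul h1 x) (hb.integrable_mul h2 x)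
  rw [sol_eq φ _ ht, sol_eq φ _ ht, integral_heat_eq_duh g ht]
  simp only [e]
  ring

/-- Two splittings of `u(t)` are compared, that of Duhamel's formula and that defining `M_α`;
uniqueness gives `M_α(u(t), t) = coeff`. Writing `sol` for `u(t)` makes the identity hold at every
`x`. -/
lemma IsRegularTime.momentExpansion_eq (hN : 1 ≤ N) (hK : 0 ≤ K) (hkK : (k : ℝ) ≤ K)
    (hφ : MemL1K K φ) (hh : Source K (defect F k u du 0)) {t : ℝ} (ht : IsRegularTime F φ u du t)
    (x : E N) :
    momentExpansion k t (u t) x =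
      sol φ (defect F k u du 0) t x - remainder F φ k u du 0 t x := by
  have hφm := hφ.1.aestronglyMeasurable
  have hφs := star_zero_lt_top hN hφ
  have hφM := hasMoments_of_star hkK le_rfl hφm hφs
  have hsol := sol_eq_add hK hkK hφM hh ht.1
  obtain ⟨D, hD, hd⟩ := star_proj_le (N := N) hkK
  have hps : star K 0 (proj k 0 φ) < ⊤ :=
    (hd 0 φ le_rfl hφm).trans_lt (ENNReal.mul_lt_top hD.lt_top hφs)
  have hpm : AEStronglyMeasurable (proj k 0 φ) :=
    (hasMoments_proj hφM le_rfl).integrable.aestronglyMeasurable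
  have hW : HasMoments k (remainder F φ k u du 0 t) :=
    hasMoments_sol hK hkK hpm hps (hh.proj hkK) ht.1
  have hz : ∀ᵐ s ∂(volume.restrict (Ioi (0 : ℝ))),
      ZeroMoments k (proj k s (defect F k u du 0 s)) := by
    filter_upwards [hh.ae_hasMoments hkK, ae_restrict_mem measurableSet_Ioi] with s h1 h2
    exact zeroMoments_proj h1 (le_of_lt h2)
  have hW0 : ZeroMoments k (remainder F φ k u du 0 t) :=
    zeroMoments_sol hK hkK hpm hps (zeroMoments_proj hφM le_rfl) (hh.proj hkK) hz ht.1
  have hm : ∀ α ∈ multiIndices N k, moment (u t) t α = coeff φ (defect F k u du 0) t α :=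
    fun α hα => moment_eq_of_decomposition hW hW0 ht.1.le _
      (ht.ae_eq_sol.trans (Eventually.of_forall hsol)) (mem_multiIndices.1 hα)
  rw [hsol x, momentExpansion, Finset.sum_congr rfl fun α hα => by rw [hm α hα]]
  exact (add_sub_cancel_left _ _).symm

variable {F : E N → ℝ → ℝ → E N → ℝ} {φ : E N → ℝ} {u : ℝ → E N → ℝ} {du : ℝ → E N → E N}
  {K A : ℝ} {k : ℕ} {n : ℕ}

/-! ### The approximations at a fixed time -/

lemma sol_congr {h g : ℝ → E N → ℝ}
    (hg : ∀ᵐ s ∂(volume.restrict (Ioi (0 : ℝ))), h s =ᵐ[volume] g s) {t : ℝ} (ht : 0 < t) :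
    sol φ h t = sol φ g t := by
  rw [sol_eq φ h ht, sol_eq φ g ht, duh_congr hg]

/-- `F_n` is `F(u)` minus the next defect, hence inherits the bounds of a source. -/
lemma Source.reaction_approx (hh : Source K (defect F k u du 0))
    (hd : Source K (defect F k u du (n + 1))) : Source K (reaction F (approx F k u n)) := by
  have := hh.sub hd
  simpa only [defect, sub_sub_cancel] using this

/-- Linearity of `P_k(s)` and of Duhamel's integral merges the correction in `U_n` with the
remainder of `U_0`. -/
lemma IsRegularTime.approx_eq (hN : 1 ≤ N) (hK : 0 ≤ K) (hkK : (k : ℝ) ≤ K)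
    (hφ : MemL1K K φ) (hh : Source K (defect F k u du 0)) (hd : Source K (defect F k u du n)) {t : ℝ}
    (ht : IsRegularTime F φ u du t) (x : E N) :
    approx F k u n t x = sol φ (defect F k u du 0) t x - remainder F φ k u du n t x := by
  cases n with
  | zero => exact ht.momentExpansion_eq hN hK hkK hφ hh x
  | succ n =>
    have hg := hh.reaction_approx hd
    have e : remainder F φ k u du (n + 1) t x = remainder F φ k u du 0 t x -
        ∫ s in (0 : ℝ)..t, heat (t - s) (proj k s (reaction F (approx F k u n) s)) x := by
      rw [remainder, remainder, ← sol_sub hK (hh.proj hkK) (hg.proj hkK) ht.1]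
      refine congrFun (sol_congr ?_ ht.1) x
      filter_upwards [hh.ae_hasMoments hkK, hg.ae_hasMoments hkK, ae_restrict_mem measurableSet_Ioi]
        with s h1 h2 h3
      exact (proj_sub h1 h2 (le_of_lt h3)).eventuallyEq
    simp only [e, approx, ht.momentExpansion_eq hN hK hkK hφ hh x]
    ring

lemma contDiff_momentExpansion (k : ℕ) (t : ℝ) (f : E N → ℝ) :
    ContDiff ℝ 1 (momentExpansion k t f) := by
  unfold momentExpansion
  exact ContDiff.sum fun α _ =>
    contDiff_const.mul ((polyGauss_gKernel α t).contDiff.of_le (by simp))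

/-- Regularity of `t` plays no role: the moment expansion is smooth whatever its coefficients are.
-/
lemma contDiff_approx (hK : 0 ≤ K) (hkK : (k : ℝ) ≤ K) (hh : Source K (defect F k u du 0))
    (hd : Source K (defect F k u du n)) {t : ℝ} (ht : 0 < t) : ContDiff ℝ 1 (approx F k u n t) := by
  cases n with
  | zero => exact contDiff_momentExpansion k t (u t)
  | succ n =>
    have hg := (hh.reaction_approx hd).proj hkK
    refine (contDiff_momentExpansion k t (u t)).add ?_
    simp only [integral_heat_eq_duh (fun s => proj k s (reaction F (approx F k u n) s)) ht]
    exact hg.contDiff_duh hK quarter_pos polyGauss_gauss t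

lemma gradient_sub {f g : E N → ℝ} (hf : ContDiff ℝ 1 f) (hg : ContDiff ℝ 1 g) (x : E N) :
    gradient (fun x => f x - g x) x = gradient f x - gradient g x := by
  simp only [gradient]
  rw [← map_sub, fderiv_fun_sub (hf.differentiable one_ne_zero x) (hg.differentiable one_ne_zero x)]

lemma pnorm_sub_le {t : ℝ} {f g : E N → ℝ} (hf : ContDiff ℝ 1 f) (hg : ContDiff ℝ 1 g) :
    pnorm K t (fun x => f x - g x) (gradient fun x => f x - g x) ≤
      pnorm K t f (gradient f) + pnorm K t g (gradient g) := by
  have e : gradient (fun x => f x - g x) = fun x => gradient f x - gradient g x :=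
    funext (gradient_sub hf hg)
  have h1 := star_sub_le (K := K) (s := t) hf.continuous.aestronglyMeasurable
    hg.continuous.aestronglyMeasurable
  have h2 := star_sub_le (K := K) (s := t) (continuous_gradient hf).aestronglyMeasurable
    (continuous_gradient hg).aestronglyMeasurable
  rw [e]
  unfold pnorm
  refine (add_le_add h1 (mul_le_mul_right h2 _)).trans (le_of_eq ?_)
  ring

/-! ### The induction -/

/-- The hypotheses of the expansion theorem that do not involve `n`. -/
structure Setting (F : E N → ℝ → ℝ → E N → ℝ) (φ : E N → ℝ) (u : ℝ → E N → ℝ)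
    (du : ℝ → E N → E N) (K A : ℝ) : Prop where
  hN : 1 ≤ N
  hK : 0 ≤ K
  hA : 1 < A
  hF : ContinuousReaction F
  hφ : MemL1K K φ
  hu : IsSolution F φ u du
  hLq : LqBounds u du
  hW : WeightedBounds K u du
  hC : ConditionC A F u du

/-- The decay of the `n`-th defect. -/
structure DefectBound (F : E N → ℝ → ℝ → E N → ℝ) (u : ℝ → E N → ℝ)
    (du : ℝ → E N → E N) (K A : ℝ) (n : ℕ) (p : ℝ) : Prop where
  meas : JointMeas (defect F ⌊K⌋₊ u du n)
  pos : 0 < p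
  rate : HasRate K p (defect F ⌊K⌋₊ u du n)
  -- Up to the threshold `K / 2` the exact rate enters the error bound; beyond it only `p > K / 2`
  -- matters.
  eq_of_le : (n + 1) * (A - 1) ≤ K / 2 → p = (n + 1) * (A - 1)
  lt_of_lt : K / 2 < (n + 1) * (A - 1) → K / 2 < p

lemma DefectBound.source {p : ℝ} (h : DefectBound F u du K A n p) :
    Source K (defect F ⌊K⌋₊ u du n) := h.rate.source h.pos h.meas

namespace Setting

lemma floor_le (S : Setting F φ u du K A) : (⌊K⌋₊ : ℝ) ≤ K := Nat.floor_le S.hK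

lemma star_proj_lt_top (S : Setting F φ u du K A) : star K 0 (proj ⌊K⌋₊ 0 φ) < ⊤ := by
  obtain ⟨D, hD, hd⟩ := star_proj_le (N := N) S.floor_le
  exact (hd 0 φ le_rfl S.hφ.1.aestronglyMeasurable).trans_lt
    (ENNReal.mul_lt_top hD.lt_top (star_zero_lt_top S.hN S.hφ))

lemma hasMoments (S : Setting F φ u du K A) : HasMoments ⌊K⌋₊ φ :=
  hasMoments_of_star S.floor_le le_rfl S.hφ.1.aestronglyMeasurable (star_zero_lt_top S.hN S.hφ)

lemma defectBound_zero (S : Setting F φ u du K A) : DefectBound F u du K A 0 (A - 1) := by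
  refine ⟨jointMeas_reaction S.hF S.hu.1, by linarith [S.hA],
    S.hC.hasRate S.hK S.hu.1 S.hLq S.hW, fun _ => by simp, fun h => by simpa using h⟩

lemma contDiff_sol (S : Setting F φ u du K A) {t : ℝ} (ht : 0 < t) :
    ContDiff ℝ 1 (sol φ (defect F ⌊K⌋₊ u du 0) t) :=
  ParabolicExpansion.contDiff_sol S.hK S.hφ.1 S.defectBound_zero.source ht

lemma contDiff_remainder (S : Setting F φ u du K A) {p : ℝ} (h : DefectBound F u du K A n p)
    {t : ℝ} (ht : 0 < t) : ContDiff ℝ 1 (remainder F φ ⌊K⌋₊ u du n t) :=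
  ParabolicExpansion.contDiff_sol S.hK (hasMoments_proj S.hasMoments le_rfl).integrable
    (h.source.proj S.floor_le) ht

lemma approx_eq (S : Setting F φ u du K A) {p : ℝ} (h : DefectBound F u du K A n p)
    {t : ℝ} (ht : IsRegularTime F φ u du t) : approx F ⌊K⌋₊ u n t = fun x =>
      sol φ (defect F ⌊K⌋₊ u du 0) t x - remainder F φ ⌊K⌋₊ u du n t x :=
  funext (ht.approx_eq S.hN S.hK S.floor_le S.hφ S.defectBound_zero.source h.source)

lemma error_ae_eq (S : Setting F φ u du K A) {p : ℝ} (h : DefectBound F u du K A n p)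
    {t : ℝ} (ht : IsRegularTime F φ u du t) :
    (fun x => u t x - approx F ⌊K⌋₊ u n t x) =ᵐ[volume] remainder F φ ⌊K⌋₊ u du n t ∧
    (fun x => du t x - gradient (approx F ⌊K⌋₊ u n t) x) =ᵐ[volume]
      gradient (remainder F φ ⌊K⌋₊ u du n t) := by
  have h1 : u t =ᵐ[volume] sol φ (defect F ⌊K⌋₊ u du 0) t := ht.ae_eq_sol
  have h2 := ht.2.1.ae_eq_gradient (S.contDiff_sol ht.1) h1
  rw [S.approx_eq h ht]
  constructor
  · filter_upwards [h1] with x hx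
    rw [hx, sub_sub_cancel]
  · filter_upwards [h2] with x hx
    rw [hx, gradient_sub (S.contDiff_sol ht.1) (S.contDiff_remainder h ht.1), sub_sub_cancel]

lemma ae_zeroMoments (S : Setting F φ u du K A) {p : ℝ} (h : DefectBound F u du K A n p) :
    ∀ᵐ s ∂(volume.restrict (Ioi (0 : ℝ))),
      ZeroMoments ⌊K⌋₊ (proj ⌊K⌋₊ s (defect F ⌊K⌋₊ u du n s)) := by
  filter_upwards [h.source.ae_hasMoments S.floor_le, ae_restrict_mem measurableSet_Ioi] with s h1 h2
  exact zeroMoments_proj h1 (le_of_lt h2)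

lemma pnorm_error_le (S : Setting F φ u du K A) {p : ℝ} (h : DefectBound F u du K A n p)
    {t : ℝ} (ht : IsRegularTime F φ u du t) :
    pnorm K t (fun x => u t x - approx F ⌊K⌋₊ u n t x)
      (fun x => du t x - gradient (approx F ⌊K⌋₊ u n t) x) ≤
        dnorm K t (remainder F φ ⌊K⌋₊ u du n t) := by
  obtain ⟨h1, h2⟩ := S.error_ae_eq h ht
  rw [pnorm_congr h1 h2]
  exact pnorm_gradient_le_dnorm K t (S.contDiff_remainder h ht.1)

lemma exists_error_le (S : Setting F φ u du K A) {p : ℝ} (h : DefectBound F u du K A n p) :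
    ∃ C : ℝ, 0 ≤ C ∧ ∀ t, IsRegularTime F φ u du t →
      pnorm K t (fun x => u t x - approx F ⌊K⌋₊ u n t x)
        (fun x => du t x - gradient (approx F ⌊K⌋₊ u n t) x) ≤
        ENNReal.ofReal (C * ((1 + t) ^ (-K / 2) * growth (p - K / 2) t)) := by
  obtain ⟨C, hC, hb⟩ := dnorm_sol_le_of_zeroMoments_of_hasRate S.hK S.floor_le
    (Nat.lt_floor_add_one K).le (hasMoments_proj S.hasMoments le_rfl)
    (zeroMoments_proj S.hasMoments le_rfl) S.star_proj_lt_top (h.meas.proj ⌊K⌋₊)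
    (S.ae_zeroMoments h) h.pos (h.rate.proj S.floor_le h.meas)
  exact ⟨C, hC, fun t ht => (S.pnorm_error_le h ht).trans (hb t ht.1)⟩

lemma exists_approx_le (S : Setting F φ u du K A) {p : ℝ} (h : DefectBound F u du K A n p) :
    ∃ C : ℝ, 0 ≤ C ∧ ∀ t, IsRegularTime F φ u du t →
      pnorm K t (approx F ⌊K⌋₊ u n t) (gradient (approx F ⌊K⌋₊ u n t)) ≤ ENNReal.ofReal C := by
  obtain ⟨C, hC, hb⟩ := dnorm_sol_le_of_hasRate S.hK S.hφ.1 (star_zero_lt_top S.hN S.hφ)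
    S.defectBound_zero.meas S.defectBound_zero.pos S.defectBound_zero.rate
  obtain ⟨D, hD, hd⟩ := dnorm_sol_le_of_hasRate S.hK
    (hasMoments_proj S.hasMoments le_rfl).integrable S.star_proj_lt_top (h.meas.proj ⌊K⌋₊) h.pos
    (h.rate.proj S.floor_le h.meas)
  refine ⟨C + D, by positivity, fun t ht => ?_⟩
  rw [S.approx_eq h ht, ENNReal.ofReal_add hC hD]
  exact (pnorm_sub_le (S.contDiff_sol ht.1) (S.contDiff_remainder h ht.1)).trans
    (add_le_add ((pnorm_gradient_le_dnorm K t (S.contDiff_sol ht.1)).trans (hb t ht.1))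
      ((pnorm_gradient_le_dnorm K t (S.contDiff_remainder h ht.1)).trans (hd t ht.1)))

lemma jointMeas_approx (S : Setting F φ u du K A) {p : ℝ} (h : DefectBound F u du K A n p) :
    JointMeas (approx F ⌊K⌋₊ u n) := by
  have hR : JointMeas (remainder F φ ⌊K⌋₊ u du n) :=
    jointMeas_sol (hasMoments_proj S.hasMoments le_rfl).integrable.aestronglyMeasurable
      (h.meas.proj ⌊K⌋₊)
  have hV : JointMeas (sol φ (defect F ⌊K⌋₊ u du 0)) :=
    jointMeas_sol S.hφ.1.aestronglyMeasurable S.defectBound_zero.meas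
  refine (hV.sub hR).congr ?_
  have hreg : ∀ᵐ p : ℝ × E N ∂(spaceTime N), IsRegularTime F φ u du p.1 :=
    Measure.quasiMeasurePreserving_fst.ae (ae_isRegularTime S.hu)
  filter_upwards [hreg] with p hp
  rw [S.approx_eq h hp]

lemma contDiff_approx (S : Setting F φ u du K A) {p : ℝ} (h : DefectBound F u du K A n p) {t : ℝ}
    (ht : 0 < t) : ContDiff ℝ 1 (approx F ⌊K⌋₊ u n t) :=
  ParabolicExpansion.contDiff_approx S.hK S.floor_le S.defectBound_zero.source h.source ht

lemma isWeaklyDiff_approx (S : Setting F φ u du K A) {p : ℝ} (h : DefectBound F u du K A n p) :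
    IsWeaklyDiff (approx F ⌊K⌋₊ u n) fun t => gradient (approx F ⌊K⌋₊ u n t) :=
  isWeaklyDiff_gradient (S.jointMeas_approx h) fun _ ht => S.contDiff_approx h ht

/-- Makes `U_n` admissible in `(F_A)`, which speaks of members of `𝒮` only. -/
lemma memS_approx (S : Setting F φ u du K A) {p : ℝ} (h : DefectBound F u du K A n p) :
    MemS (approx F ⌊K⌋₊ u n) fun t => gradient (approx F ⌊K⌋₊ u n t) := by
  obtain ⟨C, hC, hb⟩ := S.exists_approx_le h
  refine ⟨S.isWeaklyDiff_approx h, C, ?_⟩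
  filter_upwards [ae_isRegularTime S.hu] with t ht
  have e : decayExp N ∞ = (N : ℝ) / 2 := by simp [decayExp]
  rw [← e]
  exact (ofReal_mul_add_eLpNorm_le S.hK le_top ht.1 _ _).trans (hb t ht)

lemma memS_solution (S : Setting F φ u du K A) : MemS u du := by
  obtain ⟨C, hC⟩ := S.hLq ∞ le_top
  refine ⟨S.hu.1, C, ?_⟩
  simpa [decayExp] using hC

end Setting

lemma growth_zero_le {σ : ℝ} (hσ : 0 < σ) :
    ∃ C : ℝ, 0 ≤ C ∧ ∀ t : ℝ, 0 < t → growth 0 t ≤ C * (1 + t) ^ σ := by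
  refine ⟨2 ^ σ / σ, by positivity, fun t ht => ?_⟩
  rw [growth, if_neg (lt_irrefl _), if_pos rfl]
  calc Real.log (2 + t) ≤ (2 + t) ^ σ / σ := Real.log_le_rpow_div (by linarith) hσ
    _ ≤ (2 * (1 + t)) ^ σ / σ := by gcongr; linarith
    _ = _ := by rw [Real.mul_rpow zero_le_two (by linarith)]; ring

lemma growth_of_neg {q : ℝ} (hq : q < 0) (t : ℝ) : growth q t = (1 + t) ^ (-q) := by
  rw [growth, if_neg (by linarith), if_neg hq.ne]

/-- `(F_A)` applied to `u` and `U_n` bounds the next defect by the present error, with a coefficient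
that improves the rate by `A - 1`. -/
lemma Setting.defectBound_succ (S : Setting F φ u du K A) (hFA : ConditionF A F) {p : ℝ}
    (h : DefectBound F u du K A n p) : ∃ p', DefectBound F u du K A (n + 1) p' := by
  have hA : 0 < A - 1 := by linarith [S.hA]
  have hm : JointMeas (defect F ⌊K⌋₊ u du (n + 1)) :=
    (jointMeas_reaction S.hF S.hu.1).sub (jointMeas_reaction S.hF (S.isWeaklyDiff_approx h))
  obtain ⟨C, hC⟩ := hFA.2 _ _ _ _ S.memS_solution (S.memS_approx h)
  obtain ⟨D, hD, hd⟩ := S.exists_error_le h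
  have hpos : ∀ᵐ p : ℝ × E N ∂(spaceTime N), p.1 ∈ Ioi (0 : ℝ) :=
    Measure.quasiMeasurePreserving_fst.ae (ae_restrict_mem measurableSet_Ioi)
  have hd' : IsWeaklyDiff (fun t x => u t x - approx F ⌊K⌋₊ u n t x)
      (fun t x => du t x - gradient (approx F ⌊K⌋₊ u n t) x) := by
    have h1 := S.hu.1
    have h2 := S.isWeaklyDiff_approx h
    refine ⟨h1.1.sub h2.1, h1.2.1.sub h2.2.1, ?_⟩
    filter_upwards [ae_isRegularTime S.hu] with t ht
    obtain ⟨e1, e2⟩ := S.error_ae_eq h ht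
    exact (hasWeakGradient_gradient (S.contDiff_remainder h ht.1)).congr e1.symm e2.symm
  have key : ∀ p', (∃ c, 0 ≤ c ∧ ∀ s : ℝ, 0 < s →
      (1 + s) ^ (-K / 2) * growth (p - K / 2) s * (1 + s) ^ (p' - (A - 1)) ≤ c) →
      HasRate K p' (defect F ⌊K⌋₊ u du (n + 1)) := by
    intro p' hp'
    refine hasRate_of_forall_ae (A := A) (abs_nonneg C) hd' ?_ hD ?_ hp'
    · filter_upwards [hC, hpos] with p h1 h2
      have h3 : (0 : ℝ) < p.1 := h2
      refine h1.trans ?_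
      gcongr
      exact le_abs_self C
    · filter_upwards [ae_isRegularTime S.hu] with t ht
      exact hd t ht
  have hcast : ((n + 1 : ℕ) : ℝ) = n + 1 := by push_cast; rfl
  have hmul : ((n + 1 : ℕ) + 1 : ℝ) * (A - 1) = (n + 1) * (A - 1) + (A - 1) := by
    rw [hcast]; ring
  have hn0 : 0 ≤ ((n : ℝ) + 1) * (A - 1) := by positivity
  rcases lt_trichotomy (((n : ℝ) + 1) * (A - 1)) (K / 2) with hx | hx | hx
  -- Below the threshold the error decays like `(1 + s)^{-p}`, and the new rate is `p + (A - 1)`.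
  · have hp := h.eq_of_le hx.le
    refine ⟨(n + 1) * (A - 1) + (A - 1), hm, by linarith, key _ ⟨1, zero_le_one, fun s hs => ?_⟩,
      fun _ => hmul.symm, fun h' => by rwa [hmul] at h'⟩
    have h1s : (0 : ℝ) < 1 + s := by linarith
    rw [growth_of_neg (by linarith), ← Real.rpow_add h1s, ← Real.rpow_add h1s, hp]
    exact le_of_eq ((congrArg _ (by ring)).trans (Real.rpow_zero (1 + s)))
  -- At the threshold half of `A - 1` pays for the logarithm, and the other half keeps the rate
  -- above `K / 2`.
  · have hp := h.eq_of_le hx.le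
    obtain ⟨c, hc, hg⟩ := growth_zero_le (half_pos hA)
    refine ⟨K / 2 + (A - 1) / 2, hm, by linarith [S.hK], key _ ⟨c, hc, fun s hs => ?_⟩,
      fun h' => by rw [hmul] at h'; linarith, fun _ => by linarith⟩
    have h1s : (0 : ℝ) < 1 + s := by linarith
    rw [hp, hx, sub_self]
    calc _ ≤ (1 + s) ^ (-K / 2) * (c * (1 + s) ^ ((A - 1) / 2)) *
          (1 + s) ^ (K / 2 + (A - 1) / 2 - (A - 1)) := by gcongr; exact hg s hs
      _ = c * ((1 + s) ^ (-K / 2) * (1 + s) ^ ((A - 1) / 2) *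
          (1 + s) ^ (K / 2 + (A - 1) / 2 - (A - 1))) := by ring
      _ = c := by
          rw [← Real.rpow_add h1s, ← Real.rpow_add h1s, show -K / 2 + (A - 1) / 2 +
            (K / 2 + (A - 1) / 2 - (A - 1)) = 0 by ring, Real.rpow_zero, mul_one]
  -- Above the threshold the error is only known to decay like `(1 + s)^{-K/2}`, so the rate
  -- obtained is `K / 2 + (A - 1)` at every further stage.
  · have hp := h.lt_of_lt hx
    refine ⟨K / 2 + (A - 1), hm, by linarith [S.hK], key _ ⟨1, zero_le_one, fun s hs => ?_⟩,
      fun h' => by rw [hmul] at h'; linarith, fun _ => by linarith⟩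
    have h1s : (0 : ℝ) < 1 + s := by linarith
    rw [growth_of_pos (by linarith), mul_one, ← Real.rpow_add h1s]
    exact le_of_eq ((congrArg _ (by ring)).trans (Real.rpow_zero (1 + s)))

lemma Setting.exists_defectBound (S : Setting F φ u du K A) (n : ℕ)
    (hFA : 1 ≤ n → ConditionF A F) : ∃ p, DefectBound F u du K A n p := by
  induction n with
  | zero => exact ⟨A - 1, S.defectBound_zero⟩
  | succ n ih =>
    obtain ⟨p, hp⟩ := ih fun _ => hFA (by omega)
    exact S.defectBound_succ (hFA (by omega)) hp

/-! ### Error bounds and well-definedness for fixed `n`. -/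

variable {F : E N → ℝ → ℝ → E N → ℝ} {φ : E N → ℝ} {u : ℝ → E N → ℝ} {du : ℝ → E N → E N}
  {K A : ℝ} {n : ℕ}

namespace Setting

/-- Deduced from Duhamel's formula at the given time; the essential-supremum hypotheses say nothing
about an individual `t`. -/
lemma memL1K (S : Setting F φ u du K A) {t : ℝ} (ht : IsRegularTime F φ u du t) :
    MemL1K K (u t) := by
  obtain ⟨C, -, hb⟩ := dnorm_sol_le_of_hasRate S.hK S.hφ.1 (star_zero_lt_top S.hN S.hφ)
    S.defectBound_zero.meas S.defectBound_zero.pos S.defectBound_zero.rate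
  refine memL1K_of_star_lt_top S.hK ht.1.le ht.2.1.1.aestronglyMeasurable ?_
  rw [star_congr (ht.ae_eq_sol (k := ⌊K⌋₊))]
  exact ((star_le_ostar K t _).trans le_self_add).trans_lt
    ((hb t ht.1).trans_lt ENNReal.ofReal_lt_top)

lemma approxWellDefined (S : Setting F φ u du K A) (hFA : 1 ≤ n → ConditionF A F) :
    ApproxWellDefined F φ K u du n := by
  obtain ⟨p, h⟩ := S.exists_defectBound n hFA
  refine ⟨fun t ht => S.memL1K ht, fun m hm => ?_, fun t ht => S.contDiff_approx h ht⟩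
  -- The defect of index `m + 1 ≤ n` is the one that contains `F_m`.
  obtain ⟨p', h'⟩ := S.exists_defectBound (m + 1) fun _ => hFA (by omega)
  have hg := S.defectBound_zero.source.reaction_approx h'.source
  refine ⟨?_, fun t x _ => (hg.proj S.floor_le).integrableOn_kernel S.hK x⟩
  filter_upwards [hg.ae_star_lt_top, hg.meas.ae_aestronglyMeasurable,
    ae_restrict_mem measurableSet_Ioi] with s h1 h2 h3
  exact memL1K_of_star_lt_top S.hK (le_of_lt h3) h2 h1

lemma exists_error_le_add (S : Setting F φ u du K A) (hFA : 1 ≤ n → ConditionF A F)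
    (hne : 2 * (n + 1) * (A - 1) ≠ K) :
    ∃ C : ℝ, 0 ≤ C ∧ ∀ t, IsRegularTime F φ u du t →
      pnorm K t (fun x => u t x - approx F ⌊K⌋₊ u n t x)
        (fun x => du t x - gradient (approx F ⌊K⌋₊ u n t) x) ≤
        ENNReal.ofReal (C * ((1 + t) ^ (-K / 2) + (1 + t) ^ (-((n + 1) * (A - 1))))) := by
  obtain ⟨p, h⟩ := S.exists_defectBound n hFA
  obtain ⟨C, hC, hb⟩ := S.exists_error_le h
  refine ⟨C, hC, fun t ht => (hb t ht).trans (ENNReal.ofReal_le_ofReal ?_)⟩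
  have h1t : (0 : ℝ) < 1 + t := by linarith [ht.1]
  refine mul_le_mul_of_nonneg_left ?_ hC
  have e1 : 0 ≤ (1 + t) ^ (-K / 2) := by positivity
  have e2 : 0 ≤ (1 + t) ^ (-((n + 1) * (A - 1))) := by positivity
  rcases lt_or_gt_of_ne hne with hlt | hgt
  · have hp := h.eq_of_le (by linarith)
    rw [growth_of_neg (by linarith), ← Real.rpow_add h1t, hp,
      show -K / 2 + -((n + 1) * (A - 1) - K / 2) = -((n + 1) * (A - 1)) by ring]
    linarith
  · rw [growth_of_pos (by linarith [h.lt_of_lt (by linarith)])]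
    linarith

lemma exists_error_le_log (S : Setting F φ u du K A) (hFA : 1 ≤ n → ConditionF A F)
    (heq : 2 * (n + 1) * (A - 1) = K) :
    ∃ C : ℝ, 0 ≤ C ∧ ∀ t, IsRegularTime F φ u du t →
      pnorm K t (fun x => u t x - approx F ⌊K⌋₊ u n t x)
        (fun x => du t x - gradient (approx F ⌊K⌋₊ u n t) x) ≤
        ENNReal.ofReal (C * ((1 + t) ^ (-K / 2) * Real.log (2 + t))) := by
  obtain ⟨p, h⟩ := S.exists_defectBound n hFA
  obtain ⟨C, hC, hb⟩ := S.exists_error_le h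
  refine ⟨C, hC, fun t ht => (hb t ht).trans_eq ?_⟩
  rw [growth, if_neg (by linarith [h.eq_of_le (by linarith)]),
    if_pos (by linarith [h.eq_of_le (by linarith)])]

/-- The power `σ` is spent only in the critical case, to absorb the logarithm. -/
lemma exists_error_le_rpow (S : Setting F φ u du K A) (hFA : 1 ≤ n → ConditionF A F)
    {σ : ℝ} (hσ : 0 < σ) :
    ∃ C : ℝ, 0 ≤ C ∧ ∀ t, IsRegularTime F φ u du t →
      pnorm K t (fun x => u t x - approx F ⌊K⌋₊ u n t x)
        (fun x => du t x - gradient (approx F ⌊K⌋₊ u n t) x) ≤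
        ENNReal.ofReal (C * ((1 + t) ^ (-K / 2 + σ) + (1 + t) ^ (-((n + 1) * (A - 1))))) := by
  by_cases hne : 2 * (n + 1) * (A - 1) = K
  · obtain ⟨C, hC, hb⟩ := S.exists_error_le_log hFA hne
    obtain ⟨D, hD, hd⟩ := growth_zero_le hσ
    refine ⟨C * D, by positivity, fun t ht => (hb t ht).trans (ENNReal.ofReal_le_ofReal ?_)⟩
    have h1t : (0 : ℝ) < 1 + t := by linarith [ht.1]
    have h2 := hd t ht.1
    rw [growth, if_neg (lt_irrefl _), if_pos rfl] at h2
    have e2 : 0 ≤ (1 + t) ^ (-((n + 1) * (A - 1))) := by positivity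
    calc C * ((1 + t) ^ (-K / 2) * Real.log (2 + t))
        ≤ C * ((1 + t) ^ (-K / 2) * (D * (1 + t) ^ σ)) := by gcongr
      _ = C * D * (1 + t) ^ (-K / 2 + σ) := by rw [Real.rpow_add h1t]; ring
      _ ≤ _ := mul_le_mul_of_nonneg_left (by linarith) (by positivity)
  · obtain ⟨C, hC, hb⟩ := S.exists_error_le_add hFA hne
    refine ⟨C, hC, fun t ht => (hb t ht).trans (ENNReal.ofReal_le_ofReal ?_)⟩
    have ht0 := ht.1
    gcongr
    · linarith
    · linarith

lemma exists_error_le_of_lt (S : Setting F φ u du K A) (hFA : 1 ≤ n → ConditionF A F)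
    (hlt : K < 2 * (n + 1) * (A - 1)) {ε : ℝ} (hε : 0 < ε) :
    ∃ T : ℝ, ∀ t, T ≤ t → IsRegularTime F φ u du t →
      pnorm K t (fun x => u t x - approx F ⌊K⌋₊ u n t x)
        (fun x => du t x - gradient (approx F ⌊K⌋₊ u n t) x) ≤
        ENNReal.ofReal (ε * t ^ (-K / 2)) := by
  obtain ⟨p, h⟩ := S.exists_defectBound n hFA
  have hpm := hasMoments_proj S.hasMoments (le_refl (0 : ℝ))
  -- The strict inequality `K < ⌊K⌋ + 1` holds for integer and noninteger `K` alike, so the little-o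
  -- does too.
  have hlim := tendsto_dnorm_sol S.hK S.floor_le (Nat.lt_floor_add_one K) hpm
    (zeroMoments_proj S.hasMoments le_rfl) hpm.integrable.aestronglyMeasurable S.star_proj_lt_top
    (h.meas.proj ⌊K⌋₊) (S.ae_zeroMoments h) (h.lt_of_lt (by linarith))
    (h.rate.proj S.floor_le h.meas)
  obtain ⟨T, hT⟩ := eventually_atTop.1
    (hlim.eventually (ge_mem_nhds (ENNReal.ofReal_pos.2 hε)))
  refine ⟨T, fun t hTt ht => (S.pnorm_error_le h ht).trans ?_⟩
  have h1 := hT t hTt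
  have h2 : ENNReal.ofReal (t ^ (-K / 2)) * ENNReal.ofReal (t ^ (K / 2)) = 1 := by
    have := ht.1
    rw [← ENNReal.ofReal_mul (by positivity), ← Real.rpow_add ht.1, neg_div, neg_add_cancel,
      Real.rpow_zero, ENNReal.ofReal_one]
  calc dnorm K t (remainder F φ ⌊K⌋₊ u du n t)
      = ENNReal.ofReal (t ^ (-K / 2)) * (ENNReal.ofReal (t ^ (K / 2)) *
          dnorm K t (remainder F φ ⌊K⌋₊ u du n t)) := by rw [← mul_assoc, h2, one_mul]
    _ ≤ ENNReal.ofReal (t ^ (-K / 2)) * ENNReal.ofReal ε := mul_le_mul_right h1 _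
    _ = _ := by rw [mul_comm, ENNReal.ofReal_mul hε.le]

end Setting

end ParabolicExpansion

end

theorem theorem4p1 (N : ℕ) (hN : 1 ≤ N) (K A : ℝ) (hK : 0 ≤ K) (hA : 1 < A)
    (F : E N → ℝ → ℝ → E N → ℝ) (hF : ContinuousReaction F)
    (φ : E N → ℝ) (hφ : MemL1K K φ)
    (u : ℝ → E N → ℝ) (du : ℝ → E N → E N) (hu : IsSolution F φ u du)
    (hLq : LqBounds u du) (hW : WeightedBounds K u du) (hC : ConditionC A F u du)
    (n : ℕ) (hFA : 1 ≤ n → ConditionF A F) :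
    -- almost every time is regular, and `U_n` is well defined
    (∀ᵐ t ∂(volume.restrict (Ioi (0 : ℝ))), IsRegularTime F φ u du t) ∧
    ApproxWellDefined F φ K u du n ∧
    -- (i)
    (∀ q : ℝ≥0∞, 1 ≤ q → ∃ C : ℝ, ∀ t, IsRegularTime F φ u du t →
      ENNReal.ofReal (t ^ decayExp N q) *
        (eLpNorm (approx F ⌊K⌋₊ u n t) q volume +
          ENNReal.ofReal (t ^ (1 / 2 : ℝ)) *
            eLpNorm (gradient (approx F ⌊K⌋₊ u n t)) q volume) ≤ ENNReal.ofReal C) ∧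
    (∀ l : ℝ, 0 ≤ l → l ≤ K → ∃ C : ℝ, ∀ t, IsRegularTime F φ u du t →
      ENNReal.ofReal ((1 + t) ^ (-l / 2)) *
        (weightedNorm l (approx F ⌊K⌋₊ u n t) +
          ENNReal.ofReal (t ^ (1 / 2 : ℝ)) *
            weightedNorm l (gradient (approx F ⌊K⌋₊ u n t))) ≤ ENNReal.ofReal C) ∧
    -- (ii)
    (∀ (q : ℝ≥0∞) (j : Fin 2), 1 ≤ q →
      (2 * (n + 1) * (A - 1) ≠ K → ∃ C : ℝ, ∀ t, IsRegularTime F φ u du t →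
        ENNReal.ofReal (t ^ (decayExp N q + (j : ℝ) / 2)) * errorLq F ⌊K⌋₊ u du n j q t ≤
          ENNReal.ofReal (C * ((1 + t) ^ (-K / 2) + (1 + t) ^ (-((n + 1) * (A - 1)))))) ∧
      (2 * (n + 1) * (A - 1) = K → ∃ C : ℝ, ∀ t, IsRegularTime F φ u du t →
        ENNReal.ofReal (t ^ (decayExp N q + (j : ℝ) / 2)) * errorLq F ⌊K⌋₊ u du n j q t ≤
          ENNReal.ofReal (C * ((1 + t) ^ (-K / 2) * Real.log (2 + t))))) ∧
    -- (iii)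
    (2 * (n + 1) * (A - 1) > K → ∀ (q : ℝ≥0∞) (j : Fin 2), 1 ≤ q →
      (K = ⌊K⌋₊ → ∀ ε : ℝ, 0 < ε → ∃ T : ℝ, ∀ t, T ≤ t → IsRegularTime F φ u du t →
        ENNReal.ofReal (t ^ (decayExp N q + (j : ℝ) / 2)) * errorLq F ⌊K⌋₊ u du n j q t ≤
          ENNReal.ofReal (ε * t ^ (-K / 2))) ∧
      (K > ⌊K⌋₊ → ∃ C T : ℝ, ∀ t, T ≤ t → IsRegularTime F φ u du t →
        ENNReal.ofReal (t ^ (decayExp N q + (j : ℝ) / 2)) * errorLq F ⌊K⌋₊ u du n j q t ≤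
          ENNReal.ofReal (C * t ^ (-K / 2)))) ∧
    -- (iv)
    (∀ (l σ : ℝ) (j : Fin 2), 0 ≤ l → l ≤ K → 0 < σ →
      ∃ C : ℝ, ∀ t, IsRegularTime F φ u du t →
        ENNReal.ofReal (t ^ ((j : ℝ) / 2) * (1 + t) ^ (-l / 2)) *
            errorWeighted F ⌊K⌋₊ u du n j l t ≤
          ENNReal.ofReal
            (C * ((1 + t) ^ (-K / 2 + σ) + (1 + t) ^ (-((n + 1) * (A - 1)))))) := by
  have S : Setting F φ u du K A := ⟨hN, hK, hA, hF, hφ, hu, hLq, hW, hC⟩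
  obtain ⟨p, h⟩ := S.exists_defectBound n hFA
  obtain ⟨B, -, hB⟩ := S.exists_approx_le h
  refine ⟨ae_isRegularTime hu, S.approxWellDefined hFA,
    fun q hq => ⟨B, fun t ht => (ofReal_mul_add_eLpNorm_le hK hq ht.1 _ _).trans (hB t ht)⟩,
    fun l hl hlK => ⟨B, fun t ht =>
      (ofReal_mul_add_weightedNorm_le hl hlK ht.1 _ _).trans (hB t ht)⟩,
    fun q j hq => ⟨fun hne => ?_, fun heq => ?_⟩, fun hlt q j hq => ⟨fun _ ε hε => ?_, fun _ => ?_⟩,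
    fun l σ j hl hlK hσ => ?_⟩
  · obtain ⟨C, -, hb⟩ := S.exists_error_le_add hFA hne
    exact ⟨C, fun t ht => (ofReal_mul_nablaLq_le hK hq j ht.1 _ _).trans (hb t ht)⟩
  · obtain ⟨C, -, hb⟩ := S.exists_error_le_log hFA heq
    exact ⟨C, fun t ht => (ofReal_mul_nablaLq_le hK hq j ht.1 _ _).trans (hb t ht)⟩
  · obtain ⟨T, hb⟩ := S.exists_error_le_of_lt hFA hlt hε
    exact ⟨T, fun t hTt ht => (ofReal_mul_nablaLq_le hK hq j ht.1 _ _).trans (hb t hTt ht)⟩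
  -- The little-o estimate with `ε = 1` contains the `O` bound.
  · obtain ⟨T, hb⟩ := S.exists_error_le_of_lt hFA hlt one_pos
    exact ⟨1, T, fun t hTt ht => (ofReal_mul_nablaLq_le hK hq j ht.1 _ _).trans (hb t hTt ht)⟩
  · obtain ⟨C, -, hb⟩ := S.exists_error_le_rpow (n := n) hFA hσ
    exact ⟨C, fun t ht => (ofReal_mul_nablaWeighted_le hl hlK j ht.1 _ _).trans (hb t ht)⟩
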